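/- Let $G$ be a finitely generated group, and let $\mathcal E$ be a conjugacy-invariant family of subgroups of $G$ such that any subgroup commensurable with a member of $\mathcal E$ lies in $\mathcal E$, and such that $[B:A]<\infty$ whenever $A\subset B$ are members of $\mathcal E$. Let $T$ be a simplicial tree on which $G$ acts without inversions, which is minimal (it has no proper $G$-invariant subtree) and whose edge stabilizers all belong to $\mathcal E$. **Tree of cylinders.** A cylinder of $T$ is an equivalence class of non-oriented edges, two edges being equivalent if their stabilizers are commensurable; it is identified with the union of its edges. $T_c$ is the bipartite graph whose vertices are the vertices of $T$ that belong to at least two cylinders, together with the cylinders of $T$; a vertex $x$ and a cylinder $Y$ are joined by an edge if and only if $x\in Y$. **Almost invariant sets.** For $H\le G$, a subset of $G$ is $H$-finite if it is contained in finitely many cosets $Hg$. An almost invariant set over $H$ is a subset $X\subset G$ with $HX=X$ such that the symmetric difference of $Xs$ and $X$ is $H$-finite for every $s\in G$. It is non-trivial if neither $X$ nor its complement $X^*$ is $H$-finite. Almost invariant sets $X$ over $H$ and $Y$ over $K$ are equivalent if their symmetric difference is $H$-finite and $K$-finite; $[X]$ denotes the class of $X$ for the equivalence relation generated in this way. $X$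 crosses $Y$ if none of $X\cap Y$, $X^*\cap Y$, $X\cap Y^*$, $X^*\cap Y^*$ is $H$-finite. $G$ acts on classes by left translation. **The set $\mathcal B(T)$.** Fix a vertex $v_0$ of $T$. For an oriented edge $e$, let $Z_e$ be the set of $g\in G$ such that $gv_0$ lies in the component of $T$ minus the open edge $e$ that contains the terminal vertex of $e$. $\mathcal B(T)$ is the set of classes $[X]$ for which there is a cylinder $Y$ such that $X$ is a Boolean combination of sets $Z_e$, with $e$ an edge of $Y$, viewed as an almost invariant set over a subgroup commensurable with the stabilizers of the edges of $Y$. **Regular neighbourhood.** Let $\mathcal X$ be a $G$-invariant set of classes. A cross-connected component of $\mathcal X$ is an equivalence class for the equivalence relation generated by crossing on the set of unordered pairs $\{[X],[X^*]\}$ with $[X]\in\mathcal X$ and $X$ non-trivial. Given three distinct cross-connected components, $C_2$ is between $C_1$ and $C_3$ if there are almost invariant sets $X_1\subset X_2\subset X_3$ with $\{[X_i],[X_i^*]\}\in C_i$. A star is a set of cross-connected components that contains at least two elements and is maximal for the property that no cross-connected component is between two of its elements. $RN(\mathcal X)$ is the bipartite graph, with its natural action of $G$, whose vertices are the cross-connected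 components and the stars of $\mathcal X$, with an edge between $C$ and $\Sigma$ if and only if $C\in\Sigma$. **Theorem.** $RN(\mathcal B(T))$ is $G$-equivariantly isomorphic to a $G$-invariant subdivision of $T_c$ (obtained by inserting finitely many vertices in the interior of each edge). In particular, if $T$ is not a single point, then $RN(\mathcal B(T))$ is a tree. -/

import Mathlib

open scoped Pointwise symmDiff

/-! ### Bipartite graphs, their subdivisions, and group actions on them -/

/-- A relation between two `G`-sets is `G`-invariant. -/
class InvariantRel (G : Type*) {A B : Type*} [SMul G A] [SMul G B] (r : A → B → Prop) : Prop where
  smul_rel : ∀ (g : G) (a : A) (b : B), r a b → r (g • a) (g • b)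

/-- The bipartite graph on `A ⊔ B` with an edge between `a` and `b` if and only if `r a b`. -/
def bipartiteGraph {A B : Type*} (r : A → B → Prop) : SimpleGraph (A ⊕ B) where
  Adj
    | .inl a, .inr b => r a b
    | .inr b, .inl a => r a b
    | _, _ => False
  symm := ⟨by rintro (a | b) (a' | b') h <;> exact h⟩
  loopless := ⟨by rintro (a | b) h <;> exact h⟩

/-- The edges of `bipartiteGraph r`. -/
abbrev BipEdge {A B : Type*} (r : A → B → Prop) : Type _ := {p : A × B // r p.1 p.2}

instance BipEdge.mulAction (G : Type*) {A B : Type*} [Group G] [MulAction G A] [MulAction G B]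
    (r : A → B → Prop) [InvariantRel G r] : MulAction G (BipEdge r) where
  smul g p := ⟨g • p.1, InvariantRel.smul_rel g _ _ p.2⟩
  one_smul p := Subtype.ext (one_smul G p.1)
  mul_smul g h p := Subtype.ext (mul_smul g h p.1)

/-- The data of a `G`-invariant subdivision of `bipartiteGraph r`: the edge `ε` is to be subdivided
by inserting `num ε` new vertices in its interior. -/
structure SubdivisionData (G : Type*) {A B : Type*} [Group G] [MulAction G A] [MulAction G B]
    (r : A → B → Prop) [InvariantRel G r] where
  num : BipEdge r → ℕ
  num_smul : ∀ (g : G) (ε : BipEdge r), num (g • ε) = num ε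

namespace SubdivisionData

variable {G A B : Type*} [Group G] [MulAction G A] [MulAction G B]
  {r : A → B → Prop} [InvariantRel G r]

/-- The vertices inserted by the subdivision: `(ε, k)` is the `k`-th new vertex on the edge
`ε = (a, b)`, counted from `a`, starting at `0`. -/
abbrev NewVertex (D : SubdivisionData G r) : Type _ := {q : BipEdge r × ℕ // q.2 < D.num q.1}

/-- The vertices of the subdivided graph. -/
abbrev Vertex (D : SubdivisionData G r) : Type _ := (A ⊕ B) ⊕ D.NewVertex

instance (D : SubdivisionData G r) : MulAction G D.NewVertex where
  smul g q := ⟨(g • q.1.1, q.1.2), by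
    have h := q.2
    have h' := D.num_smul g q.1.1
    simp only [h']
    exact h⟩
  one_smul q := Subtype.ext (Prod.ext (one_smul G q.1.1) rfl)
  mul_smul g h q := Subtype.ext (Prod.ext (mul_smul g h q.1.1) rfl)

/-- The `k`-th vertex, `0 ≤ k ≤ num ε + 1`, on the subdivided edge `ε = (a, b)`:
it is `a` for `k = 0`, `b` for `k = num ε + 1`, and a new vertex in between. -/
def point (D : SubdivisionData G r) (ε : BipEdge r) : ℕ → D.Vertex
  | 0 => .inl (.inl ε.1.1)
  | k + 1 => if h : k < D.num ε then .inr ⟨(ε, k), h⟩ else .inl (.inr ε.1.2)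

/-- The subdivided graph: each edge `ε` is replaced by the path
`point ε 0, point ε 1, …, point ε (num ε + 1)`. -/
def graph (D : SubdivisionData G r) : SimpleGraph D.Vertex :=
  SimpleGraph.fromRel fun p q => ∃ ε : BipEdge r, ∃ k ≤ D.num ε,
    p = D.point ε k ∧ q = D.point ε (k + 1)

end SubdivisionData

/-! ### Almost invariant sets -/

/-- `X ⊆ G` is `H`-finite: it is contained in finitely many orbits of `H` acting by left
multiplication. -/
def HFinite {G : Type*} [Group G] (H : Subgroup G) (X : Set G) : Prop :=
  ∃ F : Set G, F.Finite ∧ X ⊆ (H : Set G) * F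

/-- An almost invariant subset `carrier` of `G`, over the subgroup `grp`. -/
@[ext]
structure AISet (G : Type*) [Group G] where
  carrier : Set G
  grp : Subgroup G
  mul_mem : ∀ h ∈ grp, ∀ x ∈ carrier, h * x ∈ carrier
  almost_inv : ∀ s : G, HFinite grp (((fun x => x * s) '' carrier) ∆ carrier)

namespace AISet

variable {G : Type*} [Group G]

/-- The complement `X^*`. -/
def compl (X : AISet G) : AISet G where
  carrier := X.carrierᶜ
  grp := X.grp
  mul_mem h hh x hx hx' := hx (by simpa using X.mul_mem h⁻¹ (X.grp.inv_mem hh) _ hx')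
  almost_inv s := by
    have h := X.almost_inv s
    rwa [Set.image_compl_eq (mul_left_injective s |> fun hi =>
      ⟨hi, fun y => ⟨y * s⁻¹, by simp⟩⟩), compl_symmDiff_compl]

/-- The left translate `gX`, an almost invariant set over `g H g⁻¹`. -/
instance : SMul G (AISet G) where
  smul g X :=
    { carrier := g • X.carrier
      grp := MulAut.conj g • X.grp
      mul_mem := by
        rintro h hh x hx
        rw [Set.mem_smul_set_iff_inv_smul_mem] at hx ⊢
        rw [Subgroup.mem_pointwise_smul_iff_inv_smul_mem] at hh
        have := X.mul_mem _ hh _ hx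
        simpa [mul_assoc] using this
      almost_inv := by
        intro s
        obtain ⟨F, hF, hsub⟩ := X.almost_inv s
        refine ⟨g • F, hF.smul_set, ?_⟩
        intro x hx
        have hx' : g⁻¹ * x ∈ ((fun x => x * s) '' X.carrier) ∆ X.carrier := by
          simp only [Set.mem_symmDiff, Set.mem_image, Set.mem_smul_set_iff_inv_smul_mem,
            smul_eq_mul] at hx ⊢
          have key : (∃ y, g⁻¹ * y ∈ X.carrier ∧ y * s = x) ↔
              ∃ y ∈ X.carrier, y * s = g⁻¹ * x := by
            constructor
            · rintro ⟨y, hy, rfl⟩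
              exact ⟨_, hy, by group⟩
            · rintro ⟨y, hy, h⟩
              refine ⟨g * y, by simpa using hy, ?_⟩
              rw [mul_assoc, h]
              group
          rwa [key] at hx
        obtain ⟨h, hh, f, hf, hfx⟩ := Set.mem_mul.1 (hsub hx')
        refine Set.mem_mul.2 ⟨g * h * g⁻¹, ?_, g * f, Set.smul_mem_smul_set hf, ?_⟩
        · exact Subgroup.smul_mem_pointwise_smul h (MulAut.conj g) X.grp hh
        · rw [show g * h * g⁻¹ * (g * f) = g * (h * f) by group, hfx]
          group }

theorem smul_carrier (g : G) (X : AISet G) : (g • X).carrier = g • X.carrier := rfl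

theorem smul_grp (g : G) (X : AISet G) : (g • X).grp = MulAut.conj g • X.grp := rfl

instance : MulAction G (AISet G) where
  one_smul X := AISet.ext (by simp [smul_carrier]) (by simp [smul_grp])
  mul_smul g h X := AISet.ext (by simp [smul_carrier, mul_smul]) (by simp [smul_grp, mul_smul])

theorem smul_compl (g : G) (X : AISet G) : (g • X).compl = g • X.compl :=
  AISet.ext (Set.smul_set_compl (a := g) (s := X.carrier)).symm rfl

/-- `X` is non-trivial: neither `X` nor `X^*` is `H`-finite. -/
def Nontrivial (X : AISet G) : Prop :=
  ¬ HFinite X.grp X.carrier ∧ ¬ HFinite X.grp X.carrierᶜ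

/-- `X` (over `H`) and `Y` (over `K`) are equivalent: their symmetric difference is `H`-finite and
`K`-finite. For non-trivial `X` and `Y` the two conditions imply each other. -/
def Equiv (X Y : AISet G) : Prop :=
  HFinite X.grp (X.carrier ∆ Y.carrier) ∧ HFinite Y.grp (X.carrier ∆ Y.carrier)

/-- `X` crosses `Y`: none of the four sets `X^(*) ∩ Y^(*)` is small, that is, `H`-finite. -/
def Crosses (X Y : AISet G) : Prop :=
  ¬ HFinite X.grp (X.carrier ∩ Y.carrier) ∧ ¬ HFinite X.grp (X.carrierᶜ ∩ Y.carrier) ∧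
  ¬ HFinite X.grp (X.carrier ∩ Y.carrierᶜ) ∧ ¬ HFinite X.grp (X.carrierᶜ ∩ Y.carrierᶜ)

theorem HFinite_smul_iff (g : G) (H : Subgroup G) (X : Set G) :
    HFinite (MulAut.conj g • H) (g • X) ↔ HFinite H X := by
  have key : ∀ (g : G) (H : Subgroup G) (X : Set G), HFinite H X →
      HFinite (MulAut.conj g • H) (g • X) := by
    rintro g H X ⟨F, hF, hsub⟩
    refine ⟨g • F, hF.smul_set, ?_⟩
    rintro _ ⟨x, hx, rfl⟩
    obtain ⟨h, hh, f, hf, rfl⟩ := Set.mem_mul.1 (hsub hx)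
    refine Set.mem_mul.2 ⟨g * h * g⁻¹, ?_, g * f, Set.smul_mem_smul_set hf, ?_⟩
    · exact Subgroup.smul_mem_pointwise_smul h (MulAut.conj g) H hh
    · simp only [smul_eq_mul]
      group
  refine ⟨fun h => ?_, key g H X⟩
  have := key g⁻¹ _ _ h
  rwa [map_inv, inv_smul_smul, inv_smul_smul] at this

theorem Equiv.compl {X Y : AISet G} (h : X.Equiv Y) : X.compl.Equiv Y.compl := by
  unfold AISet.Equiv AISet.compl at *
  simpa only [compl_symmDiff_compl] using h

theorem Equiv.smul {X Y : AISet G} (h : X.Equiv Y) (g : G) : (g • X).Equiv (g • Y) := by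
  have e : g • X.carrier ∆ Y.carrier = (g • X.carrier) ∆ (g • Y.carrier) := Set.smul_set_symmDiff
  unfold AISet.Equiv
  rw [smul_carrier, smul_carrier, smul_grp, smul_grp, ← e, HFinite_smul_iff, HFinite_smul_iff]
  exact h

theorem Nontrivial.smul {X : AISet G} (h : X.Nontrivial) (g : G) : (g • X).Nontrivial := by
  unfold AISet.Nontrivial
  rw [smul_carrier, smul_grp, ← Set.smul_set_compl, HFinite_smul_iff, HFinite_smul_iff]
  exact h

theorem Crosses.smul {X Y : AISet G} (h : X.Crosses Y) (g : G) : (g • X).Crosses (g • Y) := by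
  unfold AISet.Crosses
  rw [smul_carrier, smul_carrier, smul_grp]
  simp only [← Set.smul_set_compl, ← Set.smul_set_inter, HFinite_smul_iff]
  exact h

end AISet

/-- The set `𝓑` of equivalence classes of almost invariant subsets of `G`. -/
def AIClass (G : Type*) [Group G] : Type _ := Quot (AISet.Equiv (G := G))

namespace AIClass

variable {G : Type*} [Group G]

/-- The class `[X]`. -/
def mk (X : AISet G) : AIClass G := Quot.mk _ X

/-- The class `[X^*]` as a function of `[X]`. -/
def compl : AIClass G → AIClass G := Quot.map AISet.compl fun _ _ h => h.compl

/-- `G` acts on classes by left translation. -/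
instance : MulAction G (AIClass G) where
  smul g := Quot.map (g • ·) fun _ _ h => h.smul g
  one_smul := by rintro ⟨X⟩; exact congrArg mk (one_smul G X)
  mul_smul g h := by rintro ⟨X⟩; exact congrArg mk (mul_smul g h X)

theorem smul_mk (g : G) (X : AISet G) : g • mk X = mk (g • X) := rfl

/-- The unordered pair `{[X], [X^*]}`. -/
def pair (X : AISet G) : Set (AIClass G) := {mk X, compl (mk X)}

theorem smul_pair (g : G) (X : AISet G) : g • pair X = pair (g • X) := by
  have h : g • compl (mk X) = compl (mk (g • X)) := congrArg mk (AISet.smul_compl g X).symm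
  rw [pair, ← Set.image_smul, Set.image_pair, h, smul_mk, pair]

end AIClass

/-! ### Cross-connected components and regular neighbourhoods -/

section RegularNeighbourhood

variable {G : Type*} [Group G]

/-- `p` crosses `q`, for unordered pairs `p = {[X], [X^*]}` and `q = {[Y], [Y^*]}`. -/
def PairCrosses (p q : Set (AIClass G)) : Prop :=
  ∃ X Y : AISet G, p = AIClass.pair X ∧ q = AIClass.pair Y ∧ X.Crosses Y

/-- For a `G`-invariant set `𝒳` of classes, the set of non-trivial unordered pairs `{[X], [X^*]}`
with `[X] ∈ 𝒳`. -/
def pairs (𝒳 : SubMulAction G (AIClass G)) : Set (Set (AIClass G)) :=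
  {p | ∃ X : AISet G, X.Nontrivial ∧ AIClass.mk X ∈ 𝒳 ∧ p = AIClass.pair X}

/-- The equivalence relation generated on `pairs 𝒳` by crossing. -/
def CrossEquiv (𝒳 : SubMulAction G (AIClass G)) : Set (AIClass G) → Set (AIClass G) → Prop :=
  Relation.EqvGen fun p q => p ∈ pairs 𝒳 ∧ q ∈ pairs 𝒳 ∧ PairCrosses p q

/-- `C` is a cross-connected component of `𝒳`. -/
def IsCCC (𝒳 : SubMulAction G (AIClass G)) (C : Set (Set (AIClass G))) : Prop :=
  ∃ p ∈ pairs 𝒳, C = {q | q ∈ pairs 𝒳 ∧ CrossEquiv 𝒳 p q}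

/-- `C₂` is between `C₁` and `C₃`: the three are distinct, and there are almost invariant sets
`Xᵢ` representing `Cᵢ` such that `X₁ ⊆ X₂ ⊆ X₃`. -/
def Between (C₁ C₂ C₃ : Set (Set (AIClass G))) : Prop :=
  (C₁ ≠ C₂ ∧ C₂ ≠ C₃ ∧ C₁ ≠ C₃) ∧ ∃ X₁ X₂ X₃ : AISet G,
    AIClass.pair X₁ ∈ C₁ ∧ AIClass.pair X₂ ∈ C₂ ∧ AIClass.pair X₃ ∈ C₃ ∧
    X₁.carrier ⊆ X₂.carrier ∧ X₂.carrier ⊆ X₃.carrier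

/-- `S` is a set of cross-connected components of `𝒳` such that no cross-connected component is
between two elements of `S`. -/
def NoneBetween (𝒳 : SubMulAction G (AIClass G)) (S : Set (Set (Set (AIClass G)))) : Prop :=
  (∀ C ∈ S, IsCCC 𝒳 C) ∧ ∀ C ∈ S, ∀ C' ∈ S, ∀ C'', IsCCC 𝒳 C'' → ¬ Between C C'' C'

/-- `S` is a star: it has at least two elements, and it is maximal for `NoneBetween`. -/
def IsStar (𝒳 : SubMulAction G (AIClass G)) (S : Set (Set (Set (AIClass G)))) : Prop :=
  S.Nontrivial ∧ Maximal (NoneBetween 𝒳) S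

theorem smul_mem_pairs {𝒳 : SubMulAction G (AIClass G)} {p : Set (AIClass G)} (hp : p ∈ pairs 𝒳)
    (g : G) : g • p ∈ pairs 𝒳 := by
  obtain ⟨X, hX, hX', rfl⟩ := hp
  exact ⟨g • X, hX.smul g, 𝒳.smul_mem g hX', AIClass.smul_pair g X⟩

theorem CrossEquiv.smul {𝒳 : SubMulAction G (AIClass G)} {p q : Set (AIClass G)}
    (h : CrossEquiv 𝒳 p q) (g : G) : CrossEquiv 𝒳 (g • p) (g • q) := by
  induction h with
  | rel p q h =>
    obtain ⟨hp, hq, X, Y, rfl, rfl, hc⟩ := h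
    exact .rel _ _ ⟨smul_mem_pairs hp g, smul_mem_pairs hq g, g • X, g • Y,
      AIClass.smul_pair g X, AIClass.smul_pair g Y, hc.smul g⟩
  | refl p => exact .refl _
  | symm p q _ ih => exact .symm _ _ ih
  | trans p q r _ _ ih₁ ih₂ => exact .trans _ _ _ ih₁ ih₂

theorem IsCCC.smul {𝒳 : SubMulAction G (AIClass G)} {C : Set (Set (AIClass G))} (h : IsCCC 𝒳 C)
    (g : G) : IsCCC 𝒳 (g • C) := by
  obtain ⟨p, hp, rfl⟩ := h
  refine ⟨g • p, smul_mem_pairs hp g, ?_⟩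
  ext q
  rw [Set.mem_smul_set_iff_inv_smul_mem]
  constructor
  · rintro ⟨h₁, h₂⟩
    have h₁' := smul_mem_pairs h₁ g
    have h₂' := h₂.smul g
    rw [smul_inv_smul] at h₁' h₂'
    exact ⟨h₁', h₂'⟩
  · rintro ⟨h₁, h₂⟩
    have h₂' := h₂.smul g⁻¹
    rw [inv_smul_smul] at h₂'
    exact ⟨smul_mem_pairs h₁ g⁻¹, h₂'⟩

theorem Between.smul {C₁ C₂ C₃ : Set (Set (AIClass G))} (h : Between C₁ C₂ C₃) (g : G) :
    Between (g • C₁) (g • C₂) (g • C₃) := by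
  obtain ⟨⟨h₁, h₂, h₃⟩, X₁, X₂, X₃, m₁, m₂, m₃, s₁, s₂⟩ := h
  refine ⟨⟨?_, ?_, ?_⟩, g • X₁, g • X₂, g • X₃, ?_, ?_, ?_, Set.smul_set_mono s₁,
    Set.smul_set_mono s₂⟩
  · exact fun h => h₁ (smul_left_cancel g h)
  · exact fun h => h₂ (smul_left_cancel g h)
  · exact fun h => h₃ (smul_left_cancel g h)
  · exact AIClass.smul_pair g X₁ ▸ Set.smul_mem_smul_set m₁
  · exact AIClass.smul_pair g X₂ ▸ Set.smul_mem_smul_set m₂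
  · exact AIClass.smul_pair g X₃ ▸ Set.smul_mem_smul_set m₃

theorem NoneBetween.smul {𝒳 : SubMulAction G (AIClass G)} {S : Set (Set (Set (AIClass G)))}
    (h : NoneBetween 𝒳 S) (g : G) : NoneBetween 𝒳 (g • S) := by
  constructor
  · rintro _ ⟨C, hC, rfl⟩
    exact (h.1 C hC).smul g
  · rintro _ ⟨C, hC, rfl⟩ _ ⟨C', hC', rfl⟩ C'' hC'' hb
    have hb' := hb.smul g⁻¹
    simp only [inv_smul_smul] at hb'
    exact h.2 C hC C' hC' _ (hC''.smul g⁻¹) hb'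

theorem IsStar.smul {𝒳 : SubMulAction G (AIClass G)} {S : Set (Set (Set (AIClass G)))}
    (h : IsStar 𝒳 S) (g : G) : IsStar 𝒳 (g • S) := by
  refine ⟨h.1.image (MulAction.injective g), h.2.1.smul g, fun S' hS' hle => ?_⟩
  have h₁ : S ≤ g⁻¹ • S' := by
    have := Set.smul_set_mono (a := g⁻¹) hle
    rwa [inv_smul_smul] at this
  have h₂ := h.2.2 (hS'.smul g⁻¹) h₁
  have := Set.smul_set_mono (a := g) h₂
  rwa [smul_inv_smul] at this

/-- The type of cross-connected components of `𝒳`. -/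
def CCC (𝒳 : SubMulAction G (AIClass G)) : Type _ := {C : Set (Set (AIClass G)) // IsCCC 𝒳 C}

/-- The type of stars of `𝒳`. -/
def RNStar (𝒳 : SubMulAction G (AIClass G)) : Type _ :=
  {S : Set (Set (Set (AIClass G))) // IsStar 𝒳 S}

instance (𝒳 : SubMulAction G (AIClass G)) : MulAction G (CCC 𝒳) where
  smul g C := ⟨g • C.1, C.2.smul g⟩
  one_smul C := Subtype.ext (one_smul G C.1)
  mul_smul g h C := Subtype.ext (mul_smul g h C.1)

instance (𝒳 : SubMulAction G (AIClass G)) : MulAction G (RNStar 𝒳) where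
  smul g S := ⟨g • S.1, S.2.smul g⟩
  one_smul S := Subtype.ext (one_smul G S.1)
  mul_smul g h S := Subtype.ext (mul_smul g h S.1)

/-- The regular neighbourhood `RN(𝒳)`: the bipartite graph whose vertices are the cross-connected
components and the stars of `𝒳`, and whose edges are the pairs `(C, Σ)` with `C ∈ Σ`. The group `G`
acts on its vertices through its actions on `CCC 𝒳` and `RNStar 𝒳`. -/
def regularNeighbourhood (𝒳 : SubMulAction G (AIClass G)) : SimpleGraph (CCC 𝒳 ⊕ RNStar 𝒳) :=
  bipartiteGraph fun (C : CCC 𝒳) (S : RNStar 𝒳) => C.1 ∈ S.1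

end RegularNeighbourhood

/-! ### Trees with a group action, and trees of cylinders -/

/-- The action of a group on unordered pairs of elements of a `G`-set. -/
instance Sym2.mulActionOfMulAction (G V : Type*) [Group G] [MulAction G V] :
    MulAction G (Sym2 V) where
  smul g := Sym2.map (g • ·)
  one_smul := by
    rintro ⟨v, w⟩
    change s((1 : G) • v, (1 : G) • w) = s(v, w)
    rw [one_smul, one_smul]
  mul_smul g h := by
    rintro ⟨v, w⟩
    change s((g * h) • v, (g * h) • w) = s(g • h • v, g • h • w)
    rw [mul_smul, mul_smul]

/-- A simplicial tree with vertex set `V` on which `G` acts without inversions. -/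
structure GTree (G V : Type*) [Group G] [MulAction G V] where
  graph : SimpleGraph V
  isTree : graph.IsTree
  smul_adj : ∀ (g : G) (v w : V), graph.Adj v w → graph.Adj (g • v) (g • w)
  no_inversion : ∀ (g : G) (v w : V), graph.Adj v w → ¬ (g • v = w ∧ g • w = v)

/-- A conjugacy-invariant family of subgroups that is stable under commensurability, and in which
no member contains another one with infinite index. -/
structure IsCylinderFamily {G : Type*} [Group G] (𝓔 : Set (Subgroup G)) : Prop where
  conj_mem : ∀ (g : G), ∀ A ∈ 𝓔, MulAut.conj g • A ∈ 𝓔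
  mem_of_commensurable : ∀ A B : Subgroup G, B ∈ 𝓔 → Subgroup.Commensurable A B → A ∈ 𝓔
  finite_index : ∀ A ∈ 𝓔, ∀ B ∈ 𝓔, A ≤ B → A.IsFiniteRelIndex B

namespace GTree

variable {G V : Type*} [Group G] [MulAction G V]

/-- `T` is minimal: it has no proper `G`-invariant subtree. -/
def IsMinimal (T : GTree G V) : Prop :=
  ∀ S : Set V, (∀ (g : G), ∀ v ∈ S, g • v ∈ S) → (T.graph.induce S).Connected → S = Set.univ

/-- `T` is an `𝓔`-tree: its edge stabilizers belong to `𝓔`. -/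
def IsTreeOver (T : GTree G V) (𝓔 : Set (Subgroup G)) : Prop :=
  ∀ e ∈ T.graph.edgeSet, MulAction.stabilizer G e ∈ 𝓔

/-- `Y` is a cylinder: an equivalence class of edges, for commensurability of stabilizers. -/
def IsCylinder (T : GTree G V) (Y : Set (Sym2 V)) : Prop :=
  ∃ e ∈ T.graph.edgeSet, Y = {f | f ∈ T.graph.edgeSet ∧
    Subgroup.Commensurable (MulAction.stabilizer G e) (MulAction.stabilizer G f)}

/-- The cylinder `Y`, viewed as a union of edges, contains the vertex `x`. -/
def VertexMem (x : V) (Y : Set (Sym2 V)) : Prop := ∃ e ∈ Y, x ∈ e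

theorem smul_mem_edgeSet (T : GTree G V) (g : G) {e : Sym2 V} (he : e ∈ T.graph.edgeSet) :
    g • e ∈ T.graph.edgeSet := by
  induction e with
  | h v w => exact T.smul_adj g v w he

theorem commensurable_smul (g : G) {e f : Sym2 V}
    (h : Subgroup.Commensurable (MulAction.stabilizer G e) (MulAction.stabilizer G f)) :
    Subgroup.Commensurable (MulAction.stabilizer G (g • e)) (MulAction.stabilizer G (g • f)) := by
  rw [MulAction.stabilizer_smul_eq_stabilizer_map_conj,
    MulAction.stabilizer_smul_eq_stabilizer_map_conj]
  have hi : Function.Injective (MulAut.conj g).toMonoidHom := (MulAut.conj g).injective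
  unfold Subgroup.Commensurable at h ⊢
  rwa [Subgroup.relIndex_map_map_of_injective _ _ hi, Subgroup.relIndex_map_map_of_injective _ _ hi]

theorem IsCylinder.smul {T : GTree G V} {Y : Set (Sym2 V)} (h : T.IsCylinder Y) (g : G) :
    T.IsCylinder (g • Y) := by
  obtain ⟨e, he, rfl⟩ := h
  refine ⟨g • e, T.smul_mem_edgeSet g he, ?_⟩
  ext f
  rw [Set.mem_smul_set_iff_inv_smul_mem]
  constructor
  · rintro ⟨h₁, h₂⟩
    have h₁' := T.smul_mem_edgeSet g h₁
    have h₂' := commensurable_smul g h₂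
    rw [smul_inv_smul] at h₁' h₂'
    exact ⟨h₁', h₂'⟩
  · rintro ⟨h₁, h₂⟩
    have h₂' := commensurable_smul g⁻¹ h₂
    rw [inv_smul_smul] at h₂'
    exact ⟨T.smul_mem_edgeSet g⁻¹ h₁, h₂'⟩

theorem VertexMem.smul {x : V} {Y : Set (Sym2 V)} (h : VertexMem x Y) (g : G) :
    VertexMem (g • x) (g • Y) := by
  obtain ⟨e, he, hx⟩ := h
  exact ⟨g • e, Set.smul_mem_smul_set he, Sym2.mem_map.2 ⟨x, hx, rfl⟩⟩

/-- The set `V₀(T_c)` of vertices of `T` belonging to at least two distinct cylinders. -/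
def V₀ (T : GTree G V) : Type _ :=
  {x : V // ∃ Y Y' : Set (Sym2 V), T.IsCylinder Y ∧ T.IsCylinder Y' ∧ Y ≠ Y' ∧
    VertexMem x Y ∧ VertexMem x Y'}

/-- The set `V₁(T_c)` of cylinders of `T`. -/
def V₁ (T : GTree G V) : Type _ := {Y : Set (Sym2 V) // T.IsCylinder Y}

instance (T : GTree G V) : MulAction G T.V₀ where
  smul g x := ⟨g • x.1, by
    obtain ⟨x, Y, Y', hY, hY', hne, hx, hx'⟩ := x
    exact ⟨g • Y, g • Y', hY.smul g, hY'.smul g, fun h => hne (smul_left_cancel g h),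
      hx.smul g, hx'.smul g⟩⟩
  one_smul x := Subtype.ext (one_smul G x.1)
  mul_smul g h x := Subtype.ext (mul_smul g h x.1)

instance (T : GTree G V) : MulAction G T.V₁ where
  smul g Y := ⟨g • Y.1, Y.2.smul g⟩
  one_smul Y := Subtype.ext (one_smul G Y.1)
  mul_smul g h Y := Subtype.ext (mul_smul g h Y.1)

/-- Incidence in the tree of cylinders: the vertex `x` of `T` belongs to the cylinder `Y`.
The tree of cylinders `T_c` is `bipartiteGraph T.cylinderIncidence`. -/
def cylinderIncidence (T : GTree G V) (x : T.V₀) (Y : T.V₁) : Prop := VertexMem x.1 Y.1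

instance (T : GTree G V) : InvariantRel G T.cylinderIncidence where
  smul_rel g _ _ h := VertexMem.smul h g

/-! ### Almost invariant sets based on a tree -/

/-- For an edge `vw` of `T`, the connected component of `T` minus the open edge that
contains `w`. -/
def halfTree (T : GTree G V) (v w : V) : Set V :=
  {x | (T.graph.deleteEdges {s(v, w)}).Reachable w x}

/-- The set `Z_e` of all `g` with `g v₀` in the half-tree `T_e`, for the edge `e = vw` oriented from
`v` to `w`. -/
def halfSet (T : GTree G V) (v₀ v w : V) : Set G := {g | g • v₀ ∈ T.halfTree v w}

/-- The sets `Z_e` for the oriented edges `e` of the cylinder `Y`. -/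
def halfSets (T : GTree G V) (v₀ : V) (Y : Set (Sym2 V)) : Set (Set G) :=
  {Z | ∃ v w : V, s(v, w) ∈ Y ∧ Z = T.halfSet v₀ v w}

theorem smul_halfTree_subset (T : GTree G V) (g : G) {v w x : V} (h : x ∈ T.halfTree v w) :
    g • x ∈ T.halfTree (g • v) (g • w) := by
  let φ : T.graph.deleteEdges {s(v, w)} →g T.graph.deleteEdges {s(g • v, g • w)} :=
    { toFun := (g • ·)
      map_rel' := by
        intro a b hab
        rw [SimpleGraph.deleteEdges_adj] at hab ⊢
        refine ⟨T.smul_adj g a b hab.1, fun h => hab.2 ?_⟩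
        exact Sym2.map.injective (MulAction.injective g) (h : Sym2.map (g • ·) s(a, b) =
          Sym2.map (g • ·) s(v, w)) }
  exact SimpleGraph.Reachable.map φ h

theorem smul_halfSet (T : GTree G V) (g : G) (v₀ v w : V) :
    g • T.halfSet v₀ v w = T.halfSet v₀ (g • v) (g • w) := by
  ext x
  rw [Set.mem_smul_set_iff_inv_smul_mem]
  constructor
  · intro h
    have := T.smul_halfTree_subset g (show (g⁻¹ • x) • v₀ ∈ T.halfTree v w from h)
    rwa [smul_assoc, smul_inv_smul] at this
  · intro h
    have := T.smul_halfTree_subset g⁻¹ (show x • v₀ ∈ T.halfTree (g • v) (g • w) from h)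
    rw [inv_smul_smul, inv_smul_smul, ← smul_assoc] at this
    exact this

theorem smul_mem_closure_halfSets (T : GTree G V) (g : G) {v₀ : V} {Y : Set (Sym2 V)} {Z : Set G}
    (h : Z ∈ BooleanSubalgebra.closure (T.halfSets v₀ Y)) :
    g • Z ∈ BooleanSubalgebra.closure (T.halfSets v₀ (g • Y)) := by
  induction h using BooleanSubalgebra.closure_bot_sup_induction with
  | mem Z hZ =>
    obtain ⟨v, w, he, rfl⟩ := hZ
    exact BooleanSubalgebra.subset_closure
      ⟨g • v, g • w, Set.smul_mem_smul_set he, T.smul_halfSet g v₀ v w⟩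
  | bot =>
    have e : g • (⊥ : Set G) = ⊥ := Set.smul_set_empty
    rw [e]
    exact BooleanSubalgebra.bot_mem
  | sup x hx y hy ihx ihy =>
    have e : g • (x ⊔ y) = g • x ⊔ g • y := Set.smul_set_union
    rw [e]
    exact BooleanSubalgebra.supClosed _ ihx ihy
  | compl x hx ih =>
    rw [Set.smul_set_compl]
    exact BooleanSubalgebra.compl_mem ih

/-- The set `𝓑(T)` of (classes of) almost invariant sets based on `T`: the union over all cylinders
`Y` of the sets of classes of Boolean combinations of the sets `Z_e`, `e` an edge of `Y`, viewed as
almost invariant sets over subgroups commensurable with the stabilizers of edges of `Y`. -/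
def based (T : GTree G V) (v₀ : V) : SubMulAction G (AIClass G) where
  carrier := {a | ∃ Y : Set (Sym2 V), T.IsCylinder Y ∧ ∃ X : AISet G,
    X.carrier ∈ BooleanSubalgebra.closure (T.halfSets v₀ Y) ∧
    (∃ e ∈ Y, Subgroup.Commensurable X.grp (MulAction.stabilizer G e)) ∧ a = AIClass.mk X}
  smul_mem' := by
    rintro g _ ⟨Y, hY, X, hX, ⟨e, he, hc⟩, rfl⟩
    refine ⟨g • Y, hY.smul g, g • X, T.smul_mem_closure_halfSets g hX,
      ⟨g • e, Set.smul_mem_smul_set he, ?_⟩, rfl⟩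
    rw [MulAction.stabilizer_smul_eq_stabilizer_map_conj, AISet.smul_grp]
    have hi : Function.Injective (MulAut.conj g).toMonoidHom := (MulAut.conj g).injective
    unfold Subgroup.Commensurable at hc ⊢
    have e₁ : MulAut.conj g • X.grp = X.grp.map (MulAut.conj g).toMonoidHom := rfl
    rwa [e₁, Subgroup.relIndex_map_map_of_injective _ _ hi,
      Subgroup.relIndex_map_map_of_injective _ _ hi]

end GTree

/-! Everything is transported from subsets of `G` to sets of vertices of `T`. By induction on the
number of boundary edges, the Boolean combinations of the sets `Z_e`, with `e` in a cylinder `Y`,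
are exactly the preimages under `g ↦ g v₀` of the vertex sets whose boundary is a finite set of
edges of `Y`: these are the cuts of `Y` (`exists_isCut_of_mem_closure`,
`IsCut.pullback_mem_closure`). A non-trivial class determines its group up to commensurability,
hence its cylinder. So each cylinder carries its own Boolean algebra of cuts modulo small sets.

The hypotheses on `𝓔` only serve to make cylinders convex (`IsTreeOver.hasConvexCylinders`).
Convexity puts each other cylinder on a single side of a cut of `Y`. Therefore cuts of distinct
cylinders are nested, in a way decided by one vertex of each cylinder (`Cut.le_iff_of_ne`), and
crossing only happens inside a cylinder. There, atoms and complements of atoms cross nothing, while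
any two other cuts (`Cut.IsMid`) cross each other or cross a common third one
(`Cut.IsMid.exists_crosses_both`). Thus a cylinder has one component for each pair formed by an atom
and its complement, and one further component if it has cuts in the middle. The latter is called
main, and so is a component that is alone in its cylinder. A cylinder with exactly three atoms has
no main component.

Let `x` belong to `Y` and to another cylinder. One component of `Y` comes last on the way to `x`: it
is terminal at `x` (`existsUnique_isTerminal`). If `x` is on finitely many edges of `Y`, this is the
atom given by the component of `x` in `T` minus `Y`; otherwise it is the component of the cuts in
the middle. Conversely, a component that is not main is terminal at exactly one such vertex
(`existsUnique_isTerminal_of_not_isMain`). Finite generation is used here: if an atom contains no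
vertex of a second cylinder, cocompactness forces `T` to be a line consisting of one cylinder, which
has a single component.

Components of distinct cylinders have nothing between them exactly when they are terminal at a
common vertex (`close_iff_of_cyl_ne`). Inside a cylinder only the main component can be between two
others, and it is then between any two others (`close_iff_of_cyl_eq`). As the tree of cylinders has
no short cycles, there are three kinds of stars (`RNModel.star_cases`): the components terminal at a
vertex, all components of a cylinder without main component, and a main component together with one
other component of its cylinder. Hence the regular neighbourhood is `T_c`, where a vertex becomes
its star, a cylinder becomes its main component or its star, and each edge receives zero, one or two
new vertices. `RNModel` collects the facts used by this combinatorial step. Finally, convexity also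
shows that `T_c` is a tree, and subdividing keeps it one. -/

/-! ### `H`-finite sets -/

namespace HFinite

variable {G : Type*} [Group G] {H K : Subgroup G} {X Y : Set G}

theorem mono (h : HFinite H Y) (hXY : X ⊆ Y) : HFinite H X := by
  obtain ⟨F, hF, hsub⟩ := h
  exact ⟨F, hF, hXY.trans hsub⟩

theorem empty (H : Subgroup G) : HFinite H (∅ : Set G) := ⟨∅, Set.finite_empty, by simp⟩

theorem union (hX : HFinite H X) (hY : HFinite H Y) : HFinite H (X ∪ Y) := by
  obtain ⟨F, hF, hX⟩ := hX
  obtain ⟨F', hF', hY⟩ := hY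
  exact ⟨F ∪ F', hF.union hF', by rw [Set.mul_union]; exact Set.union_subset_union hX hY⟩

theorem biUnion {ι : Type*} {s : Set ι} (hs : s.Finite) {f : ι → Set G}
    (h : ∀ i ∈ s, HFinite H (f i)) : HFinite H (⋃ i ∈ s, f i) := by
  induction s, hs using Set.Finite.induction_on with
  | empty => simpa using HFinite.empty H
  | insert _ _ ih =>
    rw [Set.biUnion_insert]
    exact (h _ (Set.mem_insert _ _)).union (ih fun i hi => h i (Set.mem_insert_of_mem _ hi))

theorem image_mul_right (h : HFinite H X) (s : G) : HFinite H ((fun x => x * s) '' X) := by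
  obtain ⟨F, hF, hsub⟩ := h
  refine ⟨(fun x => x * s) '' F, hF.image _, ?_⟩
  rintro _ ⟨x, hx, rfl⟩
  obtain ⟨a, ha, b, hb, rfl⟩ := Set.mem_mul.1 (hsub hx)
  exact Set.mem_mul.2 ⟨a, ha, b * s, ⟨b, hb, rfl⟩, by simp [mul_assoc]⟩

/-- The saturation `H X` of an `H`-finite set is `H`-finite. -/
theorem mul_left (h : HFinite H X) : HFinite H ((H : Set G) * X) := by
  obtain ⟨F, hF, hsub⟩ := h
  refine ⟨F, hF, ?_⟩
  rintro _ ⟨a, ha, x, hx, rfl⟩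
  obtain ⟨b, hb, f, hf, rfl⟩ := Set.mem_mul.1 (hsub hx)
  exact Set.mem_mul.2 ⟨a * b, H.mul_mem ha hb, f, hf, by simp [mul_assoc]⟩

/-- Inversion exchanges the right cosets `Hf` counted by `HFinite` with the left cosets of `H ∩ K`
in `K` counted by the relative index. -/
theorem subgroup_iff : HFinite H (K : Set G) ↔ H.relIndex K ≠ 0 := by
  constructor
  · rintro ⟨F, hF, hsub⟩
    have key : ∀ k : K, ∃ f : F, ∃ h ∈ H, h * (f : G) = (k : G)⁻¹ := fun k => by
      obtain ⟨h, hh, f, hf, e⟩ := Set.mem_mul.1 (hsub (K.inv_mem k.2))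
      exact ⟨⟨f, hf⟩, h, hh, e⟩
    choose φ a ha hφ using key
    have : Finite F := hF
    have hinj : Function.Injective fun q : K ⧸ H.subgroupOf K => φ q.out := by
      intro q q' h
      rw [← q.out_eq, ← q'.out_eq]
      refine QuotientGroup.eq.2 (Subgroup.mem_subgroupOf.2 ?_)
      have h₁ := hφ q.out
      have h₂ := hφ q'.out
      have h' : (φ q.out : G) = φ q'.out := congrArg _ h
      have : ((q.out⁻¹ * q'.out : K) : G) = a q.out * (a q'.out)⁻¹ := by
        rw [Subgroup.coe_mul, Subgroup.coe_inv, ← h₁, ← inv_inv (q'.out : G), ← h₂, h']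
        group
      rw [this]
      exact H.mul_mem (ha _) (H.inv_mem (ha _))
    have := Finite.of_injective _ hinj
    exact Subgroup.index_ne_zero_of_finite
  · intro h
    have hfi : (H.subgroupOf K).FiniteIndex := ⟨h⟩
    have : Finite (K ⧸ H.subgroupOf K) := Subgroup.finite_quotient_of_finiteIndex
    refine ⟨Set.range fun q : K ⧸ H.subgroupOf K => ((q.out : K) : G)⁻¹, Set.finite_range _, ?_⟩
    intro k hk
    obtain ⟨⟨h, hh⟩, e⟩ := QuotientGroup.mk_out_eq_mul (H.subgroupOf K) (⟨k, hk⟩⁻¹ : K)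
    refine Set.mem_mul.2 ⟨(h : G), Subgroup.mem_subgroupOf.1 hh, _,
      ⟨((⟨k, hk⟩⁻¹ : K) : K ⧸ H.subgroupOf K), rfl⟩, ?_⟩
    simp only [e]
    simp

theorem of_relIndex (h : H.relIndex K ≠ 0) (hX : HFinite K X) : HFinite H X := by
  obtain ⟨F', hF', hsub'⟩ := subgroup_iff.2 h
  obtain ⟨F, hF, hsub⟩ := hX
  refine ⟨F' * F, hF'.mul hF, hsub.trans ?_⟩
  rw [← mul_assoc]
  exact Set.mul_subset_mul_right hsub'

/-- Right translation by `z⁻¹` brings the coset `Kz` back to `K`. This is how commensurability of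
groups is read off from sets. -/
theorem relIndex_ne_zero (hX : HFinite H X) {z : G} (hz : ∀ k ∈ K, k * z ∈ X) :
    H.relIndex K ≠ 0 := by
  refine subgroup_iff.1 ((hX.image_mul_right z⁻¹).mono ?_)
  intro k hk
  exact ⟨k * z, hz k hk, by simp⟩

theorem iff_of_commensurable (h : Subgroup.Commensurable H K) : HFinite H X ↔ HFinite K X :=
  ⟨of_relIndex h.2, of_relIndex h.1⟩

end HFinite

/-! ### Almost inclusion of almost invariant sets, and equality of classes -/

namespace AISet

variable {G : Type*} [Group G] {X X' Y Y' : AISet G}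

theorem compl_compl (X : AISet G) : X.compl.compl = X := AISet.ext (_root_.compl_compl _) rfl

theorem carrier_compl (X : AISet G) : X.compl.carrier = X.carrierᶜ := rfl

theorem grp_compl (X : AISet G) : X.compl.grp = X.grp := rfl

theorem Nontrivial.compl (h : X.Nontrivial) : X.compl.Nontrivial :=
  ⟨h.2, by rw [carrier_compl, _root_.compl_compl]; exact h.1⟩

theorem Equiv.symm (h : X.Equiv Y) : Y.Equiv X := by
  unfold AISet.Equiv at *
  rw [symmDiff_comm]
  exact h.symm

theorem Equiv.refl (X : AISet G) : X.Equiv X := by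
  unfold AISet.Equiv
  simp [HFinite.empty]

/-- If `Y` is not small and `X ∩ Y` is small as a subset of `Y`, then it is small as a subset
of `X`. -/
theorem hfinite_inter_of_hfinite_inter (hY : ¬ HFinite Y.grp Y.carrier)
    (h : HFinite Y.grp (X.carrier ∩ Y.carrier)) : HFinite X.grp (X.carrier ∩ Y.carrier) := by
  obtain ⟨F, hF, hsub⟩ := h
  obtain ⟨y, hy, hyF⟩ : ∃ y ∈ Y.carrier, y ∉ (Y.grp : Set G) * F := by
    by_contra! hc
    exact hY ⟨F, hF, hc⟩
  -- Write `K` for `Y.grp`. Right multiplication by `f⁻¹y` moves a point `kf` of `X ∩ Y` to `ky`,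
  -- which is in `Y` but not in `KF`, hence not in `X`. So `kf` lies in the symmetric difference of
  -- `X` and `X y⁻¹f`, and `f` takes finitely many values.
  refine (HFinite.biUnion hF fun f _ => X.almost_inv (y⁻¹ * f)).mono ?_
  rintro x ⟨hx, hxY⟩
  obtain ⟨k, hk, f, hf, rfl⟩ := Set.mem_mul.1 (hsub ⟨hx, hxY⟩)
  refine Set.mem_biUnion hf (Or.inr ⟨hx, ?_⟩)
  rintro ⟨z, hz, hz'⟩
  have hzk : z = k * y := by
    have : z * (y⁻¹ * f) = k * y * (y⁻¹ * f) := by rw [show z * (y⁻¹ * f) = k * f from hz']; group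
    exact mul_right_cancel this
  have hzY : z ∈ Y.carrier := hzk ▸ Y.mul_mem k hk y hy
  obtain ⟨k', hk', f', hf', e⟩ := Set.mem_mul.1 (hsub ⟨hz, hzY⟩)
  refine hyF (Set.mem_mul.2 ⟨k⁻¹ * k', Y.grp.mul_mem (Y.grp.inv_mem hk) hk', f', hf', ?_⟩)
  rw [mul_assoc, e, hzk]
  group

theorem Nontrivial.hfinite_inter_iff (hX : X.Nontrivial) (hY : Y.Nontrivial) :
    HFinite X.grp (X.carrier ∩ Y.carrier) ↔ HFinite Y.grp (X.carrier ∩ Y.carrier) := by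
  refine ⟨fun h => ?_, hfinite_inter_of_hfinite_inter hY.1⟩
  rw [Set.inter_comm] at h ⊢
  exact hfinite_inter_of_hfinite_inter hX.1 h

/-- `X` is almost contained in `Y`. -/
def AlmostLE (X Y : AISet G) : Prop := HFinite X.grp (X.carrier \ Y.carrier)

theorem AlmostLE.hfinite_right (h : X.AlmostLE Y) (hX : X.Nontrivial) (hY : Y.Nontrivial) :
    HFinite Y.grp (X.carrier \ Y.carrier) := by
  have := (hX.hfinite_inter_iff hY.compl).1
  exact this h

theorem AlmostLE.compl (h : X.AlmostLE Y) (hX : X.Nontrivial) (hY : Y.Nontrivial) :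
    Y.compl.AlmostLE X.compl := by
  refine (h.hfinite_right hX hY).mono ?_
  rintro x ⟨h₁, h₂⟩
  exact ⟨by simpa [carrier_compl] using h₂, h₁⟩

theorem Nontrivial.nonempty (hX : X.Nontrivial) : X.carrier.Nonempty := by
  by_contra hc
  rw [Set.not_nonempty_iff_eq_empty] at hc
  exact hX.1 (hc ▸ HFinite.empty _)

/-- The set `Y` is almost invariant over the group of `X` too. For `y ∈ Y`, `z ∉ Y` and `s = y⁻¹z`,
the coset of `z` under the group of `Y` lies in `Ys` and misses `Y`, so it is contained in a set
which is finite over the group of `X`. -/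
theorem relIndex_ne_zero_of_symmDiff (h : HFinite X.grp (X.carrier ∆ Y.carrier))
    (hne : Y.carrier.Nonempty) (hne' : Y.carrierᶜ.Nonempty) : X.grp.relIndex Y.grp ≠ 0 := by
  obtain ⟨y, hy⟩ := hne
  obtain ⟨z, hz⟩ := hne'
  have hs : HFinite X.grp (((fun x => x * (y⁻¹ * z)) '' Y.carrier) ∆ Y.carrier) := by
    refine (((h.image_mul_right (y⁻¹ * z)).union (X.almost_inv (y⁻¹ * z))).union h).mono ?_
    rw [Set.image_symmDiff (mul_left_injective _)]
    intro x
    simp only [Set.mem_symmDiff, Set.mem_union]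
    tauto
  refine hs.relIndex_ne_zero (z := z) fun k hk =>
    Or.inl ⟨⟨k * y, Y.mul_mem k hk y hy, by group⟩, ?_⟩
  intro hkz
  exact hz (by simpa using Y.mul_mem k⁻¹ (Y.grp.inv_mem hk) _ hkz)

/-- Non-triviality of `X` ensures that `Y` is neither empty nor everything, as the index argument
requires. A non-trivial class thus remembers a commensurability class of subgroups, and later a
cylinder. -/
theorem Equiv.commensurable (h : X.Equiv Y) (hX : X.Nontrivial) :
    Subgroup.Commensurable X.grp Y.grp := by
  refine ⟨relIndex_ne_zero_of_symmDiff h.1 ?_ ?_,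
    relIndex_ne_zero_of_symmDiff h.symm.1 hX.nonempty hX.compl.nonempty⟩
  · by_contra hc
    rw [Set.not_nonempty_iff_eq_empty] at hc
    refine hX.1 (h.1.mono fun x hx => Or.inl ⟨hx, by simp [hc]⟩)
  · by_contra hc
    rw [Set.not_nonempty_iff_eq_empty, Set.compl_empty_iff] at hc
    exact hX.2 (h.1.mono fun x hx => Or.inr ⟨by simp [hc], hx⟩)

theorem Equiv.nontrivial (h : X.Equiv Y) (hX : X.Nontrivial) : Y.Nontrivial := by
  have hc := h.commensurable hX
  unfold AISet.Nontrivial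
  rw [← HFinite.iff_of_commensurable hc, ← HFinite.iff_of_commensurable hc]
  refine ⟨fun hY => hX.1 ((hY.union h.1).mono ?_), fun hY => hX.2 ((hY.union h.1).mono ?_)⟩ <;>
  · intro x
    simp only [Set.mem_symmDiff, Set.mem_union, Set.mem_compl_iff]
    tauto

theorem equiv_of_commensurable (h : HFinite X.grp (X.carrier ∆ Y.carrier))
    (hc : Subgroup.Commensurable X.grp Y.grp) : X.Equiv Y :=
  ⟨h, (HFinite.iff_of_commensurable hc).1 h⟩

theorem Equiv.trans {Z : AISet G} (h : X.Equiv Y) (h' : Y.Equiv Z) (hX : X.Nontrivial) :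
    X.Equiv Z := by
  have hc := h.commensurable hX
  have hc' := h'.commensurable (h.nontrivial hX)
  refine equiv_of_commensurable ?_ (hc.trans hc')
  refine (h.1.union ((HFinite.iff_of_commensurable hc).2 h'.1)).mono ?_
  intro x
  simp only [Set.mem_symmDiff, Set.mem_union]
  tauto

theorem Equiv.almostLE (h : X.Equiv Y) : X.AlmostLE Y :=
  h.1.mono fun _ hx => Or.inl hx

theorem AlmostLE.congr (h : X.AlmostLE Y) (hX : X.Nontrivial) (hY : Y.Nontrivial)
    (hXX' : X.Equiv X') (hYY' : Y.Equiv Y') : X'.AlmostLE Y' := by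
  have h₁ : X'.AlmostLE Y := by
    unfold AlmostLE
    rw [← HFinite.iff_of_commensurable (hXX'.commensurable hX)]
    refine (HFinite.union h hXX'.1).mono ?_
    intro x
    simp only [Set.mem_symmDiff, Set.mem_union, Set.mem_sdiff]
    tauto
  have hX' := hXX'.nontrivial hX
  have hY' := hYY'.nontrivial hY
  have h₂ : Y'.compl.AlmostLE X'.compl := by
    have h₃ := h₁.compl hX' hY
    unfold AlmostLE at h₃ ⊢
    simp only [grp_compl, carrier_compl] at h₃ ⊢
    rw [← HFinite.iff_of_commensurable (hYY'.commensurable hY)]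
    refine (HFinite.union h₃ hYY'.1).mono ?_
    intro x
    simp only [Set.mem_symmDiff, Set.mem_union, Set.mem_sdiff, Set.mem_compl_iff]
    tauto
  simpa only [compl_compl] using h₂.compl hY'.compl hX'.compl

theorem AlmostLE.antisymm (h : X.AlmostLE Y) (h' : Y.AlmostLE X) (hX : X.Nontrivial)
    (hY : Y.Nontrivial) : X.Equiv Y :=
  ⟨HFinite.union h (h'.hfinite_right hY hX), HFinite.union (h.hfinite_right hX hY) h'⟩

theorem almostLE_of_subset (h : X.carrier ⊆ Y.carrier) : X.AlmostLE Y := by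
  unfold AlmostLE
  rw [Set.sdiff_eq_empty.2 h]
  exact HFinite.empty _

/-- If `X` is almost contained in `Y`, then `X` is equivalent to a subset of `Y`. -/
theorem AlmostLE.exists_subset (h : X.AlmostLE Y) :
    ∃ X' : AISet G, X.Equiv X' ∧ X'.carrier ⊆ Y.carrier := by
  -- Removing the saturation of `X \ Y`, and not just `X \ Y` itself, keeps the set invariant under
  -- the group of `X`.
  set E : Set G := (X.grp : Set G) * (X.carrier \ Y.carrier) with hE
  have hEfin : HFinite X.grp E := HFinite.mul_left h
  have hsd : X.carrier ∆ (X.carrier \ E) ⊆ E := by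
    intro x
    simp only [Set.mem_symmDiff, Set.mem_sdiff]
    tauto
  refine ⟨⟨X.carrier \ E, X.grp, ?_, ?_⟩, ⟨hEfin.mono hsd, hEfin.mono hsd⟩, ?_⟩
  · rintro g hg x ⟨hx, hxE⟩
    refine ⟨X.mul_mem g hg x hx, fun hgx => hxE ?_⟩
    obtain ⟨a, ha, b, hb, e⟩ := Set.mem_mul.1 hgx
    refine Set.mem_mul.2 ⟨g⁻¹ * a, X.grp.mul_mem (X.grp.inv_mem hg) ha, b, hb, ?_⟩
    rw [mul_assoc, e]
    group
  · intro s
    refine (((X.almost_inv s).union (hEfin.image_mul_right s)).union hEfin).mono ?_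
    rw [Set.image_sdiff (mul_left_injective _)]
    intro x
    simp only [Set.mem_symmDiff, Set.mem_sdiff, Set.mem_union]
    tauto
  · rintro x ⟨hx, hxE⟩
    by_contra hxY
    exact hxE (Set.mem_mul.2 ⟨1, X.grp.one_mem, x, ⟨hx, hxY⟩, one_mul x⟩)

theorem crosses_iff : X.Crosses Y ↔ ¬ X.AlmostLE Y.compl ∧ ¬ X.compl.AlmostLE Y.compl ∧
    ¬ X.AlmostLE Y ∧ ¬ X.compl.AlmostLE Y := by
  simp only [Crosses, AlmostLE, carrier_compl, grp_compl, Set.sdiff_eq, _root_.compl_compl]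

end AISet

namespace AIClass

variable {G : Type*} [Group G] {X Y : AISet G}

/-- The quotient is by the generated equivalence relation. Along a chain of equivalences,
non-triviality propagates from any member to all of them, and among non-trivial sets the relation is
already transitive. -/
theorem mk_eq_iff (hX : X.Nontrivial) : mk X = mk Y ↔ X.Equiv Y := by
  refine ⟨fun h => ?_, fun h => Quot.sound h⟩
  have key : ∀ A B : AISet G, Relation.EqvGen AISet.Equiv A B →
      (A.Nontrivial ∨ B.Nontrivial) → A.Nontrivial ∧ B.Nontrivial ∧ A.Equiv B := by
    intro A B hAB
    induction hAB with
    | rel A B h =>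
      rintro (hA | hB)
      · exact ⟨hA, h.nontrivial hA, h⟩
      · exact ⟨h.symm.nontrivial hB, hB, h⟩
    | refl A => exact fun h => ⟨h.elim id id, h.elim id id, .refl A⟩
    | symm A B _ ih => exact fun h => ⟨(ih h.symm).2.1, (ih h.symm).1, (ih h.symm).2.2.symm⟩
    | trans A B C _ _ ih₁ ih₂ =>
      rintro (hA | hC)
      · have h₁ := ih₁ (.inl hA)
        have h₂ := ih₂ (.inl h₁.2.1)
        exact ⟨hA, h₂.2.1, h₁.2.2.trans h₂.2.2 hA⟩
      · have h₂ := ih₂ (.inr hC)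
        have h₁ := ih₁ (.inr h₂.1)
        exact ⟨h₁.1, hC, h₁.2.2.trans h₂.2.2 h₁.1⟩
  exact (key X Y (Quot.eqvGen_exact h) (.inl hX)).2.2

theorem pair_compl (X : AISet G) : pair X.compl = pair X := by
  have e : compl (mk X.compl) = mk X := congrArg mk X.compl_compl
  rw [pair, e, Set.pair_comm]
  rfl

theorem pair_eq_of_equiv (h : X.Equiv Y) : pair X = pair Y := by
  have e : mk X = mk Y := Quot.sound h
  rw [pair, pair, e]

theorem pair_eq_iff (hX : X.Nontrivial) :
    pair X = pair Y ↔ X.Equiv Y ∨ X.Equiv Y.compl := by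
  constructor
  · intro h
    have hm : mk X ∈ pair Y := h ▸ Or.inl rfl
    rcases hm with hm | hm
    · exact .inl ((mk_eq_iff hX).1 hm)
    · exact .inr ((mk_eq_iff hX).1 hm)
  · rintro (h | h)
    · exact pair_eq_of_equiv h
    · rw [pair_eq_of_equiv h, pair_compl]

end AIClass

namespace GTree

variable {G V : Type*} [Group G] [MulAction G V] (T : GTree G V)

/-! ### Sets of vertices and their boundaries -/

/-- The edges of `T` with exactly one end point in `U`. -/
def boundary (U : Set V) : Set (Sym2 V) :=
  {e | ∃ a b : V, T.graph.Adj a b ∧ a ∈ U ∧ b ∉ U ∧ e = s(a, b)}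

variable {T}

theorem mem_boundary_of {U : Set V} {a b : V} (hab : T.graph.Adj a b) (ha : a ∈ U) (hb : b ∉ U) :
    s(a, b) ∈ T.boundary U := ⟨a, b, hab, ha, hb, rfl⟩

theorem boundary_compl (U : Set V) : T.boundary Uᶜ = T.boundary U := by
  ext e
  constructor
  · rintro ⟨a, b, hab, ha, hb, rfl⟩
    exact ⟨b, a, hab.symm, by simpa using hb, ha, Sym2.eq_swap⟩
  · rintro ⟨a, b, hab, ha, hb, rfl⟩
    exact ⟨b, a, hab.symm, hb, by simpa using ha, Sym2.eq_swap⟩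

theorem boundary_inter_subset (U W : Set V) :
    T.boundary (U ∩ W) ⊆ T.boundary U ∪ T.boundary W := by
  rintro _ ⟨a, b, hab, ha, hb, rfl⟩
  by_cases h : b ∈ U
  · exact Or.inr ⟨a, b, hab, ha.2, fun h' => hb ⟨h, h'⟩, rfl⟩
  · exact Or.inl ⟨a, b, hab, ha.1, h, rfl⟩

theorem boundary_union_subset (U W : Set V) :
    T.boundary (U ∪ W) ⊆ T.boundary U ∪ T.boundary W := by
  have := boundary_inter_subset (T := T) Uᶜ Wᶜ
  rwa [← Set.compl_union, boundary_compl, boundary_compl, boundary_compl] at this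

theorem mem_iff_of_not_mem_boundary {U : Set V} {a b : V} (hab : T.graph.Adj a b)
    (h : s(a, b) ∉ T.boundary U) : a ∈ U ↔ b ∈ U := by
  constructor
  · intro ha
    by_contra hb
    exact h (mem_boundary_of hab ha hb)
  · intro hb
    by_contra ha
    exact h (Sym2.eq_swap ▸ mem_boundary_of hab.symm hb ha)

theorem mem_iff_of_walk {U : Set V} {a b : V} (p : T.graph.Walk a b)
    (h : ∀ e ∈ p.edges, e ∉ T.boundary U) : a ∈ U ↔ b ∈ U := by
  induction p with
  | nil => rfl
  | cons hadj p ih =>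
    simp only [SimpleGraph.Walk.edges_cons, List.mem_cons, forall_eq_or_imp] at h
    exact (mem_iff_of_not_mem_boundary hadj h.1).trans (ih h.2)

theorem mem_iff_of_reachable {U : Set V} {F : Set (Sym2 V)} (hU : T.boundary U ⊆ F) {a b : V}
    (h : (T.graph.deleteEdges F).Reachable a b) : a ∈ U ↔ b ∈ U := by
  obtain ⟨p⟩ := h
  induction p with
  | nil => rfl
  | cons hadj p ih =>
    rw [SimpleGraph.deleteEdges_adj] at hadj
    exact (mem_iff_of_not_mem_boundary hadj.1 fun h => hadj.2 (hU h)).trans ih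

/-- This is connectedness of `T`. Most inclusions between vertex sets below are proved this way: the
difference has empty boundary and misses some vertex. -/
theorem mem_of_boundary_eq_empty {U : Set V} (hU : T.boundary U = ∅) {a : V} (ha : a ∈ U) (b : V) :
    b ∈ U := by
  obtain ⟨p⟩ := T.isTree.connected.preconnected a b
  exact (mem_iff_of_walk p (by simp [hU])).1 ha

theorem eq_empty_of_boundary_eq_empty {U : Set V} (hU : T.boundary U = ∅) {a : V} (ha : a ∉ U) :
    U = ∅ := by
  rw [Set.eq_empty_iff_forall_notMem]
  exact fun b hb => ha (mem_of_boundary_eq_empty hU hb a)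

/-! ### Half-trees -/

theorem mem_halfTree_self (v w : V) : w ∈ T.halfTree v w := SimpleGraph.Reachable.refl _

theorem not_mem_halfTree {v w : V} (h : T.graph.Adj v w) : v ∉ T.halfTree v w := by
  have hb := SimpleGraph.isAcyclic_iff_forall_adj_isBridge.1 T.isTree.isAcyclic h
  rw [SimpleGraph.isBridge_iff] at hb
  exact fun h' => hb h'.symm

theorem mem_halfTree_of_adj {v w a b : V} (hab : T.graph.Adj a b) (ha : a ∈ T.halfTree v w)
    (h : s(a, b) ≠ s(v, w)) : b ∈ T.halfTree v w := by
  refine SimpleGraph.Reachable.trans ha (SimpleGraph.Adj.reachable ?_)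
  rw [SimpleGraph.deleteEdges_adj]
  exact ⟨hab, h⟩

/-- The only edge that leaves the half-tree beyond `vw` is `wv`. -/
theorem eq_of_leaves_halfTree {v w a b : V} (h : T.graph.Adj v w) (hab : T.graph.Adj a b)
    (ha : a ∈ T.halfTree v w) (hb : b ∉ T.halfTree v w) : a = w ∧ b = v := by
  have he : s(a, b) = s(v, w) := by
    by_contra he
    exact hb (mem_halfTree_of_adj hab ha he)
  rcases Sym2.eq_iff.1 he with ⟨rfl, rfl⟩ | ⟨rfl, rfl⟩
  · exact absurd ha (not_mem_halfTree h)
  · exact ⟨rfl, rfl⟩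

theorem boundary_halfTree {v w : V} (h : T.graph.Adj v w) :
    T.boundary (T.halfTree v w) = {s(v, w)} := by
  ext e
  constructor
  · rintro ⟨a, b, hab, ha, hb, rfl⟩
    obtain ⟨rfl, rfl⟩ := eq_of_leaves_halfTree h hab ha hb
    exact Sym2.eq_swap
  · rintro rfl
    exact ⟨w, v, h.symm, mem_halfTree_self _ _, not_mem_halfTree h, Sym2.eq_swap⟩

/-- Both sets change only along the edge `vw`, and in the same direction, so their symmetric
difference has empty boundary; it does not contain `v`. -/
theorem compl_halfTree {v w : V} (h : T.graph.Adj v w) :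
    (T.halfTree v w)ᶜ = T.halfTree w v := by
  have key : T.boundary ((T.halfTree v w)ᶜ ∆ T.halfTree w v) = ∅ := by
    rw [Set.eq_empty_iff_forall_notMem]
    rintro _ ⟨a, b, hab, ha, hb, -⟩
    simp only [Set.mem_symmDiff, Set.mem_compl_iff, not_not] at ha hb
    have h₁ := eq_of_leaves_halfTree h hab
    have h₂ := eq_of_leaves_halfTree h hab.symm
    have h₃ := eq_of_leaves_halfTree h.symm hab
    have h₄ := eq_of_leaves_halfTree h.symm hab.symm
    have h₅ := not_mem_halfTree h
    have h₆ := not_mem_halfTree h.symm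
    have h₇ := mem_halfTree_self (T := T) v w
    have h₈ := mem_halfTree_self (T := T) w v
    grind
  have := eq_empty_of_boundary_eq_empty key (a := v) (by
    simp only [Set.mem_symmDiff, Set.mem_compl_iff]
    have := not_mem_halfTree h
    have := mem_halfTree_self (T := T) w v
    tauto)
  exact symmDiff_eq_bot.1 this

/-- A half-tree whose edge is not in the boundary of `U`, and that contains no end point of the
boundary of `U`, is contained in `U` as soon as it meets `U`. -/
theorem halfTree_subset {U : Set V} {v w : V} (h : T.graph.Adj v w) (hv : w ∈ U)
    (hU : ∀ e ∈ T.boundary U, ∀ x ∈ e, x ∉ T.halfTree v w) : T.halfTree v w ⊆ U := by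
  have key : T.boundary (T.halfTree v w \ U) = ∅ := by
    rw [Set.eq_empty_iff_forall_notMem]
    rintro _ ⟨a, b, hab, ⟨ha, haU⟩, hb, -⟩
    by_cases hb' : b ∈ T.halfTree v w
    · have hbU : b ∈ U := by
        by_contra hbU
        exact hb ⟨hb', hbU⟩
      exact hU _ (mem_boundary_of hab.symm hbU haU) a (by simp) ha
    · obtain ⟨rfl, rfl⟩ := eq_of_leaves_halfTree h hab ha hb'
      exact haU hv
  have := eq_empty_of_boundary_eq_empty key (a := v) (fun hv => not_mem_halfTree h hv.1)
  exact Set.sdiff_eq_empty.1 this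

theorem halfTree_subset_halfTree {v w u : V} (h : T.graph.Adj v w) (h' : T.graph.Adj w u)
    (hne : u ≠ v) : T.halfTree w u ⊆ T.halfTree v w := by
  refine halfTree_subset h' (mem_halfTree_of_adj h' (mem_halfTree_self _ _) ?_) ?_
  · intro he
    rcases Sym2.eq_iff.1 he with ⟨h₁, h₂⟩ | ⟨-, h₂⟩
    · exact T.graph.loopless.irrefl _ (h₁ ▸ h)
    · exact hne h₂
  · rw [boundary_halfTree h]
    rintro _ rfl x hx hx'
    rcases Sym2.mem_iff.1 hx with rfl | rfl
    · exact not_mem_halfTree h' (mem_halfTree_of_adj h hx' fun he => hne (by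
        rcases Sym2.eq_iff.1 he with ⟨-, h₂⟩ | ⟨h₁, -⟩
        · exact absurd h₂ h'.ne
        · exact h₁.symm))
    · exact not_mem_halfTree h' hx'

theorem disjoint_halfTree {v w u : V} (h : T.graph.Adj w v) (h' : T.graph.Adj w u)
    (hne : u ≠ v) : Disjoint (T.halfTree w u) (T.halfTree w v) := by
  have := halfTree_subset_halfTree h.symm h' hne
  rw [← compl_halfTree h] at this
  exact Set.disjoint_left.2 fun x hx hx' => this hx hx'

/-! ### Walks and distances -/

/-- A path which starts and ends outside of a half-tree does not enter it. -/
theorem not_mem_support_of_isPath {v w a b : V} (h : T.graph.Adj v w) {p : T.graph.Walk a b}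
    (hp : p.IsPath) (ha : a ∉ T.halfTree v w) (hb : b ∉ T.halfTree v w) {x : V}
    (hx : x ∈ p.support) : x ∉ T.halfTree v w := by
  classical
  -- Both end points lie in the half-tree on the side of `v`, so some path joins them without using
  -- `vw`; by uniqueness of paths in a tree, it is `p`.
  have key : s(v, w) ∉ p.edges := by
    have hba : (T.graph.deleteEdges {s(v, w)}).Reachable a b := by
      rw [← Set.mem_compl_iff, compl_halfTree h] at ha hb
      unfold halfTree at ha hb
      rw [Sym2.eq_swap] at ha hb
      exact SimpleGraph.Reachable.trans (SimpleGraph.Reachable.symm ha) hb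
    obtain ⟨q, hq⟩ := hba.exists_isPath
    have hle : T.graph.deleteEdges {s(v, w)} ≤ T.graph := SimpleGraph.deleteEdges_le _
    have heq : p = q.mapLe hle :=
      (T.isTree.existsUnique_path a b).unique hp (hq.mapLe hle)
    rw [heq, SimpleGraph.Walk.edges_mapLe_eq_edges]
    intro he
    have := q.edges_subset_edgeSet he
    simp at this
  have hU : a ∈ T.halfTree v w ↔ x ∈ T.halfTree v w := by
    refine mem_iff_of_walk (p.takeUntil x hx) fun e he he' => ?_
    rw [boundary_halfTree h, Set.mem_singleton_iff] at he'
    exact key (he' ▸ p.edges_takeUntil_subset_edges hx he)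
  exact fun h => ha (hU.2 h)

/-- The action of an element of `G` as a graph homomorphism. -/
def smulHom (T : GTree G V) (g : G) : T.graph →g T.graph := ⟨(g • ·), fun h => T.smul_adj g _ _ h⟩

/-- The image of a walk under an element of `G`. -/
def smulWalk (g : G) {a b : V} (p : T.graph.Walk a b) : T.graph.Walk (g • a) (g • b) :=
  p.map (T.smulHom g)

theorem support_smulWalk (g : G) {a b : V} (p : T.graph.Walk a b) :
    (smulWalk g p).support = p.support.map (g • ·) := SimpleGraph.Walk.support_map _ _

theorem edges_smulWalk (g : G) {a b : V} (p : T.graph.Walk a b) :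
    (smulWalk g p).edges = p.edges.map (g • ·) := SimpleGraph.Walk.edges_map _ _

theorem length_smulWalk (g : G) {a b : V} (p : T.graph.Walk a b) :
    (smulWalk g p).length = p.length := SimpleGraph.Walk.length_map _ _

theorem isPath_smulWalk (g : G) {a b : V} {p : T.graph.Walk a b} (hp : p.IsPath) :
    (smulWalk g p).IsPath :=
  hp.map (f := T.smulHom g) (MulAction.injective g)

theorem dist_smul (g : G) (a b : V) : T.graph.dist (g • a) (g • b) = T.graph.dist a b := by
  have key : ∀ (g : G) (a b : V), T.graph.dist (g • a) (g • b) ≤ T.graph.dist a b := by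
    intro g a b
    obtain ⟨p, hp⟩ := (T.isTree.connected.preconnected a b).exists_walk_length_eq_dist
    rw [← hp, ← length_smulWalk g p]
    exact SimpleGraph.dist_le _
  refine le_antisymm (key g a b) ?_
  simpa using key g⁻¹ (g • a) (g • b)

theorem dist_triangle (T : GTree G V) (a b c : V) :
    T.graph.dist a c ≤ T.graph.dist a b + T.graph.dist b c :=
  T.isTree.connected.dist_triangle

theorem dist_le_of_walk {v w a b : V} (h : T.graph.Adj v w) (p : T.graph.Walk a b)
    (ha : a ∉ T.halfTree v w) (hb : b ∈ T.halfTree v w) : T.graph.dist a v + 1 ≤ p.length := by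
  induction p with
  | nil => exact absurd hb ha
  | @cons a a' b hadj p ih =>
    rw [SimpleGraph.Walk.length_cons]
    by_cases ha' : a' ∈ T.halfTree v w
    · obtain ⟨-, rfl⟩ := eq_of_leaves_halfTree h hadj.symm ha' ha
      simp
    · have h₁ := ih ha' hb
      have h₂ := T.dist_triangle a a' v
      rw [SimpleGraph.dist_eq_one_iff_adj.2 hadj] at h₂
      omega

/-- A point of a half-tree is further away than its root from any point outside. -/
theorem dist_lt_of_mem_halfTree {v w a b : V} (h : T.graph.Adj v w) (ha : a ∉ T.halfTree v w)
    (hb : b ∈ T.halfTree v w) : T.graph.dist a v < T.graph.dist a b := by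
  obtain ⟨p, hp⟩ := (T.isTree.connected.preconnected a b).exists_walk_length_eq_dist
  have := dist_le_of_walk h p ha hb
  omega

/-! ### Minimal trees -/

/-- An invariant nonempty set of vertices, any two points of which are joined by a walk inside
the set, is everything. -/
theorem IsMinimal.eq_univ (hT : T.IsMinimal) {S : Set V} (hne : S.Nonempty)
    (hS : ∀ (g : G), ∀ v ∈ S, g • v ∈ S)
    (hw : ∀ a ∈ S, ∀ b ∈ S, ∃ p : T.graph.Walk a b, ∀ x ∈ p.support, x ∈ S) : S = Set.univ := by
  refine hT S hS ?_
  obtain ⟨u, hu⟩ := hne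
  refine SimpleGraph.induce_connected_of_patches u hu fun {v} hv => ?_
  obtain ⟨p, hp⟩ := hw u hu v hv
  exact ⟨{x | x ∈ p.support}, hp, p.start_mem_support, p.end_mem_support,
    p.connected_induce_support.preconnected _ _⟩

/-- In a minimal tree, every orbit meets every half-tree. -/
theorem IsMinimal.exists_smul_mem_halfTree (hT : T.IsMinimal) {v w : V} (h : T.graph.Adj v w)
    (u : V) : ∃ g : G, g • u ∈ T.halfTree v w := by
  classical
  -- The hull of the orbit is an invariant subtree, hence everything. So `w` is on a path between
  -- two points of the orbit, which could not enter the half-tree if both its ends were outside.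
  let S : Set V := {x | ∃ a ∈ MulAction.orbit G u, ∃ b ∈ MulAction.orbit G u,
    ∃ p : T.graph.Walk a b, p.IsPath ∧ x ∈ p.support}
  have hexp : ∀ a b, ∃ p : T.graph.Walk a b, p.IsPath := fun a b =>
    (T.isTree.connected.preconnected a b).exists_isPath
  have hu := MulAction.mem_orbit_self (M := G) u
  have horb : ∀ (g : G) {a : V}, a ∈ MulAction.orbit G u → g • a ∈ MulAction.orbit G u := by
    rintro g _ ⟨k, rfl⟩
    exact ⟨g * k, mul_smul g k u⟩
  have hS : S = Set.univ := by
    refine hT.eq_univ ⟨u, u, hu, u, hu, .nil, by simp, by simp⟩ ?_ ?_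
    · rintro g x ⟨a, ha, b, hb, p, hp, hx⟩
      refine ⟨g • a, horb g ha, g • b,
        horb g hb, smulWalk g p, isPath_smulWalk g hp, ?_⟩
      rw [support_smulWalk]
      exact List.mem_map_of_mem hx
    · rintro x ⟨a, ha, b, hb, p, hp, hx⟩ y ⟨c, hc, d, hd, q, hq, hy⟩
      obtain ⟨r, hr⟩ := hexp a c
      refine ⟨(p.takeUntil x hx).reverse.append (r.append (q.takeUntil y hy)), ?_⟩
      intro z hz
      rw [SimpleGraph.Walk.mem_support_append_iff, SimpleGraph.Walk.mem_support_append_iff,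
        SimpleGraph.Walk.support_reverse, List.mem_reverse] at hz
      rcases hz with hz | hz | hz
      · exact ⟨a, ha, b, hb, p, hp, p.support_takeUntil_subset_support hx hz⟩
      · exact ⟨a, ha, c, hc, r, hr, hz⟩
      · exact ⟨c, hc, d, hd, q, hq, q.support_takeUntil_subset_support hy hz⟩
  obtain ⟨_, ⟨g, rfl⟩, _, ⟨g', rfl⟩, p, hp, hw⟩ : w ∈ S := hS ▸ Set.mem_univ w
  by_contra! hc
  exact not_mem_support_of_isPath h hp (hc g) (hc g') hw (mem_halfTree_self _ _)

/-- A minimal tree has no terminal vertex. -/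
theorem IsMinimal.exists_adj_ne (hT : T.IsMinimal) {v w : V} (h : T.graph.Adj v w) :
    ∃ u, T.graph.Adj w u ∧ u ≠ v := by
  by_contra! hc
  have key : T.boundary (T.halfTree v w \ {w}) = ∅ := by
    rw [Set.eq_empty_iff_forall_notMem]
    rintro _ ⟨a, b, hab, ⟨ha, haw⟩, hb, -⟩
    by_cases hb' : b ∈ T.halfTree v w
    · have hbw : b = w := by
        by_contra hbw
        exact hb ⟨hb', hbw⟩
      subst hbw
      exact not_mem_halfTree h (hc a hab.symm ▸ ha)
    · exact haw (eq_of_leaves_halfTree h hab ha hb').1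
  have hsub := Set.sdiff_eq_empty.1 (eq_empty_of_boundary_eq_empty key (a := w) fun hw => hw.2 rfl)
  -- If `w` were terminal, the half-tree would be `{w}`, so some `g` would send `v` to `w`. Then `g
  -- w` is a neighbour of `w`, that is `v`, and `g` inverts the edge.
  obtain ⟨g, hg⟩ := hT.exists_smul_mem_halfTree h v
  have hgv : g • v = w := hsub hg
  exact T.no_inversion g v w h ⟨hgv, hc _ (hgv ▸ T.smul_adj g v w h)⟩

/-- Every half-tree contains points of any orbit, arbitrarily far away. -/
theorem IsMinimal.exists_smul_mem_halfTree_dist (hT : T.IsMinimal) {v w : V}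
    (h : T.graph.Adj v w) (u o : V) (n : ℕ) :
    ∃ g : G, g • u ∈ T.halfTree v w ∧ n < T.graph.dist o (g • u) := by
  have key : ∀ n : ℕ, ∃ a b, T.graph.Adj a b ∧ T.halfTree a b ⊆ T.halfTree v w ∧
      n ≤ T.graph.dist v a := by
    intro n
    induction n with
    | zero => exact ⟨v, w, h, subset_rfl, Nat.zero_le _⟩
    | succ n ih =>
      obtain ⟨a, b, hab, hsub, hn⟩ := ih
      obtain ⟨c, hbc, hne⟩ := hT.exists_adj_ne hab
      refine ⟨b, c, hbc, (halfTree_subset_halfTree hab hbc hne).trans hsub, ?_⟩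
      have hva : v ∉ T.halfTree a b := fun hv => not_mem_halfTree h (hsub hv)
      have := dist_lt_of_mem_halfTree hab hva (mem_halfTree_self a b)
      omega
  -- The extra term pays for measuring distances from `o` instead of `v`.
  obtain ⟨a, b, hab, hsub, hn⟩ := key (n + T.graph.dist v o)
  obtain ⟨g, hg⟩ := hT.exists_smul_mem_halfTree hab u
  have hva : v ∉ T.halfTree a b := fun hv => not_mem_halfTree h (hsub hv)
  refine ⟨g, hsub hg, ?_⟩
  have h₁ := dist_lt_of_mem_halfTree hab hva hg
  have h₂ := T.dist_triangle v o (g • u)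
  omega

/-- If `G` is finitely generated, then it acts cocompactly on a minimal tree. -/
theorem IsMinimal.exists_dist_smul_le [Group.FG G] (hT : T.IsMinimal) (v : V) :
    ∃ D : ℕ, ∀ u : V, ∃ g : G, T.graph.dist v (g • u) ≤ D := by
  classical
  obtain ⟨s, hs⟩ := Group.FG.out (G := G)
  -- With `D` the largest displacement of `v` by a generator, `v` and its image by a generator are
  -- joined inside the ball of radius `D`. Following words in the generators, the translates of this
  -- ball have connected union, which is everything by minimality.
  let D := s.sup fun g => T.graph.dist v (g • v)
  refine ⟨D, ?_⟩
  let S : Set V := {u | ∃ g : G, T.graph.dist v (g • u) ≤ D}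
  have hSinv : ∀ (g : G), ∀ v ∈ S, g • v ∈ S := by
    rintro g u ⟨k, hk⟩
    exact ⟨k * g⁻¹, by simpa [mul_smul] using hk⟩
  let R : V → V → Prop := fun a b => ∃ p : T.graph.Walk a b, ∀ x ∈ p.support, x ∈ S
  have Rsymm : ∀ {a b}, R a b → R b a := fun ⟨p, hp⟩ => ⟨p.reverse, by simpa using hp⟩
  have Rtrans : ∀ {a b c}, R a b → R b c → R a c := by
    rintro a b c ⟨p, hp⟩ ⟨q, hq⟩
    refine ⟨p.append q, fun x hx => ?_⟩
    rw [SimpleGraph.Walk.mem_support_append_iff] at hx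
    exact hx.elim (hp x) (hq x)
  have Rsmul : ∀ (g : G) {a b}, R a b → R (g • a) (g • b) := by
    rintro g a b ⟨p, hp⟩
    refine ⟨smulWalk g p, fun x hx => ?_⟩
    rw [support_smulWalk, List.mem_map] at hx
    obtain ⟨y, hy, rfl⟩ := hx
    exact hSinv g y (hp y hy)
  have Rball : ∀ u, T.graph.dist v u ≤ D → R v u := by
    intro u hu
    obtain ⟨p, hp⟩ := (T.isTree.connected.preconnected v u).exists_walk_length_eq_dist
    refine ⟨p, fun x hx => ⟨1, ?_⟩⟩
    rw [one_smul]
    have h₁ := SimpleGraph.dist_le (p.takeUntil x hx)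
    have h₂ := p.length_takeUntil_le_length hx
    omega
  have Rorb : ∀ g : G, R v (g • v) := by
    intro g
    have hg : g ∈ Subgroup.closure (s : Set G) := hs ▸ Subgroup.mem_top g
    induction hg using Subgroup.closure_induction with
    | mem g hg => exact Rball _ (Finset.le_sup (f := fun g => T.graph.dist v (g • v)) hg)
    | one => rw [one_smul]; exact Rball v (by simp)
    | mul g k _ _ hg hk => rw [mul_smul]; exact Rtrans hg (Rsmul g hk)
    | inv g _ hg => simpa using Rsmul g⁻¹ (Rsymm hg)
  have RS : ∀ u ∈ S, R v u := by
    rintro u ⟨g, hg⟩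
    exact Rtrans (Rorb g⁻¹) (by simpa using Rsmul g⁻¹ (Rball _ hg))
  have : S = Set.univ := hT.eq_univ ⟨v, 1, by simp⟩ hSinv fun a ha b hb =>
    Rtrans (Rsymm (RS a ha)) (RS b hb)
  intro u
  have hu : u ∈ S := this ▸ Set.mem_univ u
  exact hu

end GTree

namespace GTree

variable {G V : Type*} [Group G] [MulAction G V] {T : GTree G V}

/-! ### Cylinders -/

namespace IsCylinder

variable {Y Y' : Set (Sym2 V)}

theorem subset_edgeSet (hY : T.IsCylinder Y) : Y ⊆ T.graph.edgeSet := by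
  obtain ⟨e, -, rfl⟩ := hY
  exact fun f hf => hf.1

theorem nonempty (hY : T.IsCylinder Y) : Y.Nonempty := by
  obtain ⟨e, he, rfl⟩ := hY
  exact ⟨e, he, .refl _⟩

theorem mem_iff (hY : T.IsCylinder Y) {e f : Sym2 V} (he : e ∈ Y) :
    f ∈ Y ↔ f ∈ T.graph.edgeSet ∧
      Subgroup.Commensurable (MulAction.stabilizer G e) (MulAction.stabilizer G f) := by
  obtain ⟨e', -, rfl⟩ := hY
  exact ⟨fun hf => ⟨hf.1, he.2.symm.trans hf.2⟩, fun hf => ⟨hf.1, he.2.trans hf.2⟩⟩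

theorem commensurable (hY : T.IsCylinder Y) {e f : Sym2 V} (he : e ∈ Y) (hf : f ∈ Y) :
    Subgroup.Commensurable (MulAction.stabilizer G e) (MulAction.stabilizer G f) :=
  ((hY.mem_iff he).1 hf).2

theorem eq_of_commensurable (hY : T.IsCylinder Y) (hY' : T.IsCylinder Y') {e f : Sym2 V}
    (he : e ∈ Y) (hf : f ∈ Y')
    (h : Subgroup.Commensurable (MulAction.stabilizer G e) (MulAction.stabilizer G f)) :
    Y = Y' := by
  ext k
  rw [hY.mem_iff he, hY'.mem_iff hf]
  exact ⟨fun hk => ⟨hk.1, h.symm.trans hk.2⟩, fun hk => ⟨hk.1, h.trans hk.2⟩⟩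

theorem eq_of_mem (hY : T.IsCylinder Y) (hY' : T.IsCylinder Y') {e : Sym2 V} (he : e ∈ Y)
    (he' : e ∈ Y') : Y = Y' :=
  hY.eq_of_commensurable hY' he he' (.refl _)

theorem exists_mem_of_mem_edgeSet {e : Sym2 V} (he : e ∈ T.graph.edgeSet) :
    ∃ Y, T.IsCylinder Y ∧ e ∈ Y :=
  ⟨_, ⟨e, he, rfl⟩, he, .refl _⟩

end IsCylinder

theorem smul_sym2_mk (g : G) (a b : V) : g • s(a, b) = s(g • a, g • b) := rfl

theorem smul_eq_of_mem_stabilizer {e : Sym2 V} (he : e ∈ T.graph.edgeSet) {g : G}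
    (hg : g ∈ MulAction.stabilizer G e) {x : V} (hx : x ∈ e) : g • x = x := by
  induction e with
  | h v w =>
    rw [MulAction.mem_stabilizer_iff, smul_sym2_mk] at hg
    rcases Sym2.eq_iff.1 hg with ⟨h₁, h₂⟩ | ⟨h₁, h₂⟩
    · rcases Sym2.mem_iff.1 hx with rfl | rfl <;> assumption
    · exact absurd ⟨h₁, h₂⟩ (T.no_inversion g v w he)

/-- Every path between two vertices of a cylinder is contained in the cylinder. -/
def HasConvexCylinders (T : GTree G V) : Prop :=
  ∀ Y, T.IsCylinder Y → ∀ a b : V, VertexMem a Y → VertexMem b Y →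
    ∀ p : T.graph.Walk a b, p.IsPath → ∀ e ∈ p.edges, e ∈ Y

/-- An element stabilizing both `e` and `f` fixes the end points of the path, hence each edge `k` on
it. So the intersection of the two stabilizers is contained in that of `k`. It is commensurable with
the stabilizer of `e`, hence belongs to `𝓔`, and the index condition on `𝓔` makes the stabilizer of
`k` commensurable as well. -/
theorem IsTreeOver.hasConvexCylinders {𝓔 : Set (Subgroup G)} (h𝓔 : IsCylinderFamily 𝓔)
    (hT : T.IsTreeOver 𝓔) : T.HasConvexCylinders := by
  rintro Y hY a b ⟨e, he, ha⟩ ⟨f, hf, hb⟩ p hp k hk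
  have hle : MulAction.stabilizer G e ⊓ MulAction.stabilizer G f ≤ MulAction.stabilizer G k := by
    rintro g ⟨hge, hgf⟩
    have hga := smul_eq_of_mem_stabilizer (hY.subset_edgeSet he) hge ha
    have hgb := smul_eq_of_mem_stabilizer (hY.subset_edgeSet hf) hgf hb
    have hq : ((smulWalk g p).copy hga hgb).IsPath := by
      rw [SimpleGraph.Walk.isPath_copy]
      exact isPath_smulWalk g hp
    have heq := congrArg SimpleGraph.Walk.edges
      ((T.isTree.existsUnique_path a b).unique hq hp)
    rw [SimpleGraph.Walk.edges_copy, edges_smulWalk] at heq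
    exact List.map_inj_left.1 (heq.trans (List.map_id _).symm) k hk
  have hc := hY.commensurable he hf
  have hinf : Subgroup.Commensurable
      (MulAction.stabilizer G e ⊓ MulAction.stabilizer G f) (MulAction.stabilizer G e) :=
    ⟨by rw [inf_comm, Subgroup.inf_relIndex_right]; exact hc.2, by
      rw [Subgroup.relIndex_eq_one.2 inf_le_left]; exact one_ne_zero⟩
  have hkE := p.edges_subset_edgeSet hk
  have hinfE := h𝓔.mem_of_commensurable _ _ (hT e (hY.subset_edgeSet he)) hinf
  have hfin := (h𝓔.finite_index _ hinfE _ (hT k hkE) hle).relIndex_ne_zero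
  have hck : Subgroup.Commensurable (MulAction.stabilizer G e ⊓ MulAction.stabilizer G f)
      (MulAction.stabilizer G k) :=
    ⟨hfin, by rw [Subgroup.relIndex_eq_one.2 hle]; exact one_ne_zero⟩
  exact (hY.mem_iff he).2 ⟨hkE, hinf.symm.trans hck⟩

variable {Y Y' : Set (Sym2 V)}

/-- Distinct vertices of a cylinder are in distinct components of the complement of its edges. -/
theorem HasConvexCylinders.eq_of_reachable (hC : T.HasConvexCylinders) (hY : T.IsCylinder Y)
    {a b : V} (ha : VertexMem a Y)
    (hb : VertexMem b Y) (h : (T.graph.deleteEdges Y).Reachable a b) : a = b := by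
  obtain ⟨q, hq⟩ := h.exists_isPath
  have hle : T.graph.deleteEdges Y ≤ T.graph := SimpleGraph.deleteEdges_le _
  have hp := hC Y hY a b ha hb (q.mapLe hle) (hq.mapLe hle)
  cases q with
  | nil => rfl
  | cons hadj q =>
    exfalso
    rw [SimpleGraph.deleteEdges_adj] at hadj
    exact hadj.2 (hp _ (by simp))

/-- A set whose boundary is contained in a cylinder contains all vertices of any other cylinder, or
none. -/
theorem HasConvexCylinders.mem_iff_mem (hC : T.HasConvexCylinders) (hY : T.IsCylinder Y)
    (hY' : T.IsCylinder Y') (hne : Y ≠ Y') {U : Set V} (hU : T.boundary U ⊆ Y) {a b : V} (ha : VertexMem a Y') (hb : VertexMem b Y') :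
    a ∈ U ↔ b ∈ U := by
  obtain ⟨p, hp⟩ := (T.isTree.connected.preconnected a b).exists_isPath
  refine mem_iff_of_walk p fun e he heU => hne ?_
  exact hY.eq_of_mem hY' (hU heU) (hC Y' hY' a b ha hb p hp e he)

/-- A projection to the cylinder: follow a walk from `z` towards an edge of `Y` and stop before the
first edge that belongs to `Y`. -/
theorem exists_vertexMem_reachable (hY : T.IsCylinder Y) (z : V) :
    ∃ x, VertexMem x Y ∧ (T.graph.deleteEdges Y).Reachable z x := by
  obtain ⟨e, he⟩ := hY.nonempty
  obtain ⟨x, hx⟩ : ∃ x, x ∈ e := ⟨_, Sym2.out_fst_mem e⟩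
  obtain ⟨p⟩ := T.isTree.connected.preconnected z x
  induction p with
  | nil => exact ⟨_, ⟨e, he, hx⟩, .refl _⟩
  | @cons a b _ hadj p ih =>
    obtain ⟨y, hy, hby⟩ := ih hx
    by_cases hab : s(a, b) ∈ Y
    · exact ⟨a, ⟨_, hab, by simp⟩, .refl _⟩
    · refine ⟨y, hy, SimpleGraph.Reachable.trans (SimpleGraph.Adj.reachable ?_) hby⟩
      rw [SimpleGraph.deleteEdges_adj]
      exact ⟨hadj, hab⟩

/-! ### Small sets of vertices -/

/-- The set of all `g` such that `g v₀` belongs to `U`. -/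
def pullback (G : Type*) {V : Type*} [Group G] [MulAction G V] (v₀ : V) (U : Set V) : Set G :=
  {g | g • v₀ ∈ U}

/-- The coset of `g` under the stabilizer of `a` is determined by `g⁻¹ a`. Smallness thereby becomes
finiteness of a set of translates of one edge. -/
theorem hfinite_stabilizer_iff {A : Type*} [MulAction G A] {a : A} {X : Set G} :
    HFinite (MulAction.stabilizer G a) X ↔ ((fun g : G => g⁻¹ • a) '' X).Finite := by
  constructor
  · rintro ⟨F, hF, hsub⟩
    refine (hF.image fun g => g⁻¹ • a).subset ?_
    rintro _ ⟨g, hg, rfl⟩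
    obtain ⟨h, hh, f, hf, rfl⟩ := Set.mem_mul.1 (hsub hg)
    refine ⟨f, hf, ?_⟩
    have := MulAction.mem_stabilizer_iff.1 (inv_mem hh)
    simp only [mul_inv_rev, mul_smul, this]
  · intro h
    obtain ⟨F, hFX, hF⟩ := Set.exists_subset_bijOn X (fun g : G => g⁻¹ • a)
    refine ⟨F, (hF.finite_iff_finite).2 h, fun g hg => ?_⟩
    obtain ⟨f, hf, e⟩ := hF.surjOn ⟨g, hg, rfl⟩
    refine Set.mem_mul.2 ⟨g * f⁻¹, ?_, f, hf, by simp⟩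
    change (g * f⁻¹) • a = a
    rw [mul_smul, show f⁻¹ • a = g⁻¹ • a from e, smul_inv_smul]

/-- `U` is small for the cylinder `Y`: the set of all `g` with `g v₀ ∈ U` is `H`-finite, where `H`
is the stabilizer of an edge of `Y`. -/
def Small (_ : GTree G V) (v₀ : V) (Y : Set (Sym2 V)) (U : Set V) : Prop :=
  ∀ e ∈ Y, HFinite (MulAction.stabilizer G e) (pullback G v₀ U)

namespace Small

variable {v₀ : V} {U W : Set V}

theorem mono (h : T.Small v₀ Y W) (hUW : U ⊆ W) : T.Small v₀ Y U :=
  fun e he => (h e he).mono fun _ hg => hUW hg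

theorem union (hU : T.Small v₀ Y U) (hW : T.Small v₀ Y W) : T.Small v₀ Y (U ∪ W) :=
  fun e he => (hU e he).union (hW e he)

theorem empty : T.Small v₀ Y ∅ := fun _ _ => HFinite.empty _

theorem biUnion {ι : Type*} {s : Set ι} (hs : s.Finite) {f : ι → Set V}
    (h : ∀ i ∈ s, T.Small v₀ Y (f i)) : T.Small v₀ Y (⋃ i ∈ s, f i) := by
  intro e he
  refine (HFinite.biUnion hs fun i hi => h i hi e he).mono fun g hg => ?_
  simpa [pullback] using hg

end Small

variable {v₀ : V} {U W : Set V}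

theorem IsCylinder.small_iff (hY : T.IsCylinder Y) {e : Sym2 V} (he : e ∈ Y) :
    T.Small v₀ Y U ↔ HFinite (MulAction.stabilizer G e) (pullback G v₀ U) :=
  ⟨fun h => h e he, fun h _ hf => (HFinite.iff_of_commensurable (hY.commensurable he hf)).1 h⟩

theorem pullback_smul (g : G) (v₀ : V) (U : Set V) :
    pullback G v₀ (g • U) = g • pullback G v₀ U := by
  ext k
  rw [Set.mem_smul_set_iff_inv_smul_mem]
  change k • v₀ ∈ g • U ↔ (g⁻¹ * k) • v₀ ∈ U
  rw [Set.mem_smul_set_iff_inv_smul_mem, mul_smul]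

theorem Small.smul (h : T.Small v₀ Y U) (g : G) : T.Small v₀ (g • Y) (g • U) := by
  rintro _ ⟨e, he, rfl⟩
  have key := (AISet.HFinite_smul_iff g _ _).2 (h e he)
  rw [← pullback_smul] at key
  change HFinite (MulAction.stabilizer G (g • e)) _
  rw [MulAction.stabilizer_smul_eq_stabilizer_map_conj]
  exact key

/-- A half-tree is not small, for any cylinder. -/
theorem IsMinimal.not_small_halfTree (hT : T.IsMinimal) (hY : T.IsCylinder Y) {v w : V}
    (h : T.graph.Adj v w) : ¬ T.Small v₀ Y (T.halfTree v w) := by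
  intro hs
  obtain ⟨e, he⟩ := hY.nonempty
  obtain ⟨o, ho⟩ : ∃ o, o ∈ e := ⟨_, Sym2.out_fst_mem e⟩
  -- Smallness would leave finitely many edges `g⁻¹ e`, hence finitely many points `g⁻¹ o`, for `g
  -- v₀` in the half-tree. Their distances to `v₀` are the distances from `o` to `g v₀`, which are
  -- unbounded.
  have hfin := hfinite_stabilizer_iff.1 (hs e he)
  have hfin' : ((fun g : G => g⁻¹ • o) '' pullback G v₀ (T.halfTree v w)).Finite := by
    have : (⋃ f ∈ (fun g : G => g⁻¹ • e) '' pullback G v₀ (T.halfTree v w),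
        {x | x ∈ f}).Finite := by
      refine hfin.biUnion fun f _ => ?_
      induction f with
      | h a b => exact (Set.toFinite {a, b}).subset fun x hx => by simpa using hx
    refine this.subset ?_
    rintro _ ⟨g, hg, rfl⟩
    exact Set.mem_biUnion ⟨g, hg, rfl⟩ (Sym2.mem_map.2 ⟨o, ho, rfl⟩)
  obtain ⟨n, hn⟩ := (hfin'.image fun x => T.graph.dist x v₀).bddAbove
  obtain ⟨g, hg, hgn⟩ := hT.exists_smul_mem_halfTree_dist h v₀ o n
  have := hn ⟨g⁻¹ • o, ⟨g, hg, rfl⟩, rfl⟩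
  have h' := dist_smul (T := T) g⁻¹ o (g • v₀)
  rw [inv_smul_smul] at h'
  simp only at this
  omega

/-- `x` belongs to at least two cylinders. -/
def InTwoCylinders (T : GTree G V) (x : V) : Prop :=
  ∃ Y Y' : Set (Sym2 V), T.IsCylinder Y ∧ T.IsCylinder Y' ∧ Y ≠ Y' ∧ VertexMem x Y ∧ VertexMem x Y'

theorem InTwoCylinders.exists_adj (hY : T.IsCylinder Y) {x : V} (hx : T.InTwoCylinders x) :
    ∃ w, T.graph.Adj x w ∧ s(x, w) ∉ Y := by
  obtain ⟨Y₁, Y₂, h₁, h₂, hne, hx₁, hx₂⟩ := hx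
  obtain ⟨Y', hY', hx', hne'⟩ : ∃ Y', T.IsCylinder Y' ∧ VertexMem x Y' ∧ Y' ≠ Y := by
    by_cases h : Y₁ = Y
    · exact ⟨Y₂, h₂, hx₂, fun h' => hne (h.trans h'.symm)⟩
    · exact ⟨Y₁, h₁, hx₁, h⟩
  obtain ⟨e, he, hxe⟩ := hx'
  obtain ⟨w, rfl⟩ := hxe
  exact ⟨w, hY'.subset_edgeSet he, fun h => hne' (hY'.eq_of_mem hY he h)⟩

theorem inTwoCylinders_of_adj (hY : T.IsCylinder Y) {x w : V} (hx : VertexMem x Y)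
    (h : T.graph.Adj x w) (hw : s(x, w) ∉ Y) : T.InTwoCylinders x := by
  obtain ⟨Y', hY', he⟩ := IsCylinder.exists_mem_of_mem_edgeSet (T := T) (e := s(x, w)) h
  exact ⟨Y, Y', hY, hY', fun h => hw (h ▸ he), hx, _, he, by simp⟩

/-- The half-tree beyond an edge which is not in the cylinder but starts at a vertex of the cylinder
does not meet the cylinder. -/
theorem HasConvexCylinders.not_mem_halfTree_of_vertexMem (hC : T.HasConvexCylinders)
    (hY : T.IsCylinder Y) {x w a : V} (hx : VertexMem x Y) (h : T.graph.Adj x w)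
    (hw : s(x, w) ∉ Y) (ha : VertexMem a Y) : a ∉ T.halfTree x w := by
  obtain ⟨p, hp⟩ := (T.isTree.connected.preconnected x a).exists_isPath
  refine fun ha' => not_mem_halfTree h ((mem_iff_of_walk p fun e he he' => hw ?_).2 ha')
  rw [boundary_halfTree h, Set.mem_singleton_iff] at he'
  exact he' ▸ hC Y hY x a hx ha p hp e he

/-- A set whose boundary is contained in `Y` and which contains a vertex belonging to `Y` and to
another cylinder is not small. -/
theorem IsMinimal.not_small_of_inTwoCylinders (hT : T.IsMinimal) (hC : T.HasConvexCylinders)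
    (hY : T.IsCylinder Y) (hU : T.boundary U ⊆ Y) {x : V} (hx : VertexMem x Y)
    (hx' : T.InTwoCylinders x) (hxU : x ∈ U) : ¬ T.Small v₀ Y U := by
  obtain ⟨w, hw, hwY⟩ := hx'.exists_adj hY
  refine fun hs => hT.not_small_halfTree hY hw (hs.mono (halfTree_subset hw ?_ ?_))
  · exact (mem_iff_of_not_mem_boundary hw fun h => hwY (hU h)).1 hxU
  · exact fun e he a ha => hC.not_mem_halfTree_of_vertexMem hY hx hw hwY ⟨e, hU he, ha⟩

/-- A vertex of finite valence is small for a cylinder that contains an edge at that vertex. -/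
theorem small_singleton (hY : T.IsCylinder Y) {x : V} (hx : VertexMem x Y)
    (hfin : {w | T.graph.Adj x w}.Finite) : T.Small v₀ Y {x} := by
  obtain ⟨e, he, y, rfl⟩ := hx
  rw [hY.small_iff he]
  by_cases hg : ∃ g : G, g • v₀ = x
  · obtain ⟨g₀, hg₀⟩ := hg
    -- If `g v₀ = x`, then `g₀ g⁻¹` fixes `x` and sends the given edge to one of the finitely many
    -- edges at `x`, so `g⁻¹` applied to it takes finitely many values.
    refine hfinite_stabilizer_iff.2
      (((hfin.image fun w => s(x, w)).image fun f => g₀⁻¹ • f).subset ?_)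
    rintro _ ⟨g, hg, rfl⟩
    have hg' : g • v₀ = x := hg
    have hx : (g₀ * g⁻¹) • x = x := by rw [mul_smul, ← hg', inv_smul_smul, hg₀, hg']
    refine ⟨s(x, (g₀ * g⁻¹) • y), ⟨_, ?_, rfl⟩, ?_⟩
    · have := T.smul_adj (g₀ * g⁻¹) x y (hY.subset_edgeSet he)
      rwa [hx] at this
    · change g₀⁻¹ • s(x, (g₀ * g⁻¹) • y) = g⁻¹ • s(x, y)
      nth_rewrite 1 [← hx]
      rw [← smul_sym2_mk, mul_smul, inv_smul_smul]
  · refine (HFinite.empty _).mono fun g h => hg ⟨g, h⟩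

end GTree

namespace GTree

variable {G V : Type*} [Group G] [MulAction G V] {T : GTree G V} {Y Y' : Set (Sym2 V)} {v₀ : V}
  {U W : Set V}

/-! ### Cuts of a cylinder -/

/-- The boundary of `U` consists of finitely many edges of `Y`. -/
def IsCut (T : GTree G V) (Y : Set (Sym2 V)) (U : Set V) : Prop :=
  (T.boundary U).Finite ∧ T.boundary U ⊆ Y

namespace IsCut

theorem compl (h : T.IsCut Y U) : T.IsCut Y Uᶜ := by
  unfold IsCut
  rwa [boundary_compl]

theorem inter (hU : T.IsCut Y U) (hW : T.IsCut Y W) : T.IsCut Y (U ∩ W) :=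
  ⟨(hU.1.union hW.1).subset (boundary_inter_subset U W),
    (boundary_inter_subset U W).trans (Set.union_subset hU.2 hW.2)⟩

theorem union (hU : T.IsCut Y U) (hW : T.IsCut Y W) : T.IsCut Y (U ∪ W) :=
  ⟨(hU.1.union hW.1).subset (boundary_union_subset U W),
    (boundary_union_subset U W).trans (Set.union_subset hU.2 hW.2)⟩

theorem diff (hU : T.IsCut Y U) (hW : T.IsCut Y W) : T.IsCut Y (U \ W) := hU.inter hW.compl

theorem empty : T.IsCut Y ∅ := by
  have h : T.boundary (∅ : Set V) = ∅ := by
    rw [Set.eq_empty_iff_forall_notMem]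
    rintro _ ⟨a, b, -, ha, -⟩
    exact ha
  unfold IsCut
  rw [h]
  exact ⟨Set.finite_empty, Set.empty_subset _⟩

theorem halfTree {v w : V} (h : T.graph.Adj v w) (hY : s(v, w) ∈ Y) :
    T.IsCut Y (T.halfTree v w) := by
  unfold IsCut
  rw [boundary_halfTree h]
  exact ⟨Set.finite_singleton _, Set.singleton_subset_iff.2 hY⟩

end IsCut

theorem boundary_smul_subset (g : G) (U : Set V) : T.boundary (g • U) ⊆ g • T.boundary U := by
  rintro _ ⟨a, b, hab, ha, hb, rfl⟩
  rw [Set.mem_smul_set_iff_inv_smul_mem] at ha hb ⊢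
  exact mem_boundary_of (T.smul_adj g⁻¹ a b hab) ha hb

theorem IsCut.smul (hU : T.IsCut Y U) (g : G) : T.IsCut (g • Y) (g • U) :=
  ⟨hU.1.smul_set.subset (boundary_smul_subset g U),
    (boundary_smul_subset g U).trans (Set.smul_set_mono hU.2)⟩

theorem exists_isCut_of_mem_closure (hY : Y ⊆ T.graph.edgeSet) {Z : Set G}
    (h : Z ∈ BooleanSubalgebra.closure (T.halfSets v₀ Y)) :
    ∃ U, T.IsCut Y U ∧ Z = pullback G v₀ U := by
  induction h using BooleanSubalgebra.closure_bot_sup_induction with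
  | mem Z hZ =>
    obtain ⟨v, w, he, rfl⟩ := hZ
    exact ⟨T.halfTree v w, .halfTree (hY he) he, rfl⟩
  | bot => exact ⟨∅, .empty, rfl⟩
  | sup x hx y hy ihx ihy =>
    obtain ⟨U, hU, rfl⟩ := ihx
    obtain ⟨W, hW, rfl⟩ := ihy
    exact ⟨U ∪ W, hU.union hW, rfl⟩
  | compl x hx ih =>
    obtain ⟨U, hU, rfl⟩ := ih
    exact ⟨Uᶜ, hU.compl, rfl⟩

theorem boundary_halfTree_inter_subset {v w : V} (h : T.graph.Adj v w) (hv : v ∈ U) (hw : w ∉ U) :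
    T.boundary (U ∩ T.halfTree v w) ⊆ T.boundary U \ {s(v, w)} := by
  rintro _ ⟨a, b, hab, ⟨haU, ha⟩, hb, rfl⟩
  have hb' : b ∈ T.halfTree v w := by
    by_contra hb'
    obtain ⟨rfl, rfl⟩ := eq_of_leaves_halfTree h hab ha hb'
    exact hw haU
  have hbU : b ∉ U := fun hbU => hb ⟨hbU, hb'⟩
  refine ⟨mem_boundary_of hab haU hbU, fun he => ?_⟩
  rcases Sym2.eq_iff.1 he with ⟨rfl, rfl⟩ | ⟨rfl, rfl⟩
  · exact not_mem_halfTree h ha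
  · exact hw haU

/-- Induction on the number of boundary edges. For a boundary edge `vw` with `v ∈ U`, neither `U`
intersected with the side of `w` nor `Uᶜ` intersected with the side of `v` has `vw` in its boundary
any more. The set `U` is the union of the former and of the side of `v` minus the latter. -/
theorem IsCut.pullback_mem_closure (v₀ : V) (hU : T.IsCut Y U) :
    pullback G v₀ U ∈ BooleanSubalgebra.closure (T.halfSets v₀ Y) := by
  induction hn : (T.boundary U).ncard using Nat.strong_induction_on generalizing U with
  | _ n ih =>
  have step : ∀ (W : Set V) (v w : V), T.boundary W = T.boundary U → T.graph.Adj v w → v ∈ W →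
      w ∉ W → pullback G v₀ (W ∩ T.halfTree v w) ∈
        BooleanSubalgebra.closure (T.halfSets v₀ Y) := by
    intro W v w hWU hvw hv hw
    have hsub := boundary_halfTree_inter_subset hvw hv hw
    have hmem : s(v, w) ∈ T.boundary W := mem_boundary_of hvw hv hw
    refine ih _ ?_ ⟨hU.1.subset ?_, ?_⟩ rfl
    · rw [← hn, ← hWU]
      refine lt_of_le_of_lt (Set.ncard_le_ncard hsub ((hWU ▸ hU.1).subset Set.sdiff_subset)) ?_
      exact Set.ncard_sdiff_singleton_lt_of_mem hmem (hWU ▸ hU.1)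
    · exact hsub.trans (hWU ▸ Set.sdiff_subset)
    · exact (hsub.trans (hWU ▸ Set.sdiff_subset)).trans hU.2
  by_cases hne : (T.boundary U).Nonempty
  · obtain ⟨_, v, w, hvw, hv, hw, rfl⟩ := hne
    have hY : s(v, w) ∈ Y := hU.2 (mem_boundary_of hvw hv hw)
    have h₁ := step U v w rfl hvw hv hw
    have h₂ := step Uᶜ w v (boundary_compl U) hvw.symm hw (by simpa using hv)
    have h₃ : T.halfSet v₀ w v ∈ BooleanSubalgebra.closure (T.halfSets v₀ Y) :=
      BooleanSubalgebra.subset_closure ⟨w, v, Sym2.eq_swap ▸ hY, rfl⟩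
    have e : pullback G v₀ U = pullback G v₀ (U ∩ T.halfTree v w) ⊔
        (T.halfSet v₀ w v ⊓ (pullback G v₀ (Uᶜ ∩ T.halfTree w v))ᶜ) := by
      ext g
      have := Set.ext_iff.1 (compl_halfTree hvw) (g • v₀)
      simp only [pullback, halfSet, Set.mem_compl_iff, Set.sup_eq_union, Set.inf_eq_inter,
        Set.mem_union, Set.mem_inter_iff, Set.mem_ofPred_eq] at this ⊢
      tauto
    rw [e]
    exact BooleanSubalgebra.supClosed _ h₁
      (BooleanSubalgebra.infClosed _ h₃ (BooleanSubalgebra.compl_mem h₂))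
  · rw [Set.not_nonempty_iff_eq_empty] at hne
    by_cases hU' : U = ∅
    · rw [hU']
      exact BooleanSubalgebra.bot_mem
    · obtain ⟨a, ha⟩ := Set.nonempty_iff_ne_empty.2 hU'
      have : U = Set.univ := Set.eq_univ_of_forall (mem_of_boundary_eq_empty hne ha)
      rw [this]
      exact BooleanSubalgebra.top_mem

/-- The pointwise stabilizer of the boundary of `U`. -/
def cutGroup (T : GTree G V) (U : Set V) : Subgroup G :=
  ⨅ f : T.boundary U, MulAction.stabilizer G (f : Sym2 V)

theorem IsCut.relIndex_cutGroup (hY : T.IsCylinder Y) (hU : T.IsCut Y U) {e : Sym2 V} (he : e ∈ Y) :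
    (T.cutGroup U).relIndex (MulAction.stabilizer G e) ≠ 0 := by
  have : Finite (T.boundary U) := hU.1
  exact Subgroup.relIndex_iInf_ne_zero fun f => (hY.commensurable (hU.2 f.2) he).1

theorem IsCut.commensurable_cutGroup (hY : T.IsCylinder Y) (hU : T.IsCut Y U) {e : Sym2 V}
    (he : e ∈ Y) (hne : (T.boundary U).Nonempty) :
    Subgroup.Commensurable (T.cutGroup U) (MulAction.stabilizer G e) := by
  obtain ⟨f, hf⟩ := hne
  refine ⟨hU.relIndex_cutGroup hY he, fun h => ?_⟩
  exact (hY.commensurable he (hU.2 hf)).1 (Subgroup.relIndex_eq_zero_of_le_right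
    (iInf_le (fun f : T.boundary U => MulAction.stabilizer G (f : Sym2 V)) ⟨f, hf⟩) h)

/-- Since `h` fixes every boundary edge, `U` and its preimage under `h` change along the same edges;
they agree at an end point of a boundary edge, hence everywhere. -/
theorem smul_mem_iff_of_mem_cutGroup (hne : (T.boundary U).Nonempty) {h : G}
    (hh : h ∈ T.cutGroup U) (x : V) : h • x ∈ U ↔ x ∈ U := by
  have hfix : ∀ f ∈ T.boundary U, h ∈ MulAction.stabilizer G f := fun f hf =>
    (Subgroup.mem_iInf.1 hh) ⟨f, hf⟩
  have key : T.boundary (U ∆ {z | h • z ∈ U}) = ∅ := by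
    rw [Set.eq_empty_iff_forall_notMem]
    rintro _ ⟨a, b, hab, ha, hb, -⟩
    simp only [Set.mem_symmDiff, Set.mem_ofPred_eq] at ha hb
    by_cases hf : s(a, b) ∈ T.boundary U
    · have h₁ := smul_eq_of_mem_stabilizer (T := T) hab (hfix _ hf) (x := a) (by simp)
      rw [h₁] at ha
      tauto
    · have h₁ := mem_iff_of_not_mem_boundary hab hf
      have h₂ : h • s(a, b) ∉ T.boundary U := by
        intro hf'
        have h₃ := MulAction.mem_stabilizer_iff.1 (hfix _ hf')
        exact hf (smul_left_cancel h h₃ ▸ hf')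
      have h₃ := mem_iff_of_not_mem_boundary (T.smul_adj h a b hab) h₂
      tauto
  obtain ⟨_, a, b, hab, ha, hb, rfl⟩ := hne
  have hfa := smul_eq_of_mem_stabilizer (T := T) hab (hfix _ (mem_boundary_of hab ha hb)) (x := a)
    (by simp)
  have := eq_empty_of_boundary_eq_empty key (a := a) (by
    simp only [Set.mem_symmDiff, Set.mem_ofPred_eq, hfa]
    tauto)
  have h' := symmDiff_eq_bot.1 this
  exact (Set.ext_iff.1 h' x).symm

/-- Fix a walk from `v₀` to `s⁻¹ v₀`. If `g` is in the symmetric difference, the translate of the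
walk by `g` crosses the boundary of `U` at some edge `f`, so `g⁻¹ f` is among the finitely many
edges of the walk. -/
theorem IsCut.hfinite_symmDiff (hY : T.IsCylinder Y) (hU : T.IsCut Y U) (s : G) :
    HFinite (T.cutGroup U) (((fun x => x * s) '' pullback G v₀ U) ∆ pullback G v₀ U) := by
  obtain ⟨p⟩ := T.isTree.connected.preconnected v₀ (s⁻¹ • v₀)
  have hsub : ((fun x => x * s) '' pullback G v₀ U) ∆ pullback G v₀ U ⊆
      ⋃ f ∈ T.boundary U, {g : G | g⁻¹ • f ∈ p.edges} := by
    intro g hg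
    by_contra hc
    simp only [Set.mem_iUnion, Set.mem_ofPred_eq, not_exists] at hc
    have key : g • v₀ ∈ U ↔ g • s⁻¹ • v₀ ∈ U := by
      refine mem_iff_of_walk (smulWalk g p) fun e he he' => hc e he' ?_
      rw [edges_smulWalk, List.mem_map] at he
      obtain ⟨f, hf, rfl⟩ := he
      simpa using hf
    have key' : g ∈ (fun x => x * s) '' pullback G v₀ U ↔ g • s⁻¹ • v₀ ∈ U := by
      constructor
      · rintro ⟨x, hx, rfl⟩
        have hx' : x • v₀ ∈ U := hx
        simpa [mul_smul] using hx'
      · intro h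
        exact ⟨g * s⁻¹, by simpa [pullback, mul_smul] using h, by simp⟩
    have key'' : g ∈ pullback G v₀ U ↔ g • v₀ ∈ U := Iff.rfl
    rw [Set.mem_symmDiff, key', key''] at hg
    tauto
  refine (HFinite.biUnion hU.1 fun f hf => ?_).mono hsub
  refine HFinite.of_relIndex (hU.relIndex_cutGroup hY (hU.2 hf)) (hfinite_stabilizer_iff.2 ?_)
  refine (List.finite_toSet p.edges).subset ?_
  rintro _ ⟨g, hg, rfl⟩
  exact hg

/-! ### Non-trivial cuts and the almost invariant sets they define -/

variable (T v₀) in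
/-- A non-trivial cut of a cylinder. -/
structure Cut where
  cyl : Set (Sym2 V)
  isCylinder : T.IsCylinder cyl
  carrier : Set V
  isCut : T.IsCut cyl carrier
  not_small : ¬ T.Small v₀ cyl carrier
  not_small_compl : ¬ T.Small v₀ cyl carrierᶜ

namespace Cut

variable (c c' : Cut T v₀)

theorem boundary_nonempty : (T.boundary c.carrier).Nonempty := by
  by_contra hne
  rw [Set.not_nonempty_iff_eq_empty] at hne
  by_cases h : c.carrier.Nonempty
  · obtain ⟨a, ha⟩ := h
    refine c.not_small_compl ?_
    rw [Set.eq_univ_of_forall (mem_of_boundary_eq_empty hne ha), Set.compl_univ]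
    exact .empty
  · rw [Set.not_nonempty_iff_eq_empty] at h
    exact c.not_small (h ▸ .empty)

/-- The almost invariant set defined by a cut. -/
def ai : AISet G where
  carrier := pullback G v₀ c.carrier
  grp := T.cutGroup c.carrier
  mul_mem h hh x hx := by
    have := (smul_mem_iff_of_mem_cutGroup c.boundary_nonempty hh (x • v₀)).2 hx
    rwa [← mul_smul] at this
  almost_inv s := c.isCut.hfinite_symmDiff c.isCylinder s

theorem hfinite_iff (W : Set V) : HFinite c.ai.grp (pullback G v₀ W) ↔ T.Small v₀ c.cyl W := by
  obtain ⟨e, he⟩ := c.isCylinder.nonempty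
  rw [c.isCylinder.small_iff he]
  exact HFinite.iff_of_commensurable
    (c.isCut.commensurable_cutGroup c.isCylinder he c.boundary_nonempty)

theorem commensurable_grp {e : Sym2 V} (he : e ∈ c.cyl) :
    Subgroup.Commensurable c.ai.grp (MulAction.stabilizer G e) :=
  c.isCut.commensurable_cutGroup c.isCylinder he c.boundary_nonempty

theorem ai_nontrivial : c.ai.Nontrivial :=
  ⟨fun h => c.not_small ((c.hfinite_iff _).1 h), fun h => c.not_small_compl ((c.hfinite_iff _).1 h)⟩

/-- The complementary cut. -/
def compl : Cut T v₀ :=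
  ⟨c.cyl, c.isCylinder, c.carrierᶜ, c.isCut.compl, c.not_small_compl, by
    rw [compl_compl]; exact c.not_small⟩

instance : SMul G (Cut T v₀) where
  smul g c := ⟨g • c.cyl, c.isCylinder.smul g, g • c.carrier, c.isCut.smul g,
    fun h => c.not_small (by simpa using h.smul g⁻¹), fun h => c.not_small_compl (by
        have := h.smul g⁻¹
        rwa [← Set.smul_set_compl, inv_smul_smul, inv_smul_smul] at this)⟩

theorem cyl_compl : c.compl.cyl = c.cyl := rfl

theorem carrier_compl : c.compl.carrier = c.carrierᶜ := rfl

theorem cyl_smul (g : G) : (g • c).cyl = g • c.cyl := rfl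

theorem carrier_smul (g : G) : (g • c).carrier = g • c.carrier := rfl

theorem ai_compl : c.compl.ai = c.ai.compl := by
  refine AISet.ext rfl ?_
  change T.cutGroup c.carrierᶜ = T.cutGroup c.carrier
  unfold cutGroup
  rw [boundary_compl]

theorem compl_compl : c.compl.compl = c := by
  cases c
  simp [compl]

/-- The unordered pair of classes defined by a cut. -/
def pair : Set (AIClass G) := AIClass.pair c.ai

theorem pair_compl : c.compl.pair = c.pair := by
  unfold pair
  rw [ai_compl, AIClass.pair_compl]

theorem pair_smul (g : G) : (g • c).pair = g • c.pair := by
  unfold pair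
  rw [AIClass.smul_pair]
  refine AIClass.pair_eq_of_equiv ?_
  have e : (g • c).ai.carrier = (g • c.ai).carrier := pullback_smul g v₀ c.carrier
  unfold AISet.Equiv
  rw [e]
  simp [HFinite.empty]

/-- `c` is almost contained in `c'`. -/
def Le : Prop := c.ai.AlmostLE c'.ai

/-- `c` and `c'` define equivalent almost invariant sets. -/
def Sim : Prop := c.ai.Equiv c'.ai

variable {c c'}

theorem le_iff : c.Le c' ↔ T.Small v₀ c.cyl (c.carrier \ c'.carrier) :=
  c.hfinite_iff (c.carrier \ c'.carrier)

theorem Le.compl (h : c.Le c') : c'.compl.Le c.compl := by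
  unfold Le
  rw [ai_compl, ai_compl]
  exact AISet.AlmostLE.compl h c.ai_nontrivial c'.ai_nontrivial

theorem le_compl_comm : c.Le c'.compl ↔ c'.Le c.compl :=
  ⟨fun h => by simpa only [compl_compl] using h.compl,
    fun h => by simpa only [compl_compl] using h.compl⟩

theorem compl_le_comm : c.compl.Le c' ↔ c'.compl.Le c :=
  ⟨fun h => by simpa only [compl_compl] using h.compl,
    fun h => by simpa only [compl_compl] using h.compl⟩

theorem compl_le_compl : c.compl.Le c'.compl ↔ c'.Le c :=
  ⟨fun h => by simpa only [compl_compl] using h.compl, Le.compl⟩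

theorem sim_iff : c.Sim c' ↔ c.Le c' ∧ c'.Le c :=
  ⟨fun h => ⟨AISet.Equiv.almostLE h, AISet.Equiv.almostLE (AISet.Equiv.symm h)⟩,
    fun h => AISet.AlmostLE.antisymm h.1 h.2 c.ai_nontrivial c'.ai_nontrivial⟩

theorem Sim.cyl_eq (h : c.Sim c') : c.cyl = c'.cyl := by
  obtain ⟨e, he⟩ := c.isCylinder.nonempty
  obtain ⟨e', he'⟩ := c'.isCylinder.nonempty
  have h₁ := c.commensurable_grp he
  have h₂ := c'.commensurable_grp he'
  have h₃ := AISet.Equiv.commensurable h c.ai_nontrivial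
  exact c.isCylinder.eq_of_commensurable c'.isCylinder he he' ((h₁.symm.trans h₃).trans h₂)

theorem pair_eq_iff : c.pair = c'.pair ↔ c.Sim c' ∨ c.Sim c'.compl := by
  unfold Sim
  rw [ai_compl]
  exact AIClass.pair_eq_iff c.ai_nontrivial

theorem cyl_eq_of_pair_eq (h : c.pair = c'.pair) : c.cyl = c'.cyl := by
  rcases pair_eq_iff.1 h with h | h
  · exact h.cyl_eq
  · exact h.cyl_eq

theorem Le.smul (h : c.Le c') (g : G) : (g • c).Le (g • c') := by
  rw [le_iff] at h ⊢
  have := h.smul g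
  rwa [Set.smul_set_sdiff] at this

theorem pair_mem_pairs (c : Cut T v₀) : c.pair ∈ pairs (T.based v₀) := by
  obtain ⟨e, he⟩ := c.isCylinder.nonempty
  exact ⟨c.ai, c.ai_nontrivial, ⟨c.cyl, c.isCylinder, c.ai, c.isCut.pullback_mem_closure v₀,
    ⟨e, he, c.isCut.commensurable_cutGroup c.isCylinder he c.boundary_nonempty⟩, rfl⟩, rfl⟩

/-- With `pair_mem_pairs`, this allows cuts to replace classes altogether. The group with which the
given almost invariant set comes is irrelevant, being commensurable with the stabilizers of edges of
the cylinder. -/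
theorem exists_pair_eq {p : Set (AIClass G)} (hp : p ∈ pairs (T.based v₀)) :
    ∃ c : Cut T v₀, c.pair = p := by
  obtain ⟨X', hX', ⟨Y, hY, X, hX, ⟨e, he, hcomm⟩, hmk⟩, rfl⟩ := hp
  have hXX' := (AIClass.mk_eq_iff hX').1 hmk
  have hXn := hXX'.nontrivial hX'
  obtain ⟨U, hU, hXU⟩ := exists_isCut_of_mem_closure hY.subset_edgeSet hX
  have hs : ∀ W : Set V, T.Small v₀ Y W ↔ HFinite X.grp (pullback G v₀ W) := fun W => by
    rw [hY.small_iff he]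
    exact (HFinite.iff_of_commensurable hcomm).symm
  let c : Cut T v₀ := ⟨Y, hY, U, hU, fun h => hXn.1 (hXU ▸ (hs U).1 h),
    fun h => hXn.2 (hXU ▸ (hs Uᶜ).1 h)⟩
  refine ⟨c, ?_⟩
  rw [AIClass.pair_eq_of_equiv hXX']
  refine AIClass.pair_eq_of_equiv ?_
  have e : c.ai.carrier = X.carrier := hXU.symm
  unfold AISet.Equiv
  rw [e]
  simp [HFinite.empty]

/-- Almost inclusion of two cuts of distinct cylinders. -/
theorem le_iff_of_ne (hC : T.HasConvexCylinders) (hne : c.cyl ≠ c'.cyl) {z z' : V}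
    (hz : VertexMem z c.cyl) (hz' : VertexMem z' c'.cyl) :
    c.Le c' ↔ z' ∉ c.carrier ∧ z ∈ c'.carrier := by
  -- By convexity `c₁` contains no vertex of the second cylinder and `c₂` contains all vertices of
  -- the first, so the difference `c₁ \ c₂` has empty boundary.
  have key : ∀ c₁ c₂ : Cut T v₀, c₁.cyl = c.cyl → c₂.cyl = c'.cyl → z' ∉ c₁.carrier →
      z ∈ c₂.carrier → c₁.carrier ⊆ c₂.carrier := by
    intro c₁ c₂ h₁ h₂ hz₁ hz₂
    have hb : T.boundary (c₁.carrier \ c₂.carrier) = ∅ := by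
      rw [Set.eq_empty_iff_forall_notMem]
      rintro f ⟨a, b, hab, ⟨ha₁, ha₂⟩, hb, rfl⟩
      by_cases hb₁ : b ∈ c₁.carrier
      · have hb₂ : b ∈ c₂.carrier := by
          by_contra hb₂
          exact hb ⟨hb₁, hb₂⟩
        have hf := c₂.isCut.2 (Sym2.eq_swap ▸ mem_boundary_of hab.symm hb₂ ha₂)
        rw [h₂] at hf
        have hne₁ : c₁.cyl ≠ c'.cyl := h₁ ▸ hne
        exact hz₁ ((hC.mem_iff_mem c₁.isCylinder c'.isCylinder hne₁ c₁.isCut.2 hz'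
          ⟨_, hf, by simp⟩).2 ha₁)
      · have hf := c₁.isCut.2 (mem_boundary_of hab ha₁ hb₁)
        rw [h₁] at hf
        have hne₂ : c₂.cyl ≠ c.cyl := h₂ ▸ hne.symm
        exact ha₂ ((hC.mem_iff_mem c₂.isCylinder c.isCylinder hne₂ c₂.isCut.2 hz
          ⟨_, hf, by simp⟩).1 hz₂)
    exact Set.sdiff_eq_empty.1 (eq_empty_of_boundary_eq_empty hb (a := z) fun h => h.2 hz₂)
  have key' : ∀ c₁ c₂ : Cut T v₀, c₁.cyl = c.cyl → c₂.cyl = c'.cyl → z' ∉ c₁.carrier →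
      z ∈ c₂.carrier → c₁.Le c₂ := fun c₁ c₂ h₁ h₂ hz₁ hz₂ =>
    AISet.almostLE_of_subset fun _ hg => key c₁ c₂ h₁ h₂ hz₁ hz₂ hg
  have hsim : ∀ c₁ c₂ : Cut T v₀, c₁.cyl = c.cyl → c₂.cyl = c'.cyl → ¬ c₁.Sim c₂ :=
    fun c₁ c₂ h₁ h₂ h => hne (h₁ ▸ h₂ ▸ h.cyl_eq)
  refine ⟨fun hle => ?_, fun h => key' c c' rfl rfl h.1 h.2⟩
  have hd : ∀ {c₁ c₂ : Cut T v₀}, c₁.Le c₂ → ¬ c₁.Le c₂.compl := by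
    intro c₁ c₂ h₁ h₂
    refine c₁.not_small (((le_iff.1 h₁).union (le_iff.1 h₂)).mono fun x hx => ?_)
    by_cases hx' : x ∈ c₂.carrier
    · exact Or.inr ⟨hx, fun h => h hx'⟩
    · exact Or.inl ⟨hx, hx'⟩
  -- Each of the four positions of `z` and `z'` yields one almost inclusion between `c` or its
  -- complement and `c'` or its complement. Three of these contradict `c ≤ c'`: they make a
  -- non-trivial cut small, or make cuts of distinct cylinders equivalent.
  by_cases h₁ : z' ∈ c.carrier <;> by_cases h₂ : z ∈ c'.carrier
  · have := key' c.compl c' rfl rfl (fun h => h h₁) h₂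
    exact absurd hle.compl (hd (compl_le_comm.1 this))
  · have := key' c.compl c'.compl rfl rfl (fun h => h h₁) h₂
    exact absurd (sim_iff.2 ⟨hle, compl_le_compl.1 this⟩) (hsim c c' rfl rfl)
  · exact ⟨h₁, h₂⟩
  · exact absurd (key' c c'.compl rfl rfl h₁ h₂) (hd hle)

theorem exists_equiv_of_pair_eq {X : AISet G} (h : c.pair = AIClass.pair X) :
    ∃ c₁ : Cut T v₀, (c₁ = c ∨ c₁ = c.compl) ∧ c₁.ai.Equiv X := by
  rcases (AIClass.pair_eq_iff c.ai_nontrivial).1 h with h | h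
  · exact ⟨c, .inl rfl, h⟩
  · refine ⟨c.compl, .inr rfl, ?_⟩
    rw [ai_compl]
    simpa only [AISet.compl_compl] using h.compl

theorem almostLE_iff {X X' : AISet G} (h : c.ai.Equiv X) (h' : c'.ai.Equiv X') :
    X.AlmostLE X' ↔ c.Le c' :=
  ⟨fun hle => hle.congr (h.nontrivial c.ai_nontrivial) (h'.nontrivial c'.ai_nontrivial) h.symm
    h'.symm, fun hle => AISet.AlmostLE.congr hle c.ai_nontrivial c'.ai_nontrivial h h'⟩

theorem pairCrosses_iff : PairCrosses c.pair c'.pair ↔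
    ¬ c.Le c' ∧ ¬ c.Le c'.compl ∧ ¬ c.compl.Le c' ∧ ¬ c.compl.Le c'.compl := by
  constructor
  · rintro ⟨X, X', h, h', hcr⟩
    obtain ⟨c₁, hc₁, h₁⟩ := exists_equiv_of_pair_eq h
    obtain ⟨c₁', hc₁', h₁'⟩ := exists_equiv_of_pair_eq h'
    have h₂ : c₁.compl.ai.Equiv X.compl := by rw [ai_compl]; exact h₁.compl
    have h₂' : c₁'.compl.ai.Equiv X'.compl := by rw [ai_compl]; exact h₁'.compl
    rw [AISet.crosses_iff, almostLE_iff h₁ h₁', almostLE_iff h₁ h₂', almostLE_iff h₂ h₁',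
      almostLE_iff h₂ h₂'] at hcr
    rcases hc₁ with rfl | rfl <;> rcases hc₁' with rfl | rfl <;>
      (try simp only [compl_compl] at hcr) <;> tauto
  · intro h
    refine ⟨c.ai, c'.ai, rfl, rfl, AISet.crosses_iff.2 ?_⟩
    rw [← ai_compl, ← ai_compl]
    unfold Le at h
    tauto

end Cut

end GTree

namespace GTree

variable {G V : Type*} [Group G] [MulAction G V] {T : GTree G V} {Y Y' : Set (Sym2 V)} {v₀ : V}
  {U W : Set V}

/-! ### The Boolean algebra of cuts of a cylinder -/

theorem not_small_of_subset_union {A B C : Set V} (hA : ¬ T.Small v₀ Y A) (hB : T.Small v₀ Y B)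
    (h : A ⊆ C ∪ B) : ¬ T.Small v₀ Y C :=
  fun hC => hA ((hC.union hB).mono h)

theorem not_small_mono {A C : Set V} (hA : ¬ T.Small v₀ Y A) (h : A ⊆ C) : ¬ T.Small v₀ Y C :=
  fun hC => hA (hC.mono h)

namespace Cut

variable {c c' d : Cut T v₀}

theorem Sim.symm (h : c.Sim c') : c'.Sim c := AISet.Equiv.symm h

theorem Sim.refl (c : Cut T v₀) : c.Sim c := AISet.Equiv.refl _

theorem sim_compl_compl : c.compl.Sim c'.compl ↔ c.Sim c' := by
  rw [sim_iff, sim_iff, compl_le_compl, compl_le_compl, and_comm]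

theorem Sim.pair_eq (h : c.Sim c') : c.pair = c'.pair := pair_eq_iff.2 (.inl h)

theorem le_iff_of_cyl_eq (h : c.cyl = Y) : c.Le c' ↔ T.Small v₀ Y (c.carrier \ c'.carrier) := by
  rw [le_iff, h]

theorem le_compl_iff_of_cyl_eq (h : c.cyl = Y) :
    c.Le c'.compl ↔ T.Small v₀ Y (c.carrier ∩ c'.carrier) := by
  rw [le_iff, h, carrier_compl, Set.sdiff_compl]

/-- A cut is an atom if it is indivisible up to small sets. -/
def IsAtom (c : Cut T v₀) : Prop :=
  ∀ U, T.IsCut c.cyl U → T.Small v₀ c.cyl (c.carrier ∩ U) ∨ T.Small v₀ c.cyl (c.carrier \ U)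

/-- A cut is in the middle if neither it nor its complement is an atom. -/
def IsMid (c : Cut T v₀) : Prop := ¬ c.IsAtom ∧ ¬ c.compl.IsAtom

theorem isMid_compl : c.compl.IsMid ↔ c.IsMid := by
  unfold IsMid
  rw [compl_compl, and_comm]

theorem exists_split (h : ¬ c.IsAtom) (hY : c.cyl = Y) : ∃ U₁ U₂, T.IsCut Y U₁ ∧ T.IsCut Y U₂ ∧
    ¬ T.Small v₀ Y U₁ ∧ ¬ T.Small v₀ Y U₂ ∧ Disjoint U₁ U₂ ∧ U₁ ⊆ c.carrier ∧ U₂ ⊆ c.carrier := by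
  subst hY
  unfold IsAtom at h
  push Not at h
  obtain ⟨U, hU, h₁, h₂⟩ := h
  exact ⟨_, _, c.isCut.inter hU, c.isCut.diff hU, h₁, h₂,
    Set.disjoint_left.2 fun x hx hx' => hx'.2 hx.2, Set.inter_subset_left, Set.sdiff_subset⟩

theorem not_isAtom_of_disjoint {A B : Set V} (hA : T.IsCut c.cyl A) (hAs : ¬ T.Small v₀ c.cyl A)
    (hBs : ¬ T.Small v₀ c.cyl B) (hd : Disjoint A B) (hAc : A ⊆ c.carrier) (hBc : B ⊆ c.carrier) :
    ¬ c.IsAtom := by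
  intro h
  rcases h A hA with h | h
  · exact hAs (h.mono fun x hx => ⟨hAc hx, hx⟩)
  · exact hBs (h.mono fun x hx => ⟨hBc hx, fun hx' => Set.disjoint_left.1 hd hx' hx⟩)

theorem IsAtom.sim_of_le (h : c.IsAtom) (hcyl : d.cyl = c.cyl) (hle : d.Le c) : d.Sim c := by
  refine sim_iff.2 ⟨hle, le_iff.2 ((h d.carrier (hcyl ▸ d.isCut)).resolve_left fun hs => ?_)⟩
  rw [le_iff_of_cyl_eq hcyl] at hle
  refine d.not_small ?_
  rw [hcyl]
  refine (hle.union hs).mono fun x hx => ?_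
  by_cases hx' : x ∈ c.carrier
  · exact Or.inr ⟨hx', hx⟩
  · exact Or.inl ⟨hx, hx'⟩

theorem Sim.isAtom (hs : c.Sim d) (h : c.IsAtom) : d.IsAtom := by
  intro U hU
  have hcyl := hs.cyl_eq
  have hle := (sim_iff.1 hs).2
  rw [le_iff] at hle
  rw [← hcyl] at hU hle ⊢
  refine (h U hU).imp (fun h => (h.union hle).mono fun x hx => ?_) fun h => (h.union hle).mono
    fun x hx => ?_
  · by_cases hx' : x ∈ c.carrier
    · exact Or.inl ⟨hx', hx.2⟩
    · exact Or.inr ⟨hx.1, hx'⟩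
  · by_cases hx' : x ∈ c.carrier
    · exact Or.inl ⟨hx', hx.2⟩
    · exact Or.inr ⟨hx.1, hx'⟩

theorem IsAtom.of_le (h : c.IsAtom) (hcyl : d.cyl = c.cyl) (hle : d.Le c) : d.IsAtom :=
  (h.sim_of_le hcyl hle).symm.isAtom h

/-- Two cuts of a cylinder cross. -/
def Crosses (c c' : Cut T v₀) : Prop :=
  ¬ c.Le c' ∧ ¬ c.Le c'.compl ∧ ¬ c.compl.Le c' ∧ ¬ c.compl.Le c'.compl

theorem Crosses.symm (h : c.Crosses c') : c'.Crosses c :=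
  ⟨fun h' => h.2.2.2 (compl_le_compl.2 h'), fun h' => h.2.1 (le_compl_comm.1 h'),
    fun h' => h.2.2.1 (compl_le_comm.1 h'), fun h' => h.1 (compl_le_compl.1 h')⟩

theorem Crosses.not_isAtom (h : c.Crosses c') (hcyl : c.cyl = c'.cyl) : ¬ c.IsAtom := fun ha =>
  (ha c'.carrier (hcyl ▸ c'.isCut)).elim
    (fun hs => h.2.1 ((le_compl_iff_of_cyl_eq rfl).2 hs)) fun hs => h.1 (le_iff.2 hs)

theorem Crosses.compl (h : c.Crosses c') : c.compl.Crosses c' := by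
  unfold Crosses at *
  rw [compl_compl]
  tauto

theorem Crosses.isMid (h : c.Crosses c') (hcyl : c.cyl = c'.cyl) : c.IsMid :=
  ⟨h.not_isAtom hcyl, h.compl.not_isAtom hcyl⟩

theorem crosses_of_not_small {A B C D : Set V} (hc : c.cyl = Y)
    (hA : ¬ T.Small v₀ Y A) (hB : ¬ T.Small v₀ Y B) (hC : ¬ T.Small v₀ Y C)
    (hD : ¬ T.Small v₀ Y D) (hAs : A ⊆ c.carrier ∩ c'.carrier) (hBs : B ⊆ c.carrier \ c'.carrier)
    (hCs : C ⊆ c'.carrier \ c.carrier) (hDs : ∀ x ∈ D, x ∉ c.carrier ∧ x ∉ c'.carrier) :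
    c.Crosses c' := by
  have hc' : c.compl.cyl = Y := hc
  refine ⟨?_, ?_, ?_, ?_⟩
  · rw [le_iff_of_cyl_eq hc]
    exact not_small_mono hB hBs
  · rw [le_compl_iff_of_cyl_eq hc]
    exact not_small_mono hA hAs
  · rw [le_iff_of_cyl_eq hc']
    exact not_small_mono hD hDs
  · rw [le_compl_iff_of_cyl_eq hc']
    exact not_small_mono hC fun x hx => ⟨(hCs hx).2, (hCs hx).1⟩

/-- Split `c` into `U₁`, `U₂`, and find disjoint pieces `W₁`, `W₂` in the complement of `c'`, none
of them small. The cut `U₁ ∪ W₁` contains one piece and misses the other on each side, so it crosses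
both `c` and `c'`. -/
theorem exists_crosses_of_le (hcyl : c.cyl = c'.cyl) (hle : c.Le c') (hc : ¬ c.IsAtom)
    (hc' : ¬ c'.compl.IsAtom) : ∃ d : Cut T v₀, d.cyl = c.cyl ∧ d.Crosses c ∧ d.Crosses c' := by
  obtain ⟨Y, hY⟩ : ∃ Y, c.cyl = Y := ⟨_, rfl⟩
  have hY' : c'.cyl = Y := hcyl ▸ hY
  obtain ⟨U₁, U₂, hU₁, hU₂, hs₁, hs₂, hd, hUc₁, hUc₂⟩ := exists_split hc hY
  obtain ⟨W₁, W₂, hW₁, hW₂, ht₁, ht₂, hd', hWc₁, hWc₂⟩ := exists_split hc' hY'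
  rw [le_iff_of_cyl_eq hY] at hle
  -- As `c` is contained in `c'` only up to a small set, the four pieces are trimmed to be genuinely
  -- inside `c'` or outside `c`.
  have hA : ¬ T.Small v₀ Y (U₁ ∩ c'.carrier) := not_small_of_subset_union hs₁ hle fun x hx => by
    by_cases h : x ∈ c'.carrier
    exacts [Or.inl ⟨hx, h⟩, Or.inr ⟨hUc₁ hx, h⟩]
  have hB : ¬ T.Small v₀ Y (U₂ ∩ c'.carrier) := not_small_of_subset_union hs₂ hle fun x hx => by
    by_cases h : x ∈ c'.carrier
    exacts [Or.inl ⟨hx, h⟩, Or.inr ⟨hUc₂ hx, h⟩]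
  have hC : ¬ T.Small v₀ Y (W₁ \ c.carrier) := not_small_of_subset_union ht₁ hle fun x hx => by
    by_cases h : x ∈ c.carrier
    exacts [Or.inr ⟨h, hWc₁ hx⟩, Or.inl ⟨hx, h⟩]
  have hD : ¬ T.Small v₀ Y (W₂ \ c.carrier) := not_small_of_subset_union ht₂ hle fun x hx => by
    by_cases h : x ∈ c.carrier
    exacts [Or.inr ⟨h, hWc₂ hx⟩, Or.inl ⟨hx, h⟩]
  have hBd : ∀ x ∈ U₂ ∩ c'.carrier, x ∉ U₁ ∪ W₁ := fun x hx h =>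
    h.elim (fun h => Set.disjoint_left.1 hd h hx.1) fun h => hWc₁ h hx.2
  have hDd : ∀ x ∈ W₂ \ c.carrier, x ∉ U₁ ∪ W₁ := fun x hx h =>
    h.elim (fun h => hx.2 (hUc₁ h)) fun h => Set.disjoint_left.1 hd' h hx.1
  refine ⟨⟨Y, hY ▸ c.isCylinder, U₁ ∪ W₁, hU₁.union hW₁, not_small_mono hs₁ Set.subset_union_left,
    not_small_mono hD hDd⟩, hY.symm, ?_, ?_⟩
  · exact crosses_of_not_small rfl hA hC hB hD (fun x hx => ⟨Or.inl hx.1, hUc₁ hx.1⟩)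
      (fun x hx => ⟨Or.inr hx.1, hx.2⟩) (fun x hx => ⟨hUc₂ hx.1, hBd x hx⟩)
      fun x hx => ⟨hDd x hx, hx.2⟩
  · exact crosses_of_not_small rfl hA hC hB hD (fun x hx => ⟨Or.inl hx.1, hx.2⟩)
      (fun x hx => ⟨Or.inr hx.1, hWc₁ hx.1⟩) (fun x hx => ⟨hx.2, hBd x hx⟩)
      fun x hx => ⟨hDd x hx, hWc₂ hx.1⟩

theorem Crosses.pairCrosses (h : c.Crosses c') : PairCrosses c.pair c'.pair := pairCrosses_iff.2 h

theorem Le.refl (c : Cut T v₀) : c.Le c := (sim_iff.1 (Sim.refl c)).1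

theorem Crosses.pair_ne (h : c.Crosses c') : c.pair ≠ c'.pair := fun he =>
  (pair_eq_iff.1 he).elim (fun hs => h.1 (sim_iff.1 hs).1) fun hs => h.2.1 (sim_iff.1 hs).1

theorem IsMid.exists_crosses (h : c.IsMid) : ∃ d : Cut T v₀, d.cyl = c.cyl ∧ d.Crosses c := by
  obtain ⟨d, hd, hdc, -⟩ := exists_crosses_of_le rfl (Le.refl c) h.1 h.2
  exact ⟨d, hd, hdc⟩

/-- If the cuts do not cross, then after complementing some of them one is almost contained in the
other, and `exists_crosses_of_le` applies. Hence all cuts in the middle of a cylinder form one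
cross-connected component. -/
theorem IsMid.exists_crosses_both (h : c.IsMid) (h' : c'.IsMid) (hcyl : c.cyl = c'.cyl) :
    c.Crosses c' ∨ ∃ d : Cut T v₀, d.cyl = c.cyl ∧ d.Crosses c ∧ d.Crosses c' := by
  by_contra! hc
  obtain ⟨h₁, h₂⟩ := hc
  have key : ∀ a b : Cut T v₀, (a = c ∨ a = c.compl) → (b = c' ∨ b = c'.compl) → ¬ a.Le b := by
    intro a b ha hb hle
    have ham : a.IsMid ∧ a.cyl = c.cyl := by
      rcases ha with rfl | rfl
      · exact ⟨h, rfl⟩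
      · exact ⟨isMid_compl.2 h, rfl⟩
    have hbm : b.IsMid ∧ b.cyl = c'.cyl := by
      rcases hb with rfl | rfl
      · exact ⟨h', rfl⟩
      · exact ⟨isMid_compl.2 h', rfl⟩
    obtain ⟨d, hd, hda, hdb⟩ := exists_crosses_of_le (ham.2.trans (hcyl.trans hbm.2.symm)) hle
      ham.1.1 hbm.1.2
    refine h₂ d (hd.trans ham.2) ?_ ?_
    · rcases ha with rfl | rfl
      · exact hda
      · have := hda.symm.compl.symm
        rwa [compl_compl] at this
    · rcases hb with rfl | rfl
      · exact hdb
      · have := hdb.symm.compl.symm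
        rwa [compl_compl] at this
  exact h₁ ⟨key _ _ (.inl rfl) (.inl rfl), key _ _ (.inl rfl) (.inr rfl),
    key _ _ (.inr rfl) (.inl rfl), key _ _ (.inr rfl) (.inr rfl)⟩

/-- A cut between two others which is not in the middle is equivalent to one of them. -/
theorem sim_or_sim_of_le {m : Cut T v₀} (hm : ¬ m.IsMid) (hc : c.cyl = m.cyl) (hd : d.cyl = m.cyl)
    (hle : c.Le m) (hle' : m.Le d) : c.Sim m ∨ d.Sim m := by
  by_cases h : m.IsAtom
  · exact .inl (h.sim_of_le hc hle)
  · have h' : m.compl.IsAtom := by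
      by_contra h'
      exact hm ⟨h, h'⟩
    exact .inr (sim_compl_compl.1 (h'.sim_of_le hd hle'.compl))

theorem IsAtom.pair_eq_of_not_le_compl (h : c.IsAtom) (h' : c'.IsAtom) (hcyl : c.cyl = c'.cyl)
    (hle : ¬ c.Le c'.compl) : c.pair = c'.pair := by
  rw [le_compl_iff_of_cyl_eq rfl] at hle
  have hs := (h c'.carrier (hcyl ▸ c'.isCut)).resolve_left hle
  exact (h'.sim_of_le hcyl (le_iff.2 hs)).pair_eq

/-- If a cylinder has a cut in the middle, any two inequivalent atoms are separated by such a cut. -/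
theorem IsAtom.exists_isMid_between {n : Cut T v₀} (h : c.IsAtom) (h' : c'.IsAtom)
    (hne : c.pair ≠ c'.pair) (hcyl : c.cyl = c'.cyl) (hn : n.IsMid) (hncyl : n.cyl = c.cyl) :
    ∃ m : Cut T v₀, m.cyl = c.cyl ∧ m.IsMid ∧ c.Le m ∧ m.Le c'.compl := by
  obtain ⟨Y, hY⟩ : ∃ Y, c.cyl = Y := ⟨_, rfl⟩
  have hY' : c'.cyl = Y := hcyl ▸ hY
  have hnY : n.cyl = Y := hncyl.trans hY
  have hdisj : T.Small v₀ Y (c.carrier ∩ c'.carrier) := by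
    by_contra hs
    rw [← le_compl_iff_of_cyl_eq hY] at hs
    exact hne (h.pair_eq_of_not_le_compl h' hcyl hs)
  have hcs : ¬ T.Small v₀ Y c.carrier := hY ▸ c.not_small
  have hcs' : ¬ T.Small v₀ Y c'.carrier := hY' ▸ c'.not_small
  have hcutc : T.IsCut Y c.carrier := hY ▸ c.isCut
  have hcutc' : T.IsCut Y c'.carrier := hY' ▸ c'.isCut
  -- The remainder `r` is not small, since otherwise `c` would be equivalent to the complement of
  -- `c'`.
  let r : Cut T v₀ := ⟨Y, hY ▸ c.isCylinder, (c.carrier ∪ c'.carrier)ᶜ,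
    (hcutc.union hcutc').compl, fun hs => by
      refine hne (pair_eq_iff.2 (.inr (sim_iff.2 ⟨(le_compl_iff_of_cyl_eq hY).2 hdisj, ?_⟩)))
      rw [← compl_le_comm, le_iff_of_cyl_eq (c := c.compl) (Y := Y) hY]
      refine hs.mono fun x hx => ?_
      simp only [carrier_compl, Set.mem_sdiff, Set.mem_compl_iff, Set.mem_union] at hx ⊢
      tauto, by
    rw [_root_.compl_compl]
    exact not_small_mono hcs Set.subset_union_left⟩
  -- If `r` were an atom, the algebra would have the three atoms `c`, `c'`, `r`. Two of them lie on
  -- the same side of `n`, so `n` or its complement would be almost contained in the third and be an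
  -- atom.
  have hr : ¬ r.IsAtom := by
    intro hr
    have hcut : T.IsCut Y n.carrier := hnY ▸ n.isCut
    have h₁ := h n.carrier (hY ▸ hcut)
    have h₂ := h' n.carrier (hY' ▸ hcut)
    have h₃ := hr n.carrier hcut
    rw [hY] at h₁
    rw [hY'] at h₂
    have h₃' : T.Small v₀ Y (r.carrier ∩ n.carrier) ∨ T.Small v₀ Y (r.carrier \ n.carrier) := h₃
    have hrc : ∀ x, x ∈ r.carrier ↔ ¬ (x ∈ c.carrier ∨ x ∈ c'.carrier) := fun x => Iff.rfl
    have key : ∀ a : Cut T v₀, a.IsAtom → a.cyl = Y →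
        ¬ T.Small v₀ Y (n.carrier \ a.carrier) ∧ ¬ T.Small v₀ Y (n.carrierᶜ \ a.carrier) := by
      intro a ha haY
      refine ⟨fun hs => hn.1 (ha.of_le (hnY.trans haY.symm) ((le_iff_of_cyl_eq hnY).2 hs)),
        fun hs => hn.2 (ha.of_le (d := n.compl) (hnY.trans haY.symm)
          ((le_iff_of_cyl_eq (c := n.compl) hnY).2 hs))⟩
    have k₁ := key c h hY
    have k₂ := key c' h' hY'
    have k₃ := key r hr rfl
    rcases h₁ with h₁ | h₁ <;> rcases h₂ with h₂ | h₂ <;> rcases h₃' with h₃ | h₃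
    · exact k₁.1 ((h₂.union h₃).mono fun x hx => by have := hrc x; simp at hx ⊢; tauto)
    · exact k₃.1 ((h₁.union h₂).mono fun x hx => by have := hrc x; simp at hx ⊢; tauto)
    · exact k₂.1 ((h₁.union h₃).mono fun x hx => by have := hrc x; simp at hx ⊢; tauto)
    · exact k₁.2 ((h₂.union h₃).mono fun x hx => by have := hrc x; simp at hx ⊢; tauto)
    · exact k₁.1 ((h₂.union h₃).mono fun x hx => by have := hrc x; simp at hx ⊢; tauto)
    · exact k₂.2 ((h₁.union h₃).mono fun x hx => by have := hrc x; simp at hx ⊢; tauto)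
    · exact k₃.2 ((h₁.union h₂).mono fun x hx => by have := hrc x; simp at hx ⊢; tauto)
    · exact k₁.2 ((h₂.union h₃).mono fun x hx => by have := hrc x; simp at hx ⊢; tauto)
  obtain ⟨D₁, D₂, hD₁, hD₂, hs₁, hs₂, hd, hr₁, hr₂⟩ := exists_split (Y := Y) hr rfl
  have key : ∀ x, (x ∈ D₁ → x ∉ c.carrier ∧ x ∉ c'.carrier ∧ x ∉ D₂) ∧
      (x ∈ D₂ → x ∉ c.carrier ∧ x ∉ c'.carrier) := fun x => by
    have h₁ := @hr₁ x
    have h₂ := @hr₂ x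
    have h₃ : x ∈ D₁ → x ∉ D₂ := fun hx => Set.disjoint_left.1 hd hx
    simp only [r, Set.mem_compl_iff, Set.mem_union] at h₁ h₂
    tauto
  have hcc : ¬ T.Small v₀ Y (c'.carrier \ c.carrier) :=
    not_small_of_subset_union hcs' hdisj fun x hx => by
      simp only [Set.mem_union, Set.mem_sdiff, Set.mem_inter_iff]
      tauto
  -- With `r` split into `D₁` and `D₂`, the cut `c ∪ D₁` contains the two disjoint non-small sets
  -- `c` and `D₁`, and its complement contains `D₂` and `c' \ c`.
  let m : Cut T v₀ := ⟨Y, hY ▸ c.isCylinder, c.carrier ∪ D₁, hcutc.union hD₁,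
    not_small_mono hs₁ Set.subset_union_right, not_small_mono hs₂ fun x hx => by
      have := key x
      simp only [Set.mem_union, Set.mem_compl_iff]
      tauto⟩
  refine ⟨m, hY.symm, ⟨?_, ?_⟩, ?_, ?_⟩
  · exact not_isAtom_of_disjoint (c := m) hcutc hcs hs₁ (Set.disjoint_left.2 fun x hx hx' =>
      ((key x).1 hx').1 hx) Set.subset_union_left Set.subset_union_right
  · refine not_isAtom_of_disjoint (c := m.compl) hD₂ hs₂ hcc (Set.disjoint_left.2 fun x hx hx' =>
      ((key x).2 hx).2 hx'.1) ?_ ?_ <;>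
    · intro x hx
      have := key x
      simp only [m, carrier_compl, Set.mem_union, Set.mem_compl_iff, Set.mem_sdiff] at hx ⊢
      tauto
  · rw [le_iff_of_cyl_eq hY]
    refine Small.empty.mono fun x hx => hx.2 (Or.inl hx.1)
  · rw [le_compl_iff_of_cyl_eq (Y := Y) rfl]
    refine hdisj.mono fun x hx => ?_
    have := key x
    simp only [m, Set.mem_union, Set.mem_inter_iff] at hx ⊢
    tauto

/-- If a cut and its complement are atoms, they are the only cuts of the cylinder. -/
theorem IsAtom.pair_eq_of_compl (h : c.IsAtom) (h' : c.compl.IsAtom) (hcyl : d.cyl = c.cyl) :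
    d.pair = c.pair := by
  have h₁ := h d.carrier (hcyl ▸ d.isCut)
  have h₂ := h' d.carrier (hcyl ▸ d.isCut)
  have key : d.Le c ∨ d.Le c.compl := by
    rw [le_iff_of_cyl_eq hcyl, le_iff_of_cyl_eq hcyl]
    have hd : ¬ T.Small v₀ c.cyl d.carrierᶜ := hcyl ▸ d.not_small_compl
    rcases h₁ with h₁ | h₁
    · exact .inr (h₁.mono fun x hx => by simp [carrier_compl] at hx ⊢; tauto)
    rcases h₂ with h₂ | h₂
    · exact .inl (h₂.mono fun x hx => by simp [carrier_compl] at hx ⊢; tauto)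
    · refine absurd ((h₁.union h₂).mono fun x hx => ?_) hd
      simp [carrier_compl] at hx ⊢
      tauto
  rcases key with hle | hle
  · exact (h.sim_of_le hcyl hle).pair_eq
  · rw [(h'.sim_of_le hcyl hle).pair_eq, pair_compl]

end Cut

end GTree

namespace GTree

variable {G V : Type*} [Group G] [MulAction G V] {T : GTree G V} {Y Y' : Set (Sym2 V)} {v₀ : V}
  {U W : Set V}

/-! ### Cross-connected components -/

theorem _root_.Sym2.exists_mem {α : Type*} (e : Sym2 α) : ∃ x, x ∈ e := ⟨_, Sym2.out_fst_mem e⟩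

theorem IsCylinder.exists_vertexMem (hY : T.IsCylinder Y) : ∃ x, VertexMem x Y := by
  obtain ⟨e, he⟩ := hY.nonempty
  obtain ⟨x, hx⟩ := e.exists_mem
  exact ⟨x, e, he, hx⟩

namespace Cut

variable {c c' d : Cut T v₀}

/-- By `le_iff_of_ne`, wherever `z` and `z'` lie, one of the four possible almost inclusions holds
for cuts of distinct cylinders. -/
theorem Crosses.cyl_eq (hC : T.HasConvexCylinders) (h : c.Crosses c') : c.cyl = c'.cyl := by
  by_contra hne
  obtain ⟨z, hz⟩ := c.isCylinder.exists_vertexMem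
  obtain ⟨z', hz'⟩ := c'.isCylinder.exists_vertexMem
  have h₁ := le_iff_of_ne hC (c := c) (c' := c') hne hz hz'
  have h₂ := le_iff_of_ne hC (c := c) (c' := c'.compl) hne hz hz'
  have h₃ := le_iff_of_ne hC (c := c.compl) (c' := c') hne hz hz'
  have h₄ := le_iff_of_ne hC (c := c.compl) (c' := c'.compl) hne hz hz'
  simp only [carrier_compl, Set.mem_compl_iff] at h₁ h₂ h₃ h₄
  unfold Crosses at h
  tauto

/-- Two cuts define the same cross-connected component. -/
def Rel (c c' : Cut T v₀) : Prop := c.cyl = c'.cyl ∧ (c.pair = c'.pair ∨ c.IsMid ∧ c'.IsMid)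

theorem Sim.isMid (h : c.Sim c') (hm : c.IsMid) : c'.IsMid :=
  ⟨fun ha => hm.1 (h.symm.isAtom ha), fun ha => hm.2 ((sim_compl_compl.2 h.symm).isAtom ha)⟩

theorem isMid_of_pair_eq (h : c.pair = c'.pair) (hm : c.IsMid) : c'.IsMid := by
  rcases pair_eq_iff.1 h with h | h
  · exact h.isMid hm
  · exact isMid_compl.1 (h.isMid hm)

theorem Rel.symm (h : c.Rel c') : c'.Rel c := ⟨h.1.symm, h.2.imp Eq.symm And.symm⟩

theorem Rel.trans (h : c.Rel c') (h' : c'.Rel d) : c.Rel d := by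
  refine ⟨h.1.trans h'.1, ?_⟩
  rcases h.2 with h₁ | h₁ <;> rcases h'.2 with h₂ | h₂
  · exact .inl (h₁.trans h₂)
  · exact .inr ⟨isMid_of_pair_eq h₁.symm h₂.1, h₂.2⟩
  · exact .inr ⟨h₁.1, isMid_of_pair_eq h₂ h₁.2⟩
  · exact .inr ⟨h₁.1, h₂.2⟩

theorem rel_of_pair_eq (h : c.pair = c'.pair) : c.Rel c' := ⟨cyl_eq_of_pair_eq h, .inl h⟩

theorem rel_of_crossEquiv (hC : T.HasConvexCylinders) (h : CrossEquiv (T.based v₀) c.pair c'.pair) :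
    c.Rel c' := by
  -- The alternative `p = q` is needed because the generated relation is reflexive also on sets of
  -- classes that do not come from a cut.
  have key : ∀ p q, CrossEquiv (T.based v₀) p q → p = q ∨ p ∈ pairs (T.based v₀) ∧
      q ∈ pairs (T.based v₀) ∧ ∀ c c' : Cut T v₀, c.pair = p → c'.pair = q → c.Rel c' := by
    intro p q h
    induction h with
    | rel p q h =>
      refine .inr ⟨h.1, h.2.1, ?_⟩
      rintro c c' rfl rfl
      have hcr : c.Crosses c' := pairCrosses_iff.1 h.2.2
      have hcyl := hcr.cyl_eq hC
      exact ⟨hcyl, .inr ⟨hcr.isMid hcyl, hcr.symm.isMid hcyl.symm⟩⟩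
    | refl p => exact .inl rfl
    | symm p q _ ih =>
      rcases ih with ih | ih
      · exact .inl ih.symm
      · exact .inr ⟨ih.2.1, ih.1, fun c c' h h' => (ih.2.2 c' c h' h).symm⟩
    | trans p q r _ _ ih₁ ih₂ =>
      rcases ih₁ with rfl | ih₁
      · exact ih₂
      rcases ih₂ with rfl | ih₂
      · exact .inr ih₁
      · obtain ⟨d, hd⟩ := exists_pair_eq ih₁.2.1
        exact .inr ⟨ih₁.1, ih₂.2.1, fun c c' h h' =>
          (ih₁.2.2 c d h hd).trans (ih₂.2.2 d c' hd h')⟩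
  rcases key _ _ h with h | h
  · exact rel_of_pair_eq h
  · exact h.2.2 c c' rfl rfl

theorem Rel.crossEquiv (h : c.Rel c') : CrossEquiv (T.based v₀) c.pair c'.pair := by
  have key : ∀ {a b : Cut T v₀}, a.Crosses b → CrossEquiv (T.based v₀) a.pair b.pair :=
    fun {a b} h => .rel _ _ ⟨a.pair_mem_pairs, b.pair_mem_pairs, h.pairCrosses⟩
  rcases h.2 with h₁ | ⟨h₁, h₂⟩
  · rw [h₁]
    exact .refl _
  · rcases h₁.exists_crosses_both h₂ h.1 with h | ⟨d, -, h₁, h₂⟩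
    · exact key h
    · exact .trans _ _ _ (.symm _ _ (key h₁)) (key h₂)

/-- The cross-connected component of a cut. -/
def ccc (c : Cut T v₀) : CCC (T.based v₀) :=
  ⟨{q | q ∈ pairs (T.based v₀) ∧ CrossEquiv (T.based v₀) c.pair q}, c.pair, c.pair_mem_pairs, rfl⟩

theorem mem_ccc_iff (hC : T.HasConvexCylinders) : c'.pair ∈ c.ccc.1 ↔ c.Rel c' :=
  ⟨fun h => rel_of_crossEquiv hC h.2, fun h => ⟨c'.pair_mem_pairs, h.crossEquiv⟩⟩

theorem pair_mem_ccc (c : Cut T v₀) : c.pair ∈ c.ccc.1 := ⟨c.pair_mem_pairs, .refl _⟩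

theorem exists_ccc_eq (C : CCC (T.based v₀)) : ∃ c : Cut T v₀, c.ccc = C := by
  obtain ⟨C, p, hp, rfl⟩ := C
  obtain ⟨c, rfl⟩ := exists_pair_eq hp
  exact ⟨c, rfl⟩

theorem ccc_eq_of_rel (h : c.Rel c') : c.ccc = c'.ccc := by
  refine Subtype.ext (Set.ext fun q => and_congr_right fun _ => ?_)
  exact ⟨fun h' => .trans _ _ _ h.symm.crossEquiv h', fun h' => .trans _ _ _ h.crossEquiv h'⟩

theorem ccc_eq_iff (hC : T.HasConvexCylinders) : c.ccc = c'.ccc ↔ c.Rel c' :=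
  ⟨fun h => (mem_ccc_iff hC).1 (h ▸ c'.pair_mem_ccc), ccc_eq_of_rel⟩

theorem pair_mem_iff (hC : T.HasConvexCylinders) {C : CCC (T.based v₀)} :
    c.pair ∈ C.1 ↔ c.ccc = C := by
  obtain ⟨c', rfl⟩ := exists_ccc_eq C
  rw [mem_ccc_iff hC, ccc_eq_iff hC]
  exact ⟨Rel.symm, Rel.symm⟩

theorem ccc_compl (c : Cut T v₀) : c.compl.ccc = c.ccc :=
  ccc_eq_of_rel (rel_of_pair_eq c.pair_compl)

theorem smul_ccc (hC : T.HasConvexCylinders) (g : G) (c : Cut T v₀) : g • c.ccc = (g • c).ccc := by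
  refine ((pair_mem_iff hC).1 ?_).symm
  rw [pair_smul]
  exact Set.smul_mem_smul_set c.pair_mem_ccc

end Cut

open Cut

/-- The cylinder of a cross-connected component. -/
noncomputable def cccCyl (C : CCC (T.based v₀)) : T.V₁ :=
  ⟨(exists_ccc_eq C).choose.cyl, (exists_ccc_eq C).choose.isCylinder⟩

theorem cccCyl_ccc (hC : T.HasConvexCylinders) (c : Cut T v₀) :
    cccCyl c.ccc = ⟨c.cyl, c.isCylinder⟩ :=
  Subtype.ext ((ccc_eq_iff hC).1 (exists_ccc_eq c.ccc).choose_spec).1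

theorem cccCyl_smul (hC : T.HasConvexCylinders) (g : G) (C : CCC (T.based v₀)) :
    cccCyl (g • C) = g • cccCyl C := by
  obtain ⟨c, rfl⟩ := exists_ccc_eq C
  rw [smul_ccc hC, cccCyl_ccc hC, cccCyl_ccc hC]
  rfl

theorem _root_.CCC.ext_iff {𝒳 : SubMulAction G (AIClass G)} {C C' : CCC 𝒳} : C = C' ↔ C.1 = C'.1 :=
  Subtype.ext_iff

/-- Genuine inclusions may be relaxed to almost inclusions: the middle set is kept, the first one is
shrunk to a subset of it, and the complement of the third one is shrunk to a subset of its
complement. -/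
theorem between_iff (hC : T.HasConvexCylinders) {C₁ C₂ C₃ : CCC (T.based v₀)} :
    Between C₁.1 C₂.1 C₃.1 ↔ (C₁ ≠ C₂ ∧ C₂ ≠ C₃ ∧ C₁ ≠ C₃) ∧ ∃ c₁ c₂ c₃ : Cut T v₀,
      c₁.ccc = C₁ ∧ c₂.ccc = C₂ ∧ c₃.ccc = C₃ ∧ c₁.Le c₂ ∧ c₂.Le c₃ := by
  unfold Between
  simp only [← CCC.ext_iff, Ne]
  refine and_congr_right fun _ => ⟨?_, ?_⟩
  · rintro ⟨X₁, X₂, X₃, h₁, h₂, h₃, h₁₂, h₂₃⟩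
    have key : ∀ {X : AISet G} {C : CCC (T.based v₀)}, AIClass.pair X ∈ C.1 →
        ∃ c : Cut T v₀, c.ccc = C ∧ c.ai.Equiv X := by
      intro X C hX
      have hp : AIClass.pair X ∈ pairs (T.based v₀) := by
        obtain ⟨p, -, hp⟩ := C.2
        rw [hp] at hX
        exact hX.1
      obtain ⟨d, hd⟩ := exists_pair_eq hp
      obtain ⟨c, hc, hcX⟩ := exists_equiv_of_pair_eq hd
      refine ⟨c, (pair_mem_iff hC).1 ?_, hcX⟩
      rcases hc with rfl | rfl
      · rwa [hd]
      · rwa [pair_compl, hd]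
    obtain ⟨c₁, hc₁, e₁⟩ := key h₁
    obtain ⟨c₂, hc₂, e₂⟩ := key h₂
    obtain ⟨c₃, hc₃, e₃⟩ := key h₃
    exact ⟨c₁, c₂, c₃, hc₁, hc₂, hc₃, (almostLE_iff e₁ e₂).1 (AISet.almostLE_of_subset h₁₂),
      (almostLE_iff e₂ e₃).1 (AISet.almostLE_of_subset h₂₃)⟩
  · rintro ⟨c₁, c₂, c₃, rfl, rfl, rfl, h₁₂, h₂₃⟩
    obtain ⟨X₁, e₁, hX₁⟩ := AISet.AlmostLE.exists_subset h₁₂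
    obtain ⟨X₃, e₃, hX₃⟩ := AISet.AlmostLE.exists_subset h₂₃.compl
    refine ⟨X₁, c₂.ai, X₃.compl, ?_, c₂.pair_mem_ccc, ?_, hX₁, fun x hx hx' => hX₃ hx' hx⟩
    · rw [← AIClass.pair_eq_of_equiv e₁]
      exact c₁.pair_mem_ccc
    · rw [AIClass.pair_compl, ← AIClass.pair_eq_of_equiv e₃]
      have h := c₃.pair_mem_ccc
      rwa [← pair_compl] at h

theorem between_symm (hC : T.HasConvexCylinders) {C₁ C₂ C₃ : CCC (T.based v₀)}
    (h : Between C₁.1 C₂.1 C₃.1) : Between C₃.1 C₂.1 C₁.1 := by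
  rw [between_iff hC] at h ⊢
  obtain ⟨⟨h₁, h₂, h₃⟩, c₁, c₂, c₃, e₁, e₂, e₃, h₁₂, h₂₃⟩ := h
  refine ⟨⟨h₂.symm, h₁.symm, h₃.symm⟩, c₃.compl, c₂.compl, c₁.compl, ?_, ?_, ?_, h₂₃.compl,
    h₁₂.compl⟩ <;> rwa [ccc_compl]

end GTree

namespace GTree

variable {G V : Type*} [Group G] [MulAction G V] {T : GTree G V} {Y Y' : Set (Sym2 V)} {v₀ : V}
  {U W : Set V}

open Cut

/-! ### Main components, and components that are terminal at a vertex -/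

namespace Cut

variable {c c' d : Cut T v₀}

/-- A cut in the middle crosses another cut, which is then in its component, whereas any other cut
crosses nothing. -/
theorem nontrivial_ccc_iff (hC : T.HasConvexCylinders) : c.ccc.1.Nontrivial ↔ c.IsMid := by
  constructor
  · rintro ⟨p, hp, q, hq, hne⟩
    obtain ⟨d, rfl⟩ := exists_pair_eq hp.1
    obtain ⟨d', rfl⟩ := exists_pair_eq hq.1
    by_contra hm
    have h₁ := (((mem_ccc_iff hC).1 hp).2).resolve_right fun h => hm h.1
    have h₂ := (((mem_ccc_iff hC).1 hq).2).resolve_right fun h => hm h.1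
    exact hne (h₁.symm.trans h₂)
  · intro h
    obtain ⟨d, hd, hcr⟩ := h.exists_crosses
    exact ⟨d.pair, (mem_ccc_iff hC).2 ⟨hd.symm, .inr ⟨h, hcr.isMid hd⟩⟩, c.pair, c.pair_mem_ccc,
      hcr.pair_ne⟩

theorem exists_ccc_eq_not_mem (C : CCC (T.based v₀)) (x : V) :
    ∃ c : Cut T v₀, c.ccc = C ∧ x ∉ c.carrier := by
  obtain ⟨c, rfl⟩ := exists_ccc_eq C
  by_cases h : x ∈ c.carrier
  · exact ⟨c.compl, ccc_compl c, fun h' => h' h⟩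
  · exact ⟨c, rfl, h⟩

theorem exists_ccc_eq_mem (C : CCC (T.based v₀)) (x : V) :
    ∃ c : Cut T v₀, c.ccc = C ∧ x ∈ c.carrier := by
  obtain ⟨c, hc, hx⟩ := exists_ccc_eq_not_mem C x
  exact ⟨c.compl, by rwa [ccc_compl], hx⟩

end Cut

/-- A cross-connected component is main if it contains several pairs, or if it is the only one in
its cylinder. -/
def IsMain (C : CCC (T.based v₀)) : Prop :=
  C.1.Nontrivial ∨ ∀ C' : CCC (T.based v₀), cccCyl C' = cccCyl C → C' = C

theorem IsMain.smul (hC : T.HasConvexCylinders) {C : CCC (T.based v₀)} (h : IsMain C) (g : G) :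
    IsMain (g • C) := by
  refine h.imp (fun h => h.image (MulAction.injective g)) fun h C' hC' => ?_
  rw [← h (g⁻¹ • C') (by rw [cccCyl_smul hC, hC', cccCyl_smul hC, inv_smul_smul]), smul_inv_smul]

theorem IsMain.eq (hC : T.HasConvexCylinders) {C C' : CCC (T.based v₀)} (h : IsMain C)
    (h' : IsMain C') (hcyl : cccCyl C = cccCyl C') : C = C' := by
  rcases h with h | h
  · rcases h' with h' | h'
    · obtain ⟨c, rfl⟩ := exists_ccc_eq C
      obtain ⟨c', rfl⟩ := exists_ccc_eq C'
      rw [nontrivial_ccc_iff hC] at h h'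
      rw [cccCyl_ccc hC, cccCyl_ccc hC] at hcyl
      exact ccc_eq_of_rel ⟨congrArg Subtype.val hcyl, .inr ⟨h, h'⟩⟩
    · exact h' C hcyl
  · exact (h C' hcyl.symm).symm

/-- `C` is terminal at the vertex `x` of its cylinder. -/
def IsTerminal (x : V) (C : CCC (T.based v₀)) : Prop :=
  VertexMem x (cccCyl C).1 ∧ ∀ c c' : Cut T v₀, c.ccc = C → c'.cyl = c.cyl → c.Le c' →
    x ∉ c'.carrier → c'.ccc = C

theorem IsTerminal.smul (hC : T.HasConvexCylinders) {x : V} {C : CCC (T.based v₀)}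
    (h : IsTerminal x C) (g : G) : IsTerminal (g • x) (g • C) := by
  refine ⟨?_, fun c c' hc hc' hle hx => ?_⟩
  · rw [cccCyl_smul hC]
    exact h.1.smul g
  · have h₁ := h.2 (g⁻¹ • c) (g⁻¹ • c') (by rw [← smul_ccc hC, hc, inv_smul_smul])
      (by rw [cyl_smul, cyl_smul, hc']) (hle.smul g⁻¹) (by
        rwa [carrier_smul, Set.mem_smul_set_iff_inv_smul_mem, inv_inv])
    rw [← h₁, smul_ccc hC]
    have : g • g⁻¹ • c' = c' := by
      cases c'
      change Cut.mk _ _ _ _ _ _ = _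
      simp [cyl_smul, carrier_smul]
    rw [this]

/-- The component of the vertex `x` in the complement of the edges of `Y`. -/
def component (T : GTree G V) (Y : Set (Sym2 V)) (x : V) : Set V :=
  {z | (T.graph.deleteEdges Y).Reachable x z}

theorem mem_component_self (x : V) : x ∈ T.component Y x := SimpleGraph.Reachable.refl _

theorem component_subset {x : V} (hU : T.boundary U ⊆ Y) (hx : x ∈ U) : T.component Y x ⊆ U :=
  fun _ hz => (mem_iff_of_reachable hU hz).1 hx

/-- An edge leaving the component is in `Y`, so its inner end point is a vertex of the cylinder in
the component of `x`; by convexity it is `x`. -/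
theorem boundary_component_subset (hC : T.HasConvexCylinders) (hY : T.IsCylinder Y) {x : V}
    (hx : VertexMem x Y) : T.boundary (T.component Y x) ⊆ {e | e ∈ Y ∧ x ∈ e} := by
  rintro _ ⟨a, b, hab, ha, hb, rfl⟩
  have hY' : s(a, b) ∈ Y := by
    by_contra h
    refine hb (SimpleGraph.Reachable.trans ha (SimpleGraph.Adj.reachable ?_))
    rw [SimpleGraph.deleteEdges_adj]
    exact ⟨hab, h⟩
  have : x = a := hC.eq_of_reachable hY hx ⟨_, hY', by simp⟩ ha
  exact ⟨hY', by simp [this]⟩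

/-- Finiteness of the `Y`-valence of `x` makes the component a cut. It is connected outside `Y`, so
a cut of `Y` contains it or misses it, which makes it an atom. It is not small because of the second
cylinder at `x`, and its complement contains a half-tree. -/
theorem exists_component_cut (hT : T.IsMinimal) (hC : T.HasConvexCylinders) (hY : T.IsCylinder Y)
    {x : V} (hx : VertexMem x Y) (hx' : T.InTwoCylinders x) (hfin : {e | e ∈ Y ∧ x ∈ e}.Finite) :
    ∃ k : Cut T v₀, k.cyl = Y ∧ k.carrier = T.component Y x ∧ k.IsAtom := by
  have hb := boundary_component_subset hC hY hx
  have hcut : T.IsCut Y (T.component Y x) := ⟨hfin.subset hb, fun e he => (hb he).1⟩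
  let k : Cut T v₀ := ⟨Y, hY, T.component Y x, hcut,
    hT.not_small_of_inTwoCylinders hC hY hcut.2 hx hx' (mem_component_self x), by
      obtain ⟨e, he, w, rfl⟩ := hx
      have hw : T.graph.Adj x w := hY.subset_edgeSet he
      refine not_small_mono (hT.not_small_halfTree hY hw) ?_
      rw [Set.subset_compl_comm]
      refine component_subset ?_ (not_mem_halfTree hw)
      rw [boundary_compl, boundary_halfTree hw]
      exact Set.singleton_subset_iff.2 he⟩
  refine ⟨k, rfl, rfl, fun W hW => ?_⟩
  by_cases hxW : x ∈ W
  · refine .inr (Small.empty.mono fun z hz => hz.2 (component_subset hW.2 hxW hz.1))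
  · refine .inl (Small.empty.mono fun z hz => ?_)
    exact component_subset (U := Wᶜ) hW.compl.2 hxW hz.1 hz.2

/-- A cut of `C` missing `x` is almost contained in the complement of `k`, which misses `x`;
terminality then puts `k` in `C`. Conversely, if `c` is equivalent to `k` up to complement and `c ≤
c'` with `x ∉ c'`, then `c` cannot be equivalent to `k`, and otherwise the complement of `c'` is
almost contained in the atom `k`, hence equivalent to it. -/
theorem isTerminal_iff_of_component (hC : T.HasConvexCylinders) {k : Cut T v₀} {x : V}
    (hk : k.carrier = T.component k.cyl x) (hka : k.IsAtom) (hx : VertexMem x k.cyl)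
    {C : CCC (T.based v₀)} (hCk : (cccCyl C).1 = k.cyl) : IsTerminal x C ↔ C = k.ccc := by
  constructor
  · intro h
    obtain ⟨c, rfl, hc⟩ := exists_ccc_eq_not_mem C x
    rw [cccCyl_ccc hC] at hCk
    have hCk' : c.cyl = k.cyl := hCk
    refine (h.2 c k.compl rfl hCk'.symm ?_ ?_).symm.trans k.ccc_compl
    · rw [le_compl_iff_of_cyl_eq hCk', hk]
      refine Small.empty.mono fun z hz => ?_
      exact component_subset (U := c.carrierᶜ) (hCk' ▸ c.isCut.compl.2) hc hz.2 hz.1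
    · rw [carrier_compl, hk]
      exact fun h => h (mem_component_self x)
  · rintro rfl
    refine ⟨hCk ▸ hx, fun c c' hc hc' hle hxc => ?_⟩
    have hrel := (ccc_eq_iff hC).1 hc
    have hpair := hrel.2.resolve_right fun h => h.2.1 hka
    have hcyl : c'.cyl = k.cyl := hc'.trans hrel.1
    rcases pair_eq_iff.1 hpair with hs | hs
    · exfalso
      have h₁ := k.not_small
      have h₂ := (sim_iff.1 hs).2
      rw [le_iff] at h₂
      rw [le_iff_of_cyl_eq hrel.1] at hle
      refine h₁ ((h₂.union hle).mono fun z hz => ?_)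
      by_cases hzc : z ∈ c.carrier
      · refine Or.inr ⟨hzc, fun hzc' => ?_⟩
        rw [hk] at hz
        exact component_subset (U := c'.carrierᶜ) (hcyl ▸ c'.isCut.compl.2) hxc hz hzc'
      · exact Or.inl ⟨hz, hzc⟩
    · have h₁ : c'.compl.Le k := by
        have h₂ := compl_le_comm.1 (sim_iff.1 hs).2
        rw [le_iff_of_cyl_eq (c := c.compl) hrel.1] at h₂
        rw [le_iff_of_cyl_eq (c := c'.compl) hcyl]
        rw [le_iff_of_cyl_eq hrel.1] at hle
        refine (h₂.union hle).mono fun z hz => ?_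
        by_cases hzc : z ∈ c.carrier
        · exact Or.inr ⟨hzc, hz.1⟩
        · exact Or.inl ⟨hzc, hz.2⟩
      rw [← ccc_compl, ccc_eq_of_rel (rel_of_pair_eq (
          hka.sim_of_le (d := c'.compl) hcyl h₁).pair_eq)]

/-! ### Vertices of infinite valence in a cylinder -/

/-- The half-trees starting at `x` are pairwise disjoint, so only finitely many contain an end point
of a boundary edge of `U`. Any other one is on a single side of `U`, the side of `x`. -/
theorem finite_not_halfTree_subset {x : V} (hU : T.IsCut Y U) (hxU : x ∈ U) :
    {w | T.graph.Adj x w ∧ ¬ T.halfTree x w ⊆ U}.Finite := by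
  have : (⋃ e ∈ T.boundary U, ⋃ a ∈ {a | a ∈ e},
      {w | T.graph.Adj x w ∧ a ∈ T.halfTree x w}).Finite := by
    refine hU.1.biUnion fun e _ => Set.Finite.biUnion ?_ fun a _ => ?_
    · induction e with
      | h a b => exact (Set.toFinite {a, b}).subset fun x hx => by simpa using hx
    · refine Set.Subsingleton.finite fun w hw w' hw' => ?_
      by_contra hne
      exact Set.disjoint_left.1 (disjoint_halfTree hw'.1 hw.1 hne) hw.2 hw'.2
  refine this.subset ?_
  rintro w ⟨hw, hsub⟩
  simp only [Set.mem_iUnion]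
  by_contra! hc
  have hwU : w ∈ U := by
    by_contra hwU
    exact hc _ (mem_boundary_of hw hxU hwU) w (by simp) ⟨hw, mem_halfTree_self _ _⟩
  exact hsub (halfTree_subset hw hwU fun e he a ha ha' => hc e he a ha ⟨hw, ha'⟩)

theorem infinite_halfTree_subset {x : V} (hY : T.IsCylinder Y) (hinf : {e | e ∈ Y ∧ x ∈ e}.Infinite)
    (hU : T.IsCut Y U) (hxU : x ∈ U) :
    {w | T.graph.Adj x w ∧ s(x, w) ∈ Y ∧ T.halfTree x w ⊆ U}.Infinite := by
  intro hfin
  refine hinf (((hfin.union (finite_not_halfTree_subset hU hxU)).image fun w => s(x, w)).subset ?_)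
  rintro _ ⟨he, w, rfl⟩
  refine ⟨w, ?_, rfl⟩
  have hw : T.graph.Adj x w := hY.subset_edgeSet he
  by_cases h : T.halfTree x w ⊆ U
  · exact Or.inl ⟨hw, he, h⟩
  · exact Or.inr ⟨hw, h⟩

theorem not_isAtom_of_infinite (hT : T.IsMinimal) {c : Cut T v₀} {x : V}
    (hinf : {e | e ∈ c.cyl ∧ x ∈ e}.Infinite) (hx : x ∈ c.carrier) : ¬ c.IsAtom := by
  obtain ⟨w, ⟨hw, hwY, hws⟩, w', ⟨hw', -, hws'⟩, hne⟩ :=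
    (infinite_halfTree_subset c.isCylinder hinf c.isCut hx).nontrivial
  exact not_isAtom_of_disjoint (.halfTree hw hwY) (hT.not_small_halfTree c.isCylinder hw)
    (hT.not_small_halfTree c.isCylinder hw') (disjoint_halfTree hw' hw hne) hws hws'

/-- Infinitely many half-trees at `x` lie in the complement of `c`. Adding one of them to `c`
destroys being an atom, and the complement is not an atom since it still contains `x`. -/
theorem exists_isMid_ge (hT : T.IsMinimal) {c : Cut T v₀} {x : V}
    (hinf : {e | e ∈ c.cyl ∧ x ∈ e}.Infinite) (hx : x ∉ c.carrier) :
    ∃ c' : Cut T v₀, c'.cyl = c.cyl ∧ c'.IsMid ∧ c.Le c' ∧ x ∉ c'.carrier := by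
  obtain ⟨w, ⟨hw, hwY, hws⟩, w', ⟨hw', -, hws'⟩, hne⟩ :=
    (infinite_halfTree_subset c.isCylinder hinf c.isCut.compl hx).nontrivial
  have hd := disjoint_halfTree hw' hw hne
  have hcw : T.IsCut c.cyl (T.halfTree x w) := .halfTree hw hwY
  let c' : Cut T v₀ := ⟨c.cyl, c.isCylinder, c.carrier ∪ T.halfTree x w, c.isCut.union hcw,
    not_small_mono c.not_small Set.subset_union_left,
    not_small_mono (hT.not_small_halfTree c.isCylinder hw') fun z hz hz' =>
      hz'.elim (hws' hz) fun h => Set.disjoint_left.1 hd h hz⟩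
  have hx' : x ∉ c'.carrier := fun h => h.elim hx (not_mem_halfTree hw)
  refine ⟨c', rfl, ⟨?_, not_isAtom_of_infinite hT (c := c'.compl) hinf hx'⟩, ?_, hx'⟩
  · exact not_isAtom_of_disjoint (c := c') hcw (hT.not_small_halfTree c.isCylinder hw) c.not_small
      (Set.disjoint_left.2 hws) Set.subset_union_right Set.subset_union_left
  · exact le_iff.2 (Small.empty.mono fun z hz => hz.2 (Or.inl hz.1))

/-- A cut missing `x` can be enlarged to a cut in the middle still missing `x`, so a terminal
component consists of cuts in the middle. Conversely, a cut above one in the middle is not an atom,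
and its complement is not an atom if it contains `x`. -/
theorem isTerminal_iff_of_infinite (hT : T.IsMinimal) (hC : T.HasConvexCylinders) {x : V}
    (hx : VertexMem x Y) (hinf : {e | e ∈ Y ∧ x ∈ e}.Infinite)
    {C : CCC (T.based v₀)} (hCY : (cccCyl C).1 = Y) : IsTerminal x C ↔ C.1.Nontrivial := by
  constructor
  · intro h
    obtain ⟨c, rfl, hc⟩ := exists_ccc_eq_not_mem C x
    rw [cccCyl_ccc hC] at hCY
    have hCY' : c.cyl = Y := hCY
    obtain ⟨c', hcyl, hm, hle, hxc'⟩ := exists_isMid_ge hT (hCY'.symm ▸ hinf) hc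
    rw [← h.2 c c' rfl hcyl hle hxc']
    exact (nontrivial_ccc_iff hC).2 hm
  · intro h
    refine ⟨hCY ▸ hx, ?_⟩
    rintro c c' rfl hcyl hle hxc'
    rw [nontrivial_ccc_iff hC] at h
    rw [cccCyl_ccc hC] at hCY
    have hCY' : c.cyl = Y := hCY
    refine ccc_eq_of_rel ⟨hcyl, .inr ⟨⟨fun ha => h.1 (ha.of_le hcyl.symm hle), ?_⟩, h⟩⟩
    exact not_isAtom_of_infinite hT (c := c'.compl) (by rwa [cyl_compl, hcyl, hCY']) hxc'

theorem existsUnique_isTerminal (hT : T.IsMinimal) (hC : T.HasConvexCylinders) (v₀ : V)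
    (hY : T.IsCylinder Y) {x : V} (hx : VertexMem x Y) (hx' : T.InTwoCylinders x) :
    ∃! C : CCC (T.based v₀), (cccCyl C).1 = Y ∧ IsTerminal x C := by
  by_cases hfin : {e | e ∈ Y ∧ x ∈ e}.Finite
  · obtain ⟨k, rfl, hk, hka⟩ := exists_component_cut (v₀ := v₀) hT hC hY hx hx' hfin
    have hkc : (cccCyl k.ccc).1 = k.cyl := by rw [cccCyl_ccc hC]
    refine ⟨k.ccc, ⟨hkc, (isTerminal_iff_of_component hC hk hka hx hkc).2 rfl⟩, ?_⟩
    rintro C ⟨hCk, hCt⟩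
    exact (isTerminal_iff_of_component hC hk hka hx hCk).1 hCt
  · have hinf : {e | e ∈ Y ∧ x ∈ e}.Infinite := hfin
    obtain ⟨c, hcY, hm⟩ : ∃ c : Cut T v₀, c.cyl = Y ∧ c.IsMid := by
      obtain ⟨e, he, w, rfl⟩ := id hx
      have hw : T.graph.Adj x w := hY.subset_edgeSet he
      let c : Cut T v₀ := ⟨Y, hY, T.halfTree x w, .halfTree hw he, hT.not_small_halfTree hY hw, by
        rw [compl_halfTree hw]
        exact hT.not_small_halfTree hY hw.symm⟩
      obtain ⟨c', hcyl, hm, -⟩ := exists_isMid_ge hT (c := c) hinf (not_mem_halfTree hw)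
      exact ⟨c', hcyl, hm⟩
    have hcc : (cccCyl c.ccc).1 = Y := by rw [cccCyl_ccc hC]; exact hcY
    refine ⟨c.ccc, ⟨hcc, (isTerminal_iff_of_infinite hT hC hx hinf hcc).2
      ((nontrivial_ccc_iff hC).2 hm)⟩, ?_⟩
    rintro C ⟨hCY, hCt⟩
    have hCn := (isTerminal_iff_of_infinite hT hC hx hinf hCY).1 hCt
    exact IsMain.eq hC (.inl hCn) (.inl ((nontrivial_ccc_iff hC).2 hm))
      (Subtype.ext (hCY.trans hcc.symm))

end GTree

namespace GTree

variable {G V : Type*} [Group G] [MulAction G V] {T : GTree G V} {Y Y' : Set (Sym2 V)} {v₀ : V}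
  {U W : Set V}

open Cut

/-! ### Atoms come from vertices, unless the tree is a line -/

theorem IsCut.exists_dist_le (hU : T.IsCut Y U) (o : V) :
    ∃ R, ∀ e ∈ T.boundary U, ∀ a ∈ e, T.graph.dist o a ≤ R := by
  have hfin : (⋃ e ∈ T.boundary U, {a | a ∈ e}).Finite := by
    refine hU.1.biUnion fun e _ => ?_
    induction e with
    | h a b => exact (Set.toFinite {a, b}).subset fun x hx => by simpa using hx
  obtain ⟨R, hR⟩ := (hfin.image fun a => T.graph.dist o a).bddAbove
  exact ⟨R, fun e he a ha => hR ⟨a, Set.mem_biUnion he ha, rfl⟩⟩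

/-- Half-trees that start far away from the boundary of `U` are contained in `U`. -/
theorem halfTree_subset_of_dist {o z w : V} {R : ℕ}
    (hR : ∀ e ∈ T.boundary U, ∀ a ∈ e, T.graph.dist o a ≤ R) (hz : z ∈ U)
    (hd : R < T.graph.dist o z) (hw : T.graph.Adj z w) (ho : o ∉ T.halfTree z w) :
    T.halfTree z w ⊆ U := by
  refine halfTree_subset hw ?_ fun e he a ha ha' => ?_
  · exact (mem_iff_of_not_mem_boundary hw fun h => by
      have := hR _ h z (by simp)
      omega).1 hz
  · have h₁ := hR e he a ha
    have h₂ := dist_lt_of_mem_halfTree hw ho ha'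
    omega

/-- Bounded parts of `U` are finite: on the way to `o`, the next vertex is in `U` and closer to `o`,
or a boundary edge is crossed. If the orbit of `v₀` met `U` in a bounded set, `U` would be as small
as a finite union of small singletons. -/
theorem IsCut.exists_dist_lt (hU : T.IsCut Y U) (hs : ¬ T.Small v₀ Y U)
    (hfin : ∀ z ∈ U, {w | T.graph.Adj z w}.Finite) (hsm : ∀ z ∈ U, T.Small v₀ Y {z})
    (o : V) (n : ℕ) : ∃ g : G, g • v₀ ∈ U ∧ n < T.graph.dist o (g • v₀) := by
  have key : ∀ n, {z | z ∈ U ∧ T.graph.dist o z ≤ n}.Finite := by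
    intro n
    induction n with
    | zero =>
      refine (Set.finite_singleton o).subset ?_
      rintro z ⟨-, hz⟩
      exact (T.isTree.connected.dist_eq_zero_iff.1 (Nat.le_zero.1 hz)).symm
    | succ n ih =>
      have hend : (⋃ e ∈ T.boundary U, {a | a ∈ e}).Finite := by
        refine hU.1.biUnion fun e _ => ?_
        induction e with
        | h a b => exact (Set.toFinite {a, b}).subset fun x hx => by simpa using hx
      refine ((ih.union (ih.biUnion fun z hz => hfin z hz.1)).union hend).subset ?_
      rintro z ⟨hz, hd⟩
      obtain ⟨p, hp⟩ := (T.isTree.connected.preconnected z o).exists_walk_length_eq_dist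
      cases p with
      | nil => exact Or.inl (Or.inl ⟨hz, by simp⟩)
      | @cons _ z' _ hadj p =>
        rw [SimpleGraph.Walk.length_cons, SimpleGraph.dist_comm] at hp
        have h₁ := SimpleGraph.dist_le p
        rw [SimpleGraph.dist_comm] at h₁
        by_cases hz' : z' ∈ U
        · exact Or.inl (Or.inr (Set.mem_biUnion (x := z') ⟨hz', by omega⟩ hadj.symm))
        · exact Or.inr (Set.mem_biUnion (mem_boundary_of hadj hz hz') (by simp))
  by_contra! hc
  have hsmall : T.Small v₀ Y (⋃ z ∈ {z | z ∈ U ∧ T.graph.dist o z ≤ n}, {z}) :=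
    Small.biUnion (key n) fun z hz => hsm z hz.1
  exact hs fun e he => (hsmall e he).mono fun g hg =>
    Set.mem_biUnion (x := g • v₀) ⟨hg, hc g hg⟩ rfl

theorem IsMinimal.exists_adj_not_mem_halfTree (hT : T.IsMinimal) {z o : V} (hne : o ≠ z) :
    ∃ w, T.graph.Adj z w ∧ o ∉ T.halfTree z w := by
  obtain ⟨p⟩ := T.isTree.connected.preconnected z o
  cases p with
  | nil => exact absurd rfl hne
  | @cons _ z' _ hadj p =>
    obtain ⟨w, hw, hne'⟩ := hT.exists_adj_ne hadj.symm
    by_cases h : o ∈ T.halfTree z z'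
    · exact ⟨w, hw, fun h' => Set.disjoint_left.1 (disjoint_halfTree hadj hw hne') h' h⟩
    · exact ⟨z', hadj, h⟩

/-- Take an orbit point of `U` further from `v₀` than the whole boundary, and a half-tree starting
there that points away from `v₀`. -/
theorem IsMinimal.exists_halfTree_subset (hT : T.IsMinimal) (hU : T.IsCut Y U)
    (hs : ¬ T.Small v₀ Y U) (hfin : ∀ z ∈ U, {w | T.graph.Adj z w}.Finite)
    (hsm : ∀ z ∈ U, T.Small v₀ Y {z}) :
    ∃ z w, T.graph.Adj z w ∧ T.halfTree z w ⊆ U := by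
  obtain ⟨R, hR⟩ := hU.exists_dist_le v₀
  obtain ⟨g, hg, hd⟩ := hU.exists_dist_lt hs hfin hsm v₀ R
  obtain ⟨w, hw, ho⟩ := hT.exists_adj_not_mem_halfTree (z := g • v₀) (o := v₀) (by
    intro h
    rw [← h, SimpleGraph.dist_self] at hd
    omega)
  exact ⟨_, w, hw, halfTree_subset_of_dist hR hg hd hw ho⟩

theorem InTwoCylinders.smul {x : V} (h : T.InTwoCylinders x) (g : G) :
    T.InTwoCylinders (g • x) := by
  obtain ⟨Y, Y', hY, hY', hne, hx, hx'⟩ := h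
  exact ⟨g • Y, g • Y', hY.smul g, hY'.smul g, fun h => hne (smul_left_cancel g h),
    hx.smul g, hx'.smul g⟩

/-- In a line, there are no three disjoint half-trees. -/
theorem IsMinimal.not_three_halfTrees (hT : T.IsMinimal) (hY : T.IsCylinder Y)
    (hall : T.graph.edgeSet ⊆ Y) (hsm : ∀ z, T.Small v₀ Y {z})
    (hval : ∀ z a b c, T.graph.Adj z a → T.graph.Adj z b → T.graph.Adj z c → a = b ∨ b = c ∨ a = c)
    {a b : Fin 3 → V} (hab : ∀ i, T.graph.Adj (a i) (b i))
    (hd : ∀ i j, i ≠ j → Disjoint (T.halfTree (a i) (b i)) (T.halfTree (a j) (b j))) : False := by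
  let H : ∀ a b, T.graph.Adj a b → Cut T v₀ := fun a b h => ⟨Y, hY, T.halfTree a b,
    .halfTree h (hall h), hT.not_small_halfTree hY h, by
      rw [compl_halfTree h]
      exact hT.not_small_halfTree hY h.symm⟩
  have hflip : ∀ a b (h : T.graph.Adj a b), (H b a h.symm).pair = (H a b h).pair := by
    intro a b h
    rw [← (H a b h).pair_compl]
    congr 1
    simp only [H, Cut.compl, compl_halfTree h]
  -- Valence at most two means that passing from `ab` to `bc` removes only the small set `{b}`. By
  -- connectedness, all edges define the same pair.
  have hstep : ∀ a b c (h : T.graph.Adj a b) (h' : T.graph.Adj b c),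
      (H b c h').pair = (H a b h).pair := by
    intro a b c h h'
    by_cases hca : c = a
    · subst hca
      exact hflip _ _ h
    · refine Sim.pair_eq (sim_iff.2 ⟨le_iff.2 ?_, le_iff.2 ?_⟩)
      · exact Small.empty.mono fun z hz => hz.2 (halfTree_subset_halfTree h h' hca hz.1)
      · refine (hsm b).mono ?_
        change T.halfTree a b \ T.halfTree b c ⊆ {b}
        have key : T.boundary ((T.halfTree a b \ T.halfTree b c) \ {b}) = ∅ := by
          rw [Set.eq_empty_iff_forall_notMem]
          rintro _ ⟨x, y, hxy, ⟨⟨hx₁, hx₂⟩, hx₃⟩, hy, -⟩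
          have hxb : x ≠ b := hx₃
          by_cases hy₁ : y ∈ T.halfTree a b
          · by_cases hy₂ : y ∈ T.halfTree b c
            · exact hxb (eq_of_leaves_halfTree h' hxy.symm hy₂ hx₂).2
            · have hyb : y = b := by
                by_contra hyb
                exact hy ⟨⟨hy₁, hy₂⟩, hyb⟩
              subst hyb
              rcases hval y x a c hxy.symm h.symm h' with rfl | rfl | rfl
              · exact not_mem_halfTree h hx₁
              · exact hca rfl
              · exact hx₂ (mem_halfTree_self _ _)
          · exact hxb (eq_of_leaves_halfTree h hxy hx₁ hy₁).1
        exact Set.sdiff_eq_empty.1 (eq_empty_of_boundary_eq_empty key (a := b) fun h => h.2 rfl)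
  have hconn : ∀ (a b : V) (h : T.graph.Adj a b) (c : V), ∀ d (h' : T.graph.Adj c d),
      (H c d h').pair = (H a b h).pair := by
    intro a b h c
    obtain ⟨p⟩ := T.isTree.connected.preconnected c b
    induction p with
    | nil => exact fun d h' => hstep a _ d h h'
    | @cons c c' _ hadj p ih =>
      intro d h'
      rw [← ih h c hadj.symm]
      exact hstep c' c d hadj.symm h'
  let K : Fin 3 → Cut T v₀ := fun i => H (a i) (b i) (hab i)
  have hle : ∀ i j, i ≠ j → (K i).Le (K j).compl := fun i j hij =>
    le_iff.2 (Small.empty.mono fun z hz => hz.2 fun hz' =>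
      Set.disjoint_left.1 (hd i j hij) hz.1 hz')
  have hnle : ∀ i j, i ≠ j → ¬ (K i).Le (K j) := fun i j hij h => (K i).not_small
    ((le_iff.1 h).mono fun z hz => ⟨hz, fun hz' => Set.disjoint_left.1 (hd i j hij) hz hz'⟩)
  -- Two disjoint half-trees with the same pair must be complementary up to a small set, and this
  -- cannot hold for three disjoint ones.
  have hsim : ∀ i j, i ≠ j → (K j).compl.Le (K i) := by
    intro i j hij
    rcases pair_eq_iff.1 (hconn _ _ (hab j) (a i) (b i) (hab i)) with h | h
    · exact absurd (sim_iff.1 h).1 (hnle i j hij)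
    · exact (sim_iff.1 h).2
  have h₁ := hsim 0 1 (by decide)
  have h₂ := hle 2 1 (by decide)
  have s₁ : T.Small v₀ Y ((K 1).compl.carrier \ (K 0).carrier) := le_iff.1 h₁
  have s₂ : T.Small v₀ Y ((K 2).carrier \ (K 1).compl.carrier) := le_iff.1 h₂
  have s₃ : ¬ T.Small v₀ Y (K 2).carrier := (K 2).not_small
  refine s₃ ((s₁.union s₂).mono fun z hz => ?_)
  by_cases hz' : z ∈ (K 1).compl.carrier
  · exact Or.inl ⟨hz', fun h => Set.disjoint_left.1 (hd 0 2 (by decide)) h hz⟩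
  · exact Or.inr ⟨hz, hz'⟩

/-- An atom of a cylinder which contains no vertex of another cylinder is, together with its
complement, the only cut of the cylinder. -/
theorem Cut.IsAtom.pair_eq_of_forall_not [Group.FG G] (hT : T.IsMinimal) {c : Cut T v₀}
    (hc : c.IsAtom)
    (hno : ∀ x ∈ c.carrier, VertexMem x c.cyl → ¬ T.InTwoCylinders x) {d : Cut T v₀}
    (hd : d.cyl = c.cyl) : d.pair = c.pair := by
  obtain ⟨Y, hcY⟩ : ∃ Y, c.cyl = Y := ⟨_, rfl⟩
  have hY : T.IsCylinder Y := hcY ▸ c.isCylinder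
  have hcut : T.IsCut Y c.carrier := hcY ▸ c.isCut
  rw [hcY] at hno
  -- Were `z` not in the cylinder, its projection to `Y` would be a vertex of `c` with an edge
  -- outside `Y`, hence in two cylinders.
  have hmem : ∀ z ∈ c.carrier, VertexMem z Y := by
    intro z hz
    obtain ⟨x, hx, hzx⟩ := exists_vertexMem_reachable hY z
    have hxc := (mem_iff_of_reachable hcut.2 hzx).1 hz
    obtain ⟨p⟩ := hzx.symm
    cases p with
    | nil => exact hx
    | cons hadj p =>
      rw [SimpleGraph.deleteEdges_adj] at hadj
      exact absurd (inTwoCylinders_of_adj hY hx hadj.1 hadj.2) (hno x hxc hx)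
  have hedge : ∀ z, VertexMem z Y → ¬ T.InTwoCylinders z → ∀ w, T.graph.Adj z w → s(z, w) ∈ Y := by
    intro z hz hz' w hw
    by_contra h
    exact hz' (inTwoCylinders_of_adj hY hz hw h)
  have hedge' : ∀ z ∈ c.carrier, ∀ w, T.graph.Adj z w → s(z, w) ∈ Y := fun z hz =>
    hedge z (hmem z hz) (hno z hz (hmem z hz))
  have hfin : ∀ z ∈ c.carrier, {w | T.graph.Adj z w}.Finite := by
    intro z hz
    by_contra hinf
    refine not_isAtom_of_infinite hT (x := z) ?_ hz hc
    have hinj : Function.Injective fun w : V => s(z, w) := fun w w' h => Sym2.congr_right.1 h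
    refine (Set.Infinite.image (hinj.injOn) hinf).mono ?_
    rintro _ ⟨w, hw, rfl⟩
    exact ⟨hcY ▸ hedge' z hz w hw, by simp⟩
  have hsm : ∀ z ∈ c.carrier, T.Small v₀ Y {z} := fun z hz =>
    small_singleton hY (hmem z hz) (hfin z hz)
  -- Beyond distance `R`, half-trees that start in `c` and point away from `v₀` stay in `c`. Two of
  -- them at the same vertex would split the atom, so such vertices have at most one edge pointing
  -- away from `v₀`.
  obtain ⟨R, hR⟩ := hcut.exists_dist_le v₀
  have hval : ∀ z ∈ c.carrier, R < T.graph.dist v₀ z → ∀ w w', T.graph.Adj z w →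
      T.graph.Adj z w' → v₀ ∉ T.halfTree z w → v₀ ∉ T.halfTree z w' → w = w' := by
    intro z hz hzR w w' hw hw' ho ho'
    by_contra hne
    refine not_isAtom_of_disjoint (.halfTree hw (hcY ▸ hedge' z hz w hw))
      (hT.not_small_halfTree c.isCylinder hw) (hT.not_small_halfTree c.isCylinder hw')
      (disjoint_halfTree hw' hw hne) (halfTree_subset_of_dist hR hz hzR hw ho)
      (halfTree_subset_of_dist hR hz hzR hw' ho') hc
  obtain ⟨D, hD⟩ := hT.exists_dist_smul_le v₀
  -- The margin `D` keeps the ball of radius `D` around `g v₀` beyond the boundary, hence inside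
  -- `c`. This ball meets every orbit, so what was shown far out in `c` holds at all vertices of
  -- `T`.
  obtain ⟨g, hg, hgD⟩ := hcut.exists_dist_lt (hcY ▸ c.not_small) hfin hsm v₀ (R + D)
  have htrans : ∀ u, ∃ k : G, k • u ∈ c.carrier ∧ R < T.graph.dist v₀ (k • u) := by
    intro u
    obtain ⟨k, hk⟩ := hD u
    rw [← dist_smul g] at hk
    have hfar : ∀ x, T.graph.dist (g • v₀) x ≤ D → R < T.graph.dist v₀ x := by
      intro x hx
      have := T.dist_triangle v₀ x (g • v₀)
      rw [SimpleGraph.dist_comm (u := x)] at this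
      omega
    refine ⟨g * k, ?_, ?_⟩
    · rw [mul_smul]
      obtain ⟨p, hp⟩ :=
        (T.isTree.connected.preconnected (g • v₀) (g • k • u)).exists_walk_length_eq_dist
      refine (mem_iff_of_walk p fun e he he' => ?_).1 hg
      obtain ⟨a, ha⟩ := e.exists_mem
      have h₁ := hR e he' a ha
      have hap : a ∈ p.support := SimpleGraph.Walk.mem_support_of_mem_edges he ha
      classical
      have h₂ := SimpleGraph.dist_le (p.takeUntil a hap)
      have h₃ := p.length_takeUntil_le_length hap
      have := hfar a (by omega)
      omega
    · rw [mul_smul]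
      exact hfar _ hk
  have hno' : ∀ u, ¬ T.InTwoCylinders u := by
    intro u hu
    obtain ⟨k, hk, -⟩ := htrans u
    exact hno _ hk (hmem _ hk) (hu.smul k)
  have hfin' : ∀ u, {w | T.graph.Adj u w}.Finite := by
    intro u
    obtain ⟨k, hk, -⟩ := htrans u
    refine ((hfin _ hk).image fun w => k⁻¹ • w).subset fun w hw => ⟨k • w, ?_, by simp⟩
    exact T.smul_adj k u w hw
  have hval' : ∀ z a b c, T.graph.Adj z a → T.graph.Adj z b → T.graph.Adj z c →
      a = b ∨ b = c ∨ a = c := by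
    intro z a b c' ha hb hc'
    obtain ⟨k, hk, hkR⟩ := htrans z
    by_contra! hne
    have hinj := MulAction.injective (β := V) k
    have h₁ := hval _ hk hkR
    have ha := T.smul_adj k _ _ ha
    have hb := T.smul_adj k _ _ hb
    have hc' := T.smul_adj k _ _ hc'
    have hab : k • a ≠ k • b := fun h => hne.1 (hinj h)
    have hbc : k • b ≠ k • c' := fun h => hne.2.1 (hinj h)
    have hac : k • a ≠ k • c' := fun h => hne.2.2 (hinj h)
    have hdis : ∀ x y, T.graph.Adj (k • z) x → T.graph.Adj (k • z) y → x ≠ y →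
        v₀ ∈ T.halfTree (k • z) x → v₀ ∉ T.halfTree (k • z) y := fun x y hx hy hxy h h' =>
      Set.disjoint_left.1 (disjoint_halfTree hy hx hxy) h h'
    have d₁ := hdis _ _ ha hb hab
    have d₂ := hdis _ _ hb hc' hbc
    have d₃ := hdis _ _ ha hc' hac
    have e₁ := h₁ _ _ ha hb
    have e₂ := h₁ _ _ hb hc'
    have e₃ := h₁ _ _ ha hc'
    tauto
  have hvm : ∀ u, VertexMem u Y := by
    intro u
    obtain ⟨x, hx⟩ := hY.exists_vertexMem
    obtain ⟨p⟩ := T.isTree.connected.preconnected u x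
    induction p with
    | nil => exact hx
    | cons hadj p ih => exact ⟨_, Sym2.eq_swap ▸ hedge _ (ih hx) (hno' _) _ hadj.symm, by simp⟩
  have hall : T.graph.edgeSet ⊆ Y := by
    intro e
    induction e with
    | h a b => exact fun he => hedge a (hvm a) (hno' a) b he
  have hsm' : ∀ z, T.Small v₀ Y {z} := fun z => small_singleton hY (hvm z) (hfin' z)
  refine hc.pair_eq_of_compl ?_ hd
  by_contra hcc
  -- By now `T` has valence at most two and one cylinder. If the complement of `c` could be split,
  -- its two pieces and `c` would contain three disjoint half-trees.
  obtain ⟨U₁, U₂, hU₁, hU₂, hs₁, hs₂, hdisj, hsub₁, hsub₂⟩ := exists_split hcc hcY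
  obtain ⟨a₀, b₀, h₀, hH₀⟩ := hT.exists_halfTree_subset hcut (hcY ▸ c.not_small)
    (fun z _ => hfin' z) fun z _ => hsm' z
  obtain ⟨a₁, b₁, h₁, hH₁⟩ := hT.exists_halfTree_subset hU₁ hs₁ (fun z _ => hfin' z)
    fun z _ => hsm' z
  obtain ⟨a₂, b₂, h₂, hH₂⟩ := hT.exists_halfTree_subset hU₂ hs₂ (fun z _ => hfin' z)
    fun z _ => hsm' z
  have d₀₁ : Disjoint (T.halfTree a₀ b₀) (T.halfTree a₁ b₁) :=
    Set.disjoint_left.2 fun x hx hx' => hsub₁ (hH₁ hx') (hH₀ hx)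
  have d₀₂ : Disjoint (T.halfTree a₀ b₀) (T.halfTree a₂ b₂) :=
    Set.disjoint_left.2 fun x hx hx' => hsub₂ (hH₂ hx') (hH₀ hx)
  have d₁₂ : Disjoint (T.halfTree a₁ b₁) (T.halfTree a₂ b₂) := hdisj.mono hH₁ hH₂
  refine hT.not_three_halfTrees hY hall hsm' hval' (a := ![a₀, a₁, a₂]) (b := ![b₀, b₁, b₂]) ?_ ?_
  · intro i
    fin_cases i <;> assumption
  · intro i j hij
    fin_cases i <;> fin_cases j <;> first
      | exact absurd rfl hij | assumption | (apply Disjoint.symm; assumption)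

theorem exists_isAtom_of_not_isMain (hC : T.HasConvexCylinders) {C : CCC (T.based v₀)}
    (hCm : ¬ IsMain C) : ∃ c : Cut T v₀, c.ccc = C ∧ c.IsAtom := by
  obtain ⟨c₀, hc₀⟩ := exists_ccc_eq C
  have hmid : ¬ c₀.IsMid := fun h => hCm (.inl (hc₀ ▸ (nontrivial_ccc_iff hC).2 h))
  by_cases h : c₀.IsAtom
  · exact ⟨c₀, hc₀, h⟩
  · refine ⟨c₀.compl, by rw [ccc_compl, hc₀], ?_⟩
    by_contra h'
    exact hmid ⟨h, h'⟩

/-- A component which is not main is terminal at exactly one vertex. -/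
theorem existsUnique_isTerminal_of_not_isMain [Group.FG G] (hT : T.IsMinimal)
    (hC : T.HasConvexCylinders) {C : CCC (T.based v₀)} (hCm : ¬ IsMain C) :
    ∃! x, T.InTwoCylinders x ∧ IsTerminal x C := by
  obtain ⟨c, hc, hca⟩ := exists_isAtom_of_not_isMain hC hCm
  subst hc
  have hone : ¬ ∀ d : Cut T v₀, d.cyl = c.cyl → d.pair = c.pair := by
    intro h
    refine hCm (.inr fun C' hC' => ?_)
    obtain ⟨d, rfl⟩ := exists_ccc_eq C'
    rw [cccCyl_ccc hC, cccCyl_ccc hC] at hC'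
    exact ccc_eq_of_rel (rel_of_pair_eq (h d (congrArg Subtype.val hC')))
  have hcyl : (cccCyl c.ccc).1 = c.cyl := by rw [cccCyl_ccc hC]
  have hfinite : ∀ x, VertexMem x c.cyl → IsTerminal x c.ccc → {e | e ∈ c.cyl ∧ x ∈ e}.Finite := by
    intro x hx ht
    by_contra hinf
    exact hCm (.inl ((isTerminal_iff_of_infinite hT hC hx hinf hcyl).1 ht))
  obtain ⟨x, hxc, hx, hx2⟩ : ∃ x ∈ c.carrier, VertexMem x c.cyl ∧ T.InTwoCylinders x := by
    by_contra! h
    exact hone fun d hd => hca.pair_eq_of_forall_not hT h hd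
  have hfin : {e | e ∈ c.cyl ∧ x ∈ e}.Finite := by
    by_contra hinf
    exact not_isAtom_of_infinite hT hinf hxc hca
  obtain ⟨k, hkY, hk, hka⟩ := exists_component_cut (v₀ := v₀) hT hC c.isCylinder hx hx2 hfin
  have hkc : k.Sim c := hca.sim_of_le hkY (le_iff.2 (Small.empty.mono fun z hz => hz.2 (by
    have := hz.1
    rw [hk] at this
    exact component_subset c.isCut.2 hxc this)))
  have hkt : IsTerminal x c.ccc := (isTerminal_iff_of_component hC (k := k) (by rw [hk, hkY]) hka
    (hkY ▸ hx) (hcyl.trans hkY.symm)).2 (ccc_eq_of_rel (rel_of_pair_eq hkc.symm.pair_eq))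
  refine ⟨x, ⟨hx2, hkt⟩, ?_⟩
  rintro y ⟨hy2, hyt⟩
  by_contra hne
  have hy : VertexMem y c.cyl := hcyl ▸ hyt.1
  obtain ⟨l, hlY, hl, hla⟩ := exists_component_cut (v₀ := v₀) hT hC c.isCylinder hy hy2
    (hfinite y hy hyt)
  have hlc : c.ccc = l.ccc := (isTerminal_iff_of_component hC (k := l) (by rw [hl, hlY]) hla
    (hlY ▸ hy) (hcyl.trans hlY.symm)).1 hyt
  -- For a second vertex `y`, the atoms at `x` and `y` would be disjoint with the same pair, hence
  -- complementary up to small sets. A cylinder with two complementary atoms has a single component,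
  -- which is main.
  have hpair : l.pair = k.pair :=
    (((ccc_eq_iff hC).1 hlc).2.resolve_right fun h => h.1.1 hca).symm.trans hkc.pair_eq.symm
  have hdisj : l.carrier ∩ k.carrier = ∅ := by
    rw [Set.eq_empty_iff_forall_notMem]
    rintro z ⟨hz, hz'⟩
    rw [hl] at hz
    rw [hk] at hz'
    exact hne (hC.eq_of_reachable c.isCylinder hy hx (SimpleGraph.Reachable.trans hz
      (SimpleGraph.Reachable.symm hz')))
  rcases pair_eq_iff.1 hpair with h | h
  · refine l.not_small ((le_iff.1 (sim_iff.1 h).1).mono fun z hz => ⟨hz, fun hz' => ?_⟩)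
    exact Set.notMem_empty z (hdisj ▸ ⟨hz, hz'⟩)
  · refine hone fun d hd => ?_
    have hkca : k.compl.IsAtom := h.isAtom hla
    rw [hka.pair_eq_of_compl hkca (hd.trans hkY.symm), hkc.pair_eq]

end GTree

namespace GTree

variable {G V : Type*} [Group G] [MulAction G V] {T : GTree G V} {Y Y' : Set (Sym2 V)} {v₀ : V}
  {U W : Set V}

open Cut

/-! ### Pairs of components with nothing between them -/

/-- No cross-connected component is between `C` and `C'`. -/
def _root_.CCC.Close {𝒳 : SubMulAction G (AIClass G)} (C C' : CCC 𝒳) : Prop :=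
  ∀ C'' : CCC 𝒳, ¬ Between C.1 C''.1 C'.1

theorem close_symm (hC : T.HasConvexCylinders) {C C' : CCC (T.based v₀)} (h : C.Close C') :
    C'.Close C := fun C'' h' => h C'' (between_symm hC h')

theorem cyl_eq_cccCyl (hC : T.HasConvexCylinders) {c : Cut T v₀} {C : CCC (T.based v₀)}
    (h : c.ccc = C) : c.cyl = (cccCyl C).1 := by
  rw [← h, cccCyl_ccc hC]

/-- If neither component is main, both are given by atoms, and any main component has cuts in the
middle, one of which separates these atoms. Conversely, anything between two components of a
cylinder is in this cylinder and in the middle. -/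
theorem close_iff_of_cyl_eq (hC : T.HasConvexCylinders) {C C' : CCC (T.based v₀)} (hne : C ≠ C')
    (hcyl : cccCyl C = cccCyl C') : C.Close C' ↔
      IsMain C ∨ IsMain C' ∨ ∀ C'' : CCC (T.based v₀), cccCyl C'' = cccCyl C → ¬ IsMain C'' := by
  constructor
  · intro h
    by_contra! hm
    obtain ⟨hm₁, hm₂, C'', hcyl', hm⟩ := hm
    have hne₁ : C'' ≠ C := fun h => hm₁ (h ▸ hm)
    have hne₂ : C'' ≠ C' := fun h => hm₂ (h ▸ hm)
    have hnt := hm.resolve_right fun h => hne₁ (h C hcyl'.symm).symm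
    obtain ⟨n, rfl⟩ := exists_ccc_eq C''
    obtain ⟨c, rfl, hc⟩ := exists_isAtom_of_not_isMain hC hm₁
    obtain ⟨c', rfl, hc'⟩ := exists_isAtom_of_not_isMain hC hm₂
    rw [nontrivial_ccc_iff hC] at hnt
    rw [cccCyl_ccc hC, cccCyl_ccc hC] at hcyl hcyl'
    obtain ⟨m, hmc, hmm, h₁, h₂⟩ := hc.exists_isMid_between hc'
      (fun h => hne (ccc_eq_of_rel (rel_of_pair_eq h))) (congrArg Subtype.val hcyl) hnt
      (congrArg Subtype.val hcyl')
    have hmn : m.ccc = n.ccc :=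
      ccc_eq_of_rel ⟨hmc.trans (congrArg Subtype.val hcyl').symm, .inr ⟨hmm, hnt⟩⟩
    exact h n.ccc ((between_iff hC).2 ⟨⟨hne₁.symm, hne₂, hne⟩, c, m, c'.compl, rfl, hmn,
      ccc_compl c', h₁, h₂⟩)
  · rintro h C'' hb
    obtain ⟨⟨hne₁, hne₂, -⟩, c₁, c₂, c₃, rfl, rfl, rfl, h₁, h₂⟩ := (between_iff hC).1 hb
    rw [cccCyl_ccc hC, cccCyl_ccc hC] at hcyl
    have hcyl : c₁.cyl = c₃.cyl := congrArg Subtype.val hcyl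
    by_cases hcyl' : c₂.cyl = c₁.cyl
    · have hm : c₂.IsMid := by
        by_contra hm
        rcases sim_or_sim_of_le hm hcyl'.symm (hcyl.symm.trans hcyl'.symm) h₁ h₂ with hs | hs
        · exact hne₁ (ccc_eq_of_rel (rel_of_pair_eq hs.pair_eq))
        · exact hne₂ (ccc_eq_of_rel (rel_of_pair_eq hs.pair_eq)).symm
      have hm' : IsMain c₂.ccc := .inl ((nontrivial_ccc_iff hC).2 hm)
      have e₁ : cccCyl c₂.ccc = cccCyl c₁.ccc := by
        rw [cccCyl_ccc hC, cccCyl_ccc hC]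
        exact Subtype.ext hcyl'
      have e₃ : cccCyl c₂.ccc = cccCyl c₃.ccc := by
        rw [cccCyl_ccc hC, cccCyl_ccc hC]
        exact Subtype.ext (hcyl'.trans hcyl)
      rcases h with h | h | h
      · exact hne₁ (h.eq hC hm' e₁.symm)
      · exact hne₂ (hm'.eq hC h e₃)
      · exact h _ e₁ hm'
    -- For a cut `c₂` of another cylinder, `c₁ ≤ c₂` requires `z ∈ c₂` and `c₂ ≤ c₃` requires `z ∉
    -- c₂`.
    · obtain ⟨z, hz⟩ := c₁.isCylinder.exists_vertexMem
      obtain ⟨z', hz'⟩ := c₂.isCylinder.exists_vertexMem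
      exact ((le_iff_of_ne hC (fun h => hcyl' (h.trans hcyl.symm)) hz' (hcyl ▸ hz)).1 h₂).1
        ((le_iff_of_ne hC (Ne.symm hcyl') hz hz').1 h₁).2

/-- If the cylinders are disjoint, the first edge on the way from one to the other belongs to a
third cylinder, and the half-tree it bounds gives a component between the two. -/
theorem exists_vertexMem_of_close (hT : T.IsMinimal) (hC : T.HasConvexCylinders)
    {C C' : CCC (T.based v₀)} (hcyl : (cccCyl C).1 ≠ (cccCyl C').1) (h : C.Close C') :
    ∃ x, VertexMem x (cccCyl C).1 ∧ VertexMem x (cccCyl C').1 := by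
  by_contra! hno
  obtain ⟨y, hy⟩ := (cccCyl C').2.exists_vertexMem
  obtain ⟨x, hx, hyx⟩ := exists_vertexMem_reachable (cccCyl C).2 y
  obtain ⟨p, hp⟩ := hyx.symm.exists_isPath
  obtain ⟨z, hadj, p, rfl⟩ := SimpleGraph.Walk.exists_eq_cons_of_ne
    (fun h => hno x hx (h ▸ hy) : x ≠ y) p
  rw [SimpleGraph.deleteEdges_adj] at hadj
  obtain ⟨W, hW, hxz⟩ := IsCylinder.exists_mem_of_mem_edgeSet (T := T) (e := s(x, z)) hadj.1
  have hWx : VertexMem x W := ⟨_, hxz, by simp⟩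
  have hWC : (cccCyl C).1 ≠ W := fun h => hadj.2 (h ▸ hxz)
  have hWC' : W ≠ (cccCyl C').1 := fun h => hno x hx (h ▸ hWx)
  have hyz : y ∈ T.halfTree x z := by
    refine SimpleGraph.Reachable.mono ?_
      (p.toDeleteEdges {s(x, z)} fun e he he' => ?_).reachable
    · exact SimpleGraph.deleteEdges_mono (SimpleGraph.deleteEdges_le _)
    · rw [Set.mem_singleton_iff] at he'
      subst he'
      exact ((SimpleGraph.Walk.cons_isPath_iff _ _).1 hp).2
        (SimpleGraph.Walk.fst_mem_support_of_mem_edges p he)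
  let k : Cut T v₀ := ⟨W, hW, T.halfTree z x, .halfTree hadj.1.symm (Sym2.eq_swap ▸ hxz),
    hT.not_small_halfTree hW hadj.1.symm, by
      rw [compl_halfTree hadj.1.symm]
      exact hT.not_small_halfTree hW hadj.1⟩
  obtain ⟨c, hc, hxc⟩ := exists_ccc_eq_not_mem C x
  obtain ⟨c', hc', hxc'⟩ := exists_ccc_eq_mem C' x
  have hcY := cyl_eq_cccCyl hC hc
  have hcY' := cyl_eq_cccCyl hC hc'
  have hk := cyl_eq_cccCyl hC (rfl : k.ccc = k.ccc)
  refine h k.ccc ((between_iff hC).2 ⟨⟨?_, ?_, ?_⟩, c, k, c', hc, rfl, hc', ?_, ?_⟩)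
  · exact fun h => hWC (h ▸ hk.symm)
  · exact fun h => hWC' (h ▸ hk)
  · exact fun h => hcyl (h ▸ rfl)
  · exact (le_iff_of_ne hC (by rwa [hcY]) (hcY ▸ hx) hWx).2 ⟨hxc, mem_halfTree_self _ _⟩
  · refine (le_iff_of_ne hC (by rwa [hcY']) hWx (hcY' ▸ hy)).2 ⟨fun hy' => ?_, hxc'⟩
    have : y ∈ (T.halfTree x z)ᶜ := by rwa [compl_halfTree hadj.1]
    exact this hyz

/-- Choose `d` in `C'` with `x ∈ d`. A cut `c'` above `c` that misses `x` is almost contained in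
`d`, so its component would be between `C` and `C'` if it were not `C`. -/
theorem isTerminal_of_close (hC : T.HasConvexCylinders)
    {C C' : CCC (T.based v₀)} (hcyl : (cccCyl C).1 ≠ (cccCyl C').1) (h : C.Close C') {x : V}
    (hx : VertexMem x (cccCyl C).1) (hx' : VertexMem x (cccCyl C').1) : IsTerminal x C := by
  refine ⟨hx, fun c c' hc hcc' hle hxc => ?_⟩
  by_contra hne
  obtain ⟨d, hd, hxd⟩ := exists_ccc_eq_mem C' x
  have hcY := cyl_eq_cccCyl hC hc
  have hdY := cyl_eq_cccCyl hC hd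
  refine h c'.ccc ((between_iff hC).2 ⟨⟨Ne.symm hne, fun h' => hcyl ?_, fun h' => hcyl (h' ▸ rfl)⟩,
    c, c', d, hc, rfl, hd, hle, ?_⟩)
  · rw [← hcY, ← hcc', cyl_eq_cccCyl hC h']
  · refine (le_iff_of_ne hC ?_ ?_ ?_).2 ⟨hxc, hxd⟩
    · rwa [hcc', hcY, hdY]
    · rwa [hcc', hcY]
    · rwa [hdY]

/-- For the converse, a component between the two in the cylinder of `C` or `C'` is excluded by
terminality. In a third cylinder, its cut would have both to contain `x` and to miss it. -/
theorem close_iff_of_cyl_ne (hT : T.IsMinimal) (hC : T.HasConvexCylinders)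
    {C C' : CCC (T.based v₀)} (hcyl : (cccCyl C).1 ≠ (cccCyl C').1) :
    C.Close C' ↔ ∃ x, IsTerminal x C ∧ IsTerminal x C' := by
  constructor
  · intro h
    obtain ⟨x, hx, hx'⟩ := exists_vertexMem_of_close hT hC hcyl h
    exact ⟨x, isTerminal_of_close hC hcyl h hx hx',
      isTerminal_of_close hC hcyl.symm (close_symm hC h) hx' hx⟩
  · rintro ⟨x, hx, hx'⟩ C'' hb
    obtain ⟨⟨hne₁, hne₂, -⟩, c₁, c₂, c₃, rfl, rfl, rfl, h₁, h₂⟩ := (between_iff hC).1 hb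
    have hx₁ := hx.1
    have hx₃ := hx'.1
    rw [← cyl_eq_cccCyl hC rfl] at hcyl hx₁
    rw [← cyl_eq_cccCyl hC rfl] at hcyl hx₃
    by_cases hcyl₁ : c₂.cyl = c₁.cyl
    · have h := (le_iff_of_ne hC (by rwa [hcyl₁]) (hcyl₁ ▸ hx₁) hx₃).1 h₂
      exact hne₁ (hx.2 c₁ c₂ rfl hcyl₁ h₁ h.1).symm
    by_cases hcyl₃ : c₂.cyl = c₃.cyl
    · have h := (le_iff_of_ne hC (by rwa [hcyl₃]) hx₁ (hcyl₃ ▸ hx₃)).1 h₁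
      refine hne₂ ?_
      rw [← ccc_compl c₂]
      exact hx'.2 c₃.compl c₂.compl (ccc_compl _) hcyl₃ h₂.compl fun h' => h' h.2
    · obtain ⟨z, hz⟩ := c₂.isCylinder.exists_vertexMem
      exact ((le_iff_of_ne hC hcyl₃ hz hx₃).1 h₂).1
        ((le_iff_of_ne hC (Ne.symm hcyl₁) hx₁ hz).1 h₁).2

end GTree

/-! ### Regular neighbourhoods that are subdivisions of a bipartite graph -/

section RegularNeighbourhoodModel

variable {G A B : Type*} [Group G] [MulAction G A] [MulAction G B]
  {𝒳 : SubMulAction G (AIClass G)} {r : A → B → Prop}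

/-- A description of the pairs of cross-connected components of `𝒳` with nothing between them, in
terms of a bipartite graph: each component `C` lives over `cyl C ∈ B`, it can be main, and it can be
terminal at some elements of `A`. -/
structure RNModel (𝒳 : SubMulAction G (AIClass G)) (r : A → B → Prop) where
  cyl : CCC 𝒳 → B
  Main : CCC 𝒳 → Prop
  Term : A → CCC 𝒳 → Prop
  cyl_smul : ∀ (g : G) C, cyl (g • C) = g • cyl C
  main_smul : ∀ (g : G) C, Main C → Main (g • C)
  term_smul : ∀ (g : G) x C, Term x C → Term (g • x) (g • C)
  rel_of_term : ∀ x C, Term x C → r x (cyl C)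
  existsUnique_cyl : ∀ x Y, r x Y → ∃! C, cyl C = Y ∧ Term x C
  existsUnique_term : ∀ C, ¬ Main C → ∃! x, Term x C
  main_unique : ∀ C C', Main C → Main C' → cyl C = cyl C' → C = C'
  exists_main_or : ∀ Y, (∃ C, cyl C = Y ∧ Main C) ∨ ∃ C C', C ≠ C' ∧ cyl C = Y ∧ cyl C' = Y
  exists_rel_rel : ∀ x, ∃ Y Y', Y ≠ Y' ∧ r x Y ∧ r x Y'
  -- This condition and the next one are the only parts of the tree property of `bipartiteGraph r`
  -- that are needed: there are no cycles of length four or six.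
  eq_of_rel : ∀ x x' Y Y', Y ≠ Y' → r x Y → r x Y' → r x' Y → r x' Y' → x = x'
  eq_of_triangle : ∀ x x₁ x₂ Y Y₁ Y₂, Y₁ ≠ Y₂ → Y₁ ≠ Y → Y₂ ≠ Y → r x Y₁ → r x Y₂ →
    r x₁ Y₁ → r x₁ Y → r x₂ Y₂ → r x₂ Y → x = x₁
  close_iff_of_eq : ∀ C C', C ≠ C' → cyl C = cyl C' →
    (C.Close C' ↔ Main C ∨ Main C' ∨ ∀ C'', cyl C'' = cyl C → ¬ Main C'')
  close_iff_of_ne : ∀ C C', cyl C ≠ cyl C' → (C.Close C' ↔ ∃ x, Term x C ∧ Term x C')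

theorem CCC.Close.refl (C : CCC 𝒳) : C.Close C := fun _ h => h.1.2.2 rfl

/-! ### Stars as maximal sets of pairwise close components -/

namespace RNStar

/-- The cross-connected components of a star. -/
def toSet (S : RNStar 𝒳) : Set (CCC 𝒳) := {C | C.1 ∈ S.1}

theorem ext_toSet {S S' : RNStar 𝒳} (h : S.toSet = S'.toSet) : S = S' := by
  have key : ∀ S S' : RNStar 𝒳, S.toSet = S'.toSet → S.1 ⊆ S'.1 := fun S S' h C hC => by
    have : (⟨C, S.2.2.1.1 C hC⟩ : CCC 𝒳) ∈ S.toSet := hC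
    rw [h] at this
    exact this
  exact Subtype.ext ((key _ _ h).antisymm (key _ _ h.symm))

theorem close (S : RNStar 𝒳) {C C' : CCC 𝒳} (h : C ∈ S.toSet) (h' : C' ∈ S.toSet) : C.Close C' :=
  fun C'' => S.2.2.1.2 _ h _ h' _ C''.2

theorem toSet_nontrivial (S : RNStar 𝒳) : S.toSet.Nontrivial := by
  obtain ⟨C, hC, C', hC', hne⟩ := S.2.1
  exact ⟨⟨C, S.2.2.1.1 C hC⟩, hC, ⟨C', S.2.2.1.1 C' hC'⟩, hC',
    fun h => hne (congrArg Subtype.val h)⟩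

theorem mem_of_close (S : RNStar 𝒳) {D : CCC 𝒳}
    (h : ∀ C ∈ S.toSet, C.Close D ∧ D.Close C) : D ∈ S.toSet := by
  have hn : NoneBetween 𝒳 (insert D.1 S.1) := by
    refine ⟨?_, ?_⟩
    · rintro C (rfl | hC)
      · exact D.2
      · exact S.2.2.1.1 C hC
    · rintro C (rfl | hC) C' (rfl | hC') C'' hC''
      · exact CCC.Close.refl D ⟨C'', hC''⟩
      · exact (h ⟨C', S.2.2.1.1 C' hC'⟩ hC').2 ⟨C'', hC''⟩
      · exact (h ⟨C, S.2.2.1.1 C hC⟩ hC).1 ⟨C'', hC''⟩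
      · exact S.2.2.1.2 _ hC _ hC' _ hC''
  exact S.2.2.2 hn (Set.subset_insert _ _) (Set.mem_insert _ _)

/-- The star with given elements. -/
def ofSet (S : Set (CCC 𝒳)) (h₁ : S.Nontrivial) (h₂ : ∀ C ∈ S, ∀ C' ∈ S, C.Close C')
    (h₃ : ∀ D, (∀ C ∈ S, C.Close D) → D ∈ S) : RNStar 𝒳 :=
  ⟨Subtype.val '' S, h₁.image Subtype.val_injective, by
    refine ⟨⟨?_, ?_⟩, fun S' hS' hle C hC => ?_⟩
    · rintro _ ⟨C, -, rfl⟩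
      exact C.2
    · rintro _ ⟨C, hC, rfl⟩ _ ⟨C', hC', rfl⟩ C'' hC''
      exact h₂ C hC C' hC' ⟨C'', hC''⟩
    · refine ⟨⟨C, hS'.1 C hC⟩, h₃ _ fun D hD C'' => ?_, rfl⟩
      exact hS'.2 _ (hle ⟨D, hD, rfl⟩) _ hC _ C''.2⟩

theorem mem_toSet_ofSet {S : Set (CCC 𝒳)} (h₁ h₂ h₃) {C : CCC 𝒳} :
    C ∈ (ofSet S h₁ h₂ h₃).toSet ↔ C ∈ S :=
  ⟨fun ⟨D, hD, h⟩ => (show D = C from Subtype.ext h) ▸ hD, fun h => ⟨C, h, rfl⟩⟩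

theorem mem_toSet_smul {g : G} {S : RNStar 𝒳} {C : CCC 𝒳} :
    C ∈ (g • S).toSet ↔ g⁻¹ • C ∈ S.toSet := Set.mem_smul_set_iff_inv_smul_mem

end RNStar

/-! ### Classification of the stars in a model -/

namespace RNModel

variable (M : RNModel 𝒳 r) {x : A} {C C' C₁ C₂ D : CCC 𝒳} {Y : B}

theorem main_smul_iff (g : G) : M.Main (g • C) ↔ M.Main C :=
  ⟨fun h => by simpa using M.main_smul g⁻¹ _ h, M.main_smul g C⟩

theorem term_smul_iff (g : G) : M.Term x (g • C) ↔ M.Term (g⁻¹ • x) C :=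
  ⟨fun h => by simpa using M.term_smul g⁻¹ _ _ h, fun h => by simpa using M.term_smul g _ _ h⟩

theorem eq_of_term (h : M.Term x C) (h' : M.Term x C') (hcyl : M.cyl C = M.cyl C') : C = C' :=
  (M.existsUnique_cyl x _ (M.rel_of_term x C' h')).unique ⟨hcyl, h⟩ ⟨rfl, h'⟩

theorem close_of_term (h : M.Term x C) (h' : M.Term x C') : C.Close C' := by
  by_cases hcyl : M.cyl C = M.cyl C'
  · rw [M.eq_of_term h h' hcyl]
    exact .refl _
  · exact (M.close_iff_of_ne C C' hcyl).2 ⟨x, h, h'⟩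

theorem close_of_cyl_eq (hcyl : M.cyl C = M.cyl C')
    (h : M.Main C ∨ M.Main C' ∨ ∀ C'', M.cyl C'' = M.cyl C → ¬ M.Main C'') : C.Close C' := by
  by_cases hne : C = C'
  · rw [hne]
    exact .refl _
  · exact (M.close_iff_of_eq C C' hne hcyl).2 h

/-- Whenever `D` lives over a different element than `C₁` or `C₂`, it shares a terminal vertex with
that component. The absence of short cycles forces the vertices so obtained to be `x`. -/
theorem term_of_close (hcyl : M.cyl C₁ ≠ M.cyl C₂) (h₁ : M.Term x C₁) (h₂ : M.Term x C₂)
    (hD₁ : C₁.Close D) (hD₂ : C₂.Close D) : M.Term x D := by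
  have r₁ := M.rel_of_term _ _ h₁
  have r₂ := M.rel_of_term _ _ h₂
  have key : ∀ C, M.cyl C ≠ M.cyl D → C.Close D → ∃ x', r x' (M.cyl C) ∧ M.Term x' D := by
    intro C hC h
    obtain ⟨x', h, h'⟩ := (M.close_iff_of_ne C D hC).1 h
    exact ⟨x', M.rel_of_term _ _ h, h'⟩
  by_cases e₁ : M.cyl C₁ = M.cyl D
  · obtain ⟨x', h, h'⟩ := key C₂ (fun h => hcyl (e₁.trans h.symm)) hD₂
    rwa [M.eq_of_rel x x' _ _ hcyl r₁ r₂ (e₁ ▸ M.rel_of_term _ _ h') h]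
  · obtain ⟨x₁, h, h'⟩ := key C₁ e₁ hD₁
    have r₁' := M.rel_of_term _ _ h'
    by_cases e₂ : M.cyl C₂ = M.cyl D
    · rwa [M.eq_of_rel x x₁ _ _ hcyl r₁ r₂ h (e₂ ▸ r₁')]
    · obtain ⟨x₂, k, k'⟩ := key C₂ e₂ hD₂
      rwa [M.eq_of_triangle x x₁ x₂ _ _ _ hcyl e₁ e₂ r₁ r₂ h r₁' k (M.rel_of_term _ _ k')]

/-- There is a main component over `Y`. -/
def HasMain (Y : B) : Prop := ∃ C, M.cyl C = Y ∧ M.Main C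

/-- The component over `Y` which is terminal at `x`. -/
noncomputable def cc (ε : BipEdge r) : CCC 𝒳 := (M.existsUnique_cyl _ _ ε.2).choose

variable (ε : BipEdge r)

theorem cyl_cc : M.cyl (M.cc ε) = ε.1.2 := (M.existsUnique_cyl _ _ ε.2).choose_spec.1.1

theorem term_cc : M.Term ε.1.1 (M.cc ε) := (M.existsUnique_cyl _ _ ε.2).choose_spec.1.2

theorem cc_mk (h : M.Term x C) : M.cc ⟨(x, M.cyl C), M.rel_of_term x C h⟩ = C :=
  M.eq_of_term (M.term_cc _) h (M.cyl_cc _)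

variable {M} in
theorem HasMain.main_choose (h : M.HasMain Y) : M.Main h.choose := h.choose_spec.2

theorem HasMain.smul {M : RNModel 𝒳 r} (h : M.HasMain Y) (g : G) : M.HasMain (g • Y) := by
  obtain ⟨C, rfl, hC⟩ := h
  exact ⟨g • C, M.cyl_smul g C, M.main_smul g C hC⟩

theorem hasMain_smul_iff (g : G) : M.HasMain (g • Y) ↔ M.HasMain Y :=
  ⟨fun h => by simpa using h.smul g⁻¹, fun h => h.smul g⟩

/-- The star of the components which are terminal at `x`. -/
def vertexStar (x : A) : RNStar 𝒳 := .ofSet {C | M.Term x C} (by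
    obtain ⟨Y, Y', hne, h, h'⟩ := M.exists_rel_rel x
    refine ⟨_, M.term_cc ⟨(x, Y), h⟩, _, M.term_cc ⟨(x, Y'), h'⟩, fun he => hne ?_⟩
    have := congrArg M.cyl he
    rwa [cyl_cc, cyl_cc] at this)
  (fun _ h _ h' => M.close_of_term h h') fun D hD => by
    obtain ⟨Y, Y', hne, h, h'⟩ := M.exists_rel_rel x
    have t := M.term_cc ⟨(x, Y), h⟩
    have t' := M.term_cc ⟨(x, Y'), h'⟩
    refine M.term_of_close ?_ t t' (hD _ t) (hD _ t')
    rwa [cyl_cc, cyl_cc]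

theorem mem_vertexStar : C ∈ (M.vertexStar x).toSet ↔ M.Term x C :=
  RNStar.mem_toSet_ofSet _ _ _

/-- Otherwise `D` shares a terminal vertex with each of `C` and `C'`. Both vertices are incident to
the same two elements, so they coincide, and only one component over `M.cyl C` is terminal there. -/
theorem cyl_eq_of_close (hne : C ≠ C') (hcyl : M.cyl C = M.cyl C')
    (h : C.Close D) (h' : C'.Close D) : M.cyl D = M.cyl C := by
  by_contra hD
  obtain ⟨x, hx, hxD⟩ := (M.close_iff_of_ne C D (Ne.symm hD)).1 h
  obtain ⟨x', hx', hxD'⟩ := (M.close_iff_of_ne C' D (hcyl ▸ Ne.symm hD)).1 h'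
  have r₁ := M.rel_of_term _ _ hx
  have r₂ := M.rel_of_term _ _ hx'
  have := M.eq_of_rel x x' _ _ hD (M.rel_of_term _ _ hxD) r₁ (M.rel_of_term _ _ hxD')
    (hcyl ▸ r₂)
  exact hne (M.eq_of_term hx (this ▸ hx') hcyl)

theorem close_of_not_hasMain (hY : ¬ M.HasMain Y) (h : M.cyl C = Y) (h' : M.cyl C' = Y) :
    C.Close C' :=
  M.close_of_cyl_eq (h.trans h'.symm) (.inr (.inr fun _ h'' hm => hY ⟨_, h''.trans h, hm⟩))

/-- The star of all the components over `Y`, when none of them is main. -/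
def cylinderStar (Y : B) (hY : ¬ M.HasMain Y) : RNStar 𝒳 :=
  .ofSet {C | M.cyl C = Y} (by
    obtain ⟨C, C', hne, h, h'⟩ := (M.exists_main_or Y).resolve_left hY
    exact ⟨C, h, C', h', hne⟩)
  (fun _ h _ h' => M.close_of_not_hasMain hY h h') fun D hD => by
    obtain ⟨C, C', hne, h, h'⟩ := (M.exists_main_or Y).resolve_left hY
    exact (M.cyl_eq_of_close hne (h.trans h'.symm) (hD C h) (hD C' h')).trans h

theorem mem_cylinderStar {hY : ¬ M.HasMain Y} :
    C ∈ (M.cylinderStar Y hY).toSet ↔ M.cyl C = Y :=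
  RNStar.mem_toSet_ofSet _ _ _

theorem eq_or_eq_of_close (hC : ¬ M.Main C) (hC' : M.Main C') (hcyl : M.cyl C = M.cyl C')
    (h : C.Close D) (h' : C'.Close D) : D = C ∨ D = C' := by
  by_contra! hD
  have hne : C ≠ C' := fun h => hC (h ▸ hC')
  have hDC := M.cyl_eq_of_close hne hcyl h h'
  rcases (M.close_iff_of_eq C D hD.1.symm hDC.symm).1 h with h | h | h
  · exact hC h
  · exact hD.2 (M.main_unique _ _ h hC' (hDC.trans hcyl))
  · exact h C' hcyl.symm hC'

/-- The star which consists of a component and a main component over the same element. -/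
def pairStar (C C' : CCC 𝒳) (hC : ¬ M.Main C) (hC' : M.Main C') (hcyl : M.cyl C = M.cyl C') :
    RNStar 𝒳 :=
  .ofSet {C, C'} (Set.nontrivial_pair fun h => hC (h ▸ hC'))
  (by
    rintro _ (rfl | rfl) _ (rfl | rfl)
    · exact .refl _
    · exact M.close_of_cyl_eq hcyl (.inr (.inl hC'))
    · exact M.close_of_cyl_eq hcyl.symm (.inl hC')
    · exact .refl _) fun _ hD =>
    M.eq_or_eq_of_close hC hC' hcyl (hD _ (.inl rfl)) (hD _ (.inr rfl))

theorem mem_pairStar {hC : ¬ M.Main C} {hC' : M.Main C'} {hcyl : M.cyl C = M.cyl C'} :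
    D ∈ (M.pairStar C C' hC hC' hcyl).toSet ↔ D = C ∨ D = C' :=
  RNStar.mem_toSet_ofSet _ _ _

/-- Two elements of the star over distinct cylinders share a terminal vertex, which is then common
to all. Otherwise the star lives over one cylinder: by maximality it contains the main component,
with room for just one other, or else all components if none is main. -/
theorem star_cases (S : RNStar 𝒳) : (∃ x, S = M.vertexStar x) ∨
    (∃ Y hY, S = M.cylinderStar Y hY) ∨ ∃ C C' hC hC' hcyl, S = M.pairStar C C' hC hC' hcyl := by
  by_cases h : ∃ C ∈ S.toSet, ∃ C' ∈ S.toSet, M.cyl C ≠ M.cyl C'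
  · obtain ⟨C, hC, C', hC', hne⟩ := h
    obtain ⟨x, hx, hx'⟩ := (M.close_iff_of_ne C C' hne).1 (S.close hC hC')
    have key : ∀ D ∈ S.toSet, M.Term x D := fun D hD =>
      M.term_of_close hne hx hx' (S.close hC hD) (S.close hC' hD)
    refine .inl ⟨x, RNStar.ext_toSet (Set.ext fun D => ?_)⟩
    rw [mem_vertexStar]
    exact ⟨key D, fun hD => S.mem_of_close fun E hE =>
      ⟨M.close_of_term (key E hE) hD, M.close_of_term hD (key E hE)⟩⟩
  · push Not at h
    obtain ⟨C, hC, C', hC', hne⟩ := S.toSet_nontrivial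
    refine .inr ?_
    by_cases hm : M.HasMain (M.cyl C)
    · refine .inr ?_
      obtain ⟨E, hEC, hE⟩ := hm
      have hES : E ∈ S.toSet := S.mem_of_close fun D hD =>
        ⟨M.close_of_cyl_eq ((h D hD C hC).trans hEC.symm) (.inr (.inl hE)),
          M.close_of_cyl_eq (hEC.trans (h C hC D hD)) (.inl hE)⟩
      obtain ⟨D, hD, hDE⟩ : ∃ D ∈ S.toSet, D ≠ E := by
        by_cases h : C = E
        · exact ⟨C', hC', fun h' => hne (h.trans h'.symm)⟩
        · exact ⟨C, hC, h⟩
      have hcyl := h D hD E hES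
      have hDm : ¬ M.Main D := fun h => hDE (M.main_unique _ _ h hE hcyl)
      refine ⟨D, E, hDm, hE, hcyl, RNStar.ext_toSet (Set.ext fun F => ?_)⟩
      rw [mem_pairStar]
      refine ⟨fun hF => M.eq_or_eq_of_close hDm hE hcyl (S.close hD hF) (S.close hES hF), ?_⟩
      rintro (rfl | rfl)
      · exact hD
      · exact hES
    · refine .inl ⟨_, hm, RNStar.ext_toSet (Set.ext fun D => ?_)⟩
      rw [mem_cylinderStar]
      exact ⟨fun hD => h D hD C hC, fun hD => S.mem_of_close fun E hE =>
        ⟨M.close_of_not_hasMain hm (h E hE C hC) hD, M.close_of_not_hasMain hm hD (h E hE C hC)⟩⟩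

theorem exists_cc_eq (h : M.Term x C) : ∃ ε : BipEdge r, ε.1.1 = x ∧ M.cc ε = C :=
  ⟨⟨(x, M.cyl C), M.rel_of_term x C h⟩, rfl, M.cc_mk h⟩

theorem vertexStar_injective : Function.Injective M.vertexStar := by
  intro x x' h
  obtain ⟨Y, Y', hne, hY, hY'⟩ := M.exists_rel_rel x
  have key : ∀ Y, r x Y → r x' Y := fun Y hY => by
    have h₁ := M.mem_vertexStar.2 (M.term_cc ⟨(x, Y), hY⟩)
    rw [h, mem_vertexStar] at h₁
    simpa only [cyl_cc] using M.rel_of_term _ _ h₁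
  exact M.eq_of_rel x x' Y Y' hne hY hY' (key Y hY) (key Y' hY')

theorem exists_mem_vertexStar (x : A) :
    ∃ C ∈ (M.vertexStar x).toSet, ∃ C' ∈ (M.vertexStar x).toSet, M.cyl C ≠ M.cyl C' := by
  obtain ⟨Y, Y', hne, hY, hY'⟩ := M.exists_rel_rel x
  refine ⟨_, M.mem_vertexStar.2 (M.term_cc ⟨(x, Y), hY⟩), _,
    M.mem_vertexStar.2 (M.term_cc ⟨(x, Y'), hY'⟩), ?_⟩
  rwa [cyl_cc, cyl_cc]

theorem vertexStar_ne_cylinderStar {hY : ¬ M.HasMain Y} :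
    M.vertexStar x ≠ M.cylinderStar Y hY := by
  intro h
  obtain ⟨C, hC, C', hC', hne⟩ := M.exists_mem_vertexStar x
  rw [h, mem_cylinderStar] at hC hC'
  exact hne (hC.trans hC'.symm)

theorem vertexStar_ne_pairStar {hC : ¬ M.Main C} {hC' : M.Main C'} {hcyl : M.cyl C = M.cyl C'} :
    M.vertexStar x ≠ M.pairStar C C' hC hC' hcyl := by
  intro h
  obtain ⟨D, hD, D', hD', hne⟩ := M.exists_mem_vertexStar x
  rw [h, mem_pairStar] at hD hD'
  have key : ∀ D, D = C ∨ D = C' → M.cyl D = M.cyl C := by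
    rintro D (rfl | rfl)
    exacts [rfl, hcyl.symm]
  exact hne ((key D hD).trans (key D' hD').symm)

theorem cylinderStar_ne_pairStar {hY : ¬ M.HasMain Y} {hC : ¬ M.Main C} {hC' : M.Main C'}
    {hcyl : M.cyl C = M.cyl C'} : M.cylinderStar Y hY ≠ M.pairStar C C' hC hC' hcyl := by
  intro h
  have h₁ : C' ∈ (M.pairStar C C' hC hC' hcyl).toSet := M.mem_pairStar.2 (.inr rfl)
  rw [← h, mem_cylinderStar] at h₁
  exact hY ⟨C', h₁, hC'⟩

theorem cylinderStar_injective {Y' : B} {hY : ¬ M.HasMain Y} {hY' : ¬ M.HasMain Y'}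
    (h : M.cylinderStar Y hY = M.cylinderStar Y' hY') : Y = Y' := by
  obtain ⟨C, hC⟩ := (M.cylinderStar Y hY).toSet_nontrivial.nonempty
  have hC' := hC
  rw [h] at hC'
  exact (M.mem_cylinderStar.1 hC).symm.trans (M.mem_cylinderStar.1 hC')

theorem cc_injective {ε ε' : BipEdge r} (hm : ¬ M.Main (M.cc ε)) (h : M.cc ε = M.cc ε') :
    ε = ε' := by
  have h₁ := (M.existsUnique_term _ hm).unique (M.term_cc ε) (h ▸ M.term_cc ε')
  have h₂ := (M.cyl_cc ε).symm.trans (h ▸ M.cyl_cc ε')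
  exact Subtype.ext (Prod.ext h₁ h₂)

theorem pairStar_injective {D D' : CCC 𝒳} {hC : ¬ M.Main C} {hC' : M.Main C'}
    {hcyl : M.cyl C = M.cyl C'} {hD : ¬ M.Main D} {hD' : M.Main D'} {hcyl' : M.cyl D = M.cyl D'}
    (h : M.pairStar C C' hC hC' hcyl = M.pairStar D D' hD hD' hcyl') : C = D := by
  have h₁ : C ∈ (M.pairStar C C' hC hC' hcyl).toSet := M.mem_pairStar.2 (.inl rfl)
  rw [h, mem_pairStar] at h₁
  exact h₁.resolve_right fun h => hC (h ▸ hD')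

end RNModel

end RegularNeighbourhoodModel

section RegularNeighbourhoodModel

variable {G A B : Type*} [Group G] [MulAction G A] [MulAction G B]
  {𝒳 : SubMulAction G (AIClass G)} {r : A → B → Prop} [InvariantRel G r]

namespace SubdivisionData

variable (D : SubdivisionData G r) {ε : BipEdge r} {k : ℕ}

theorem point_of_lt (h : k < D.num ε) : D.point ε (k + 1) = .inr ⟨(ε, k), h⟩ := dif_pos h

theorem point_of_not_lt (h : ¬ k < D.num ε) : D.point ε (k + 1) = .inl (.inr ε.1.2) := dif_neg h

theorem point_adj (hk : k ≤ D.num ε) : D.graph.Adj (D.point ε k) (D.point ε (k + 1)) := by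
  refine (SimpleGraph.fromRel_adj _ _ _).2 ⟨?_, .inl ⟨ε, k, hk, rfl, rfl⟩⟩
  rcases k with - | k
  · by_cases h : 0 < D.num ε
    · rw [D.point_of_lt h]
      exact Sum.inl_ne_inr
    · rw [D.point_of_not_lt h]
      exact fun h => Sum.inl_ne_inr (Sum.inl_injective h)
  · rw [D.point_of_lt hk]
    by_cases h : k + 1 < D.num ε
    · rw [D.point_of_lt h]
      intro h'
      have := congrArg Prod.snd (congrArg Subtype.val (Sum.inr_injective h'))
      exact k.succ_ne_self this.symm
    · rw [D.point_of_not_lt h]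
      exact Sum.inr_ne_inl

end SubdivisionData

/-! ### The subdivision and its isomorphism with the regular neighbourhood -/

namespace RNModel

variable (M : RNModel 𝒳 r) {x : A} {C C' C₁ C₂ D : CCC 𝒳} {Y : B} (ε : BipEdge r)

theorem smul_cc (g : G) : g • M.cc ε = M.cc (g • ε) := by
  refine M.eq_of_term (x := g • ε.1.1) (M.term_smul g _ _ (M.term_cc ε)) (M.term_cc (g • ε)) ?_
  rw [M.cyl_smul, cyl_cc, cyl_cc]
  rfl

open Classical in
/-- The subdivision of `bipartiteGraph r` which models the regular neighbourhood. -/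
noncomputable def subdivisionData : SubdivisionData G r where
  -- If the component terminal at the end `x` of `ε = (x, Y)` is main, it represents `Y` and belongs
  -- to the star of `x`. If `Y` has another main component, the terminal component and its pair star
  -- are inserted. If `Y` has none, `Y` becomes a star and only the terminal component is inserted.
  num ε := if M.HasMain ε.1.2 then if M.Main (M.cc ε) then 0 else 2 else 1
  num_smul g ε := by
    have h : M.HasMain (g • ε).1.2 ↔ M.HasMain ε.1.2 := M.hasMain_smul_iff g
    rw [← smul_cc, if_congr h (if_congr (M.main_smul_iff g) rfl rfl) rfl]

variable {ε}

theorem num_of_main (h : M.Main (M.cc ε)) : M.subdivisionData.num ε = 0 := by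
  exact (if_pos ⟨_, M.cyl_cc ε, h⟩).trans (if_pos h)

theorem num_of_hasMain (h : M.HasMain ε.1.2) (h' : ¬ M.Main (M.cc ε)) :
    M.subdivisionData.num ε = 2 := by
  exact (if_pos h).trans (if_neg h')

theorem num_of_not_hasMain (h : ¬ M.HasMain ε.1.2) : M.subdivisionData.num ε = 1 := by
  exact if_neg h

theorem not_main_of_lt {k : ℕ} (hk : k < M.subdivisionData.num ε) : ¬ M.Main (M.cc ε) := by
  intro h
  rw [M.num_of_main h] at hk
  omega

theorem hasMain_of_lt {k : ℕ} (hk : k < M.subdivisionData.num ε) (h0 : k ≠ 0) :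
    M.HasMain ε.1.2 := by
  by_contra h
  rw [M.num_of_not_hasMain h] at hk
  omega

open Classical in
/-- The bijection from the vertices of the subdivision to those of the regular neighbourhood. -/
noncomputable def toRN : M.subdivisionData.Vertex → CCC 𝒳 ⊕ RNStar 𝒳
  | .inl (.inl x) => .inr (M.vertexStar x)
  | .inl (.inr Y) => if h : M.HasMain Y then .inl h.choose else .inr (M.cylinderStar Y h)
  | .inr ⟨(ε, 0), _⟩ => .inl (M.cc ε)
  | .inr ⟨(_, k + 1), hk⟩ =>
    have hm := M.hasMain_of_lt hk k.succ_ne_zero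
    .inr (M.pairStar (M.cc _) hm.choose (M.not_main_of_lt hk) hm.main_choose
      ((M.cyl_cc _).trans hm.choose_spec.1.symm))

theorem toRN_vertex (x : A) : M.toRN (.inl (.inl x)) = .inr (M.vertexStar x) := rfl

theorem toRN_of_main (h : M.Main C) : M.toRN (.inl (.inr (M.cyl C))) = .inl C := by
  have hm : M.HasMain (M.cyl C) := ⟨C, rfl, h⟩
  exact (dif_pos hm).trans
    (congrArg Sum.inl (M.main_unique _ _ hm.main_choose h hm.choose_spec.1))

theorem toRN_of_not_hasMain (h : ¬ M.HasMain Y) :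
    M.toRN (.inl (.inr Y)) = .inr (M.cylinderStar Y h) := by
  exact dif_neg h

theorem toRN_zero (h : 0 < M.subdivisionData.num ε) :
    M.toRN (.inr ⟨(ε, 0), h⟩) = .inl (M.cc ε) := rfl

theorem toRN_one (h : 1 < M.subdivisionData.num ε) (hC : ¬ M.Main (M.cc ε)) (hC' : M.Main C')
    (hcyl : M.cyl (M.cc ε) = M.cyl C') :
    M.toRN (.inr ⟨(ε, 1), h⟩) = .inr (M.pairStar (M.cc ε) C' hC hC' hcyl) := by
  have hm := M.hasMain_of_lt h one_ne_zero
  obtain rfl : hm.choose = C' := M.main_unique _ _ hm.main_choose hC'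
    (hm.choose_spec.1.trans (M.cyl_cc ε ▸ hcyl))
  rfl

/-- A case distinction for the vertices of the subdivision. -/
theorem vertex_cases (p : M.subdivisionData.Vertex) :
    (∃ x, p = .inl (.inl x) ∧ M.toRN p = .inr (M.vertexStar x)) ∨
    (∃ C, M.Main C ∧ p = .inl (.inr (M.cyl C)) ∧ M.toRN p = .inl C) ∨
    (∃ Y h, p = .inl (.inr Y) ∧ M.toRN p = .inr (M.cylinderStar Y h)) ∨
    (∃ ε h, ¬ M.Main (M.cc ε) ∧ p = .inr ⟨(ε, 0), h⟩ ∧ M.toRN p = .inl (M.cc ε)) ∨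
    ∃ ε h C' hC hC' hcyl, p = .inr ⟨(ε, 1), h⟩ ∧
      M.toRN p = .inr (M.pairStar (M.cc ε) C' hC hC' hcyl) := by
  rcases p with (x | Y) | ⟨⟨ε, k⟩, hk⟩
  · exact .inl ⟨x, rfl, rfl⟩
  · by_cases h : M.HasMain Y
    · obtain ⟨C, rfl, hC⟩ := h
      exact .inr (.inl ⟨C, hC, rfl, M.toRN_of_main hC⟩)
    · exact .inr (.inr (.inl ⟨Y, h, rfl, M.toRN_of_not_hasMain h⟩))
  · have hm := M.not_main_of_lt hk
    refine .inr (.inr (.inr ?_))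
    by_cases h0 : k = 0
    · subst h0
      exact .inl ⟨ε, hk, hm, rfl, M.toRN_zero hk⟩
    · obtain ⟨C', hC', hC'm⟩ := M.hasMain_of_lt hk h0
      have h2 := M.num_of_hasMain ⟨C', hC', hC'm⟩ hm
      have hk' : k < M.subdivisionData.num ε := hk
      obtain rfl : k = 1 := by omega
      have hcyl := (M.cyl_cc ε).trans hC'.symm
      exact .inr ⟨ε, hk, C', hm, hC'm, hcyl, rfl, M.toRN_one hk hm hC'm hcyl⟩

theorem num_pos (hm : ¬ M.Main (M.cc ε)) : 0 < M.subdivisionData.num ε := by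
  by_cases h : M.HasMain ε.1.2
  · rw [M.num_of_hasMain h hm]
    omega
  · rw [M.num_of_not_hasMain h]
    omega

theorem toRN_point_adj {k : ℕ} (hk : k ≤ M.subdivisionData.num ε) :
    (regularNeighbourhood 𝒳).Adj (M.toRN (M.subdivisionData.point ε k))
      (M.toRN (M.subdivisionData.point ε (k + 1))) := by
  by_cases hm : M.Main (M.cc ε)
  · have h0 := M.num_of_main hm
    obtain rfl : k = 0 := by omega
    rw [M.subdivisionData.point_of_not_lt (by omega), ← M.cyl_cc, M.toRN_of_main hm]
    exact M.mem_vertexStar.2 (M.term_cc ε)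
  have hpos := M.num_pos hm
  by_cases h0 : k = 0
  · subst h0
    rw [M.subdivisionData.point_of_lt hpos, toRN_zero]
    exact M.mem_vertexStar.2 (M.term_cc ε)
  have e₁ : M.subdivisionData.point ε 1 = _ := M.subdivisionData.point_of_lt hpos
  by_cases h : M.HasMain ε.1.2
  · obtain ⟨C', hC', hC'm⟩ := h
    have hcyl := (M.cyl_cc ε).trans hC'.symm
    have h2 := M.num_of_hasMain ⟨C', hC', hC'm⟩ hm
    have hlt : 1 < M.subdivisionData.num ε := by omega
    by_cases h1 : k = 1
    · subst h1
      rw [e₁, M.subdivisionData.point_of_lt hlt, toRN_zero, M.toRN_one _ hm hC'm hcyl]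
      exact M.mem_pairStar (hC := hm) (hC' := hC'm) (hcyl := hcyl).2 (.inl rfl)
    · obtain rfl : k = 1 + 1 := by omega
      rw [M.subdivisionData.point_of_not_lt (k := 1 + 1) (by omega),
        M.subdivisionData.point_of_lt hlt, ← hC', M.toRN_of_main hC'm, M.toRN_one _ hm hC'm hcyl]
      exact M.mem_pairStar (hC := hm) (hC' := hC'm) (hcyl := hcyl).2 (.inr rfl)
  · have h1 := M.num_of_not_hasMain h
    obtain rfl : k = 1 := by omega
    rw [M.subdivisionData.point_of_not_lt (k := 1) (by omega), e₁, toRN_zero,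
      M.toRN_of_not_hasMain h]
    exact M.mem_cylinderStar (hY := h).2 (M.cyl_cc ε)

/-- By `star_cases`, each edge of the regular neighbourhood is a segment of some subdivided edge:
the first one for a vertex star, the last one for a cylinder star, and one of the last two for a
pair star. This gives surjectivity and, with injectivity, that adjacency is reflected. -/
theorem exists_adj_toRN {C : CCC 𝒳} {S : RNStar 𝒳} (h : C ∈ S.toSet) :
    ∃ p q, M.toRN p = .inl C ∧ M.toRN q = .inr S ∧ M.subdivisionData.graph.Adj p q := by
  have hterm : ∀ C, ¬ M.Main C → ∃ ε, M.cc ε = C := fun C hC => by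
    obtain ⟨x, hx, -⟩ := M.existsUnique_term C hC
    obtain ⟨ε, -, hε⟩ := M.exists_cc_eq hx
    exact ⟨ε, hε⟩
  rcases M.star_cases S with ⟨x, rfl⟩ | ⟨Y, hY, rfl⟩ | ⟨C₀, C', hC₀, hC', hcyl, rfl⟩
  · obtain ⟨ε, rfl, rfl⟩ := M.exists_cc_eq (M.mem_vertexStar.1 h)
    have hadj := (M.subdivisionData.point_adj (Nat.zero_le (M.subdivisionData.num ε))).symm
    by_cases hm : M.Main (M.cc ε)
    · have h0 := M.num_of_main hm
      rw [M.subdivisionData.point_of_not_lt (by omega), ← M.cyl_cc] at hadj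
      exact ⟨_, _, M.toRN_of_main hm, rfl, hadj⟩
    · rw [M.subdivisionData.point_of_lt (M.num_pos hm)] at hadj
      exact ⟨_, _, M.toRN_zero _, rfl, hadj⟩
  · rw [mem_cylinderStar] at h
    obtain ⟨ε, rfl⟩ := hterm C fun hm => hY ⟨C, h, hm⟩
    obtain rfl : ε.1.2 = Y := (M.cyl_cc ε).symm.trans h
    have h1 := M.num_of_not_hasMain hY
    have hadj := M.subdivisionData.point_adj h1.ge
    have e₁ : M.subdivisionData.point ε 1 = _ := M.subdivisionData.point_of_lt (k := 0) (by omega)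
    rw [M.subdivisionData.point_of_not_lt (k := 1) (by omega), e₁] at hadj
    exact ⟨_, _, M.toRN_zero _, M.toRN_of_not_hasMain hY, hadj⟩
  · obtain ⟨ε, rfl⟩ := hterm C₀ hC₀
    have hYC' : M.cyl C' = ε.1.2 := hcyl.symm.trans (M.cyl_cc ε)
    have h2 := M.num_of_hasMain ⟨C', hYC', hC'⟩ hC₀
    rcases M.mem_pairStar.1 h with rfl | rfl
    · have hadj := M.subdivisionData.point_adj (ε := ε) (k := 0 + 1) (by omega)
      rw [M.subdivisionData.point_of_lt (k := 0) (by omega),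
        M.subdivisionData.point_of_lt (k := 0 + 1) (by omega)] at hadj
      exact ⟨_, _, M.toRN_zero _, M.toRN_one _ hC₀ hC' hcyl, hadj⟩
    · have hadj := (M.subdivisionData.point_adj (ε := ε) (k := 1 + 1) (by omega)).symm
      rw [M.subdivisionData.point_of_lt (k := 1) (by omega),
        M.subdivisionData.point_of_not_lt (k := 1 + 1) (by omega), ← hYC'] at hadj
      exact ⟨_, _, M.toRN_of_main hC', M.toRN_one _ hC₀ hC' hcyl, hadj⟩

theorem toRN_injective : Function.Injective M.toRN := by
  intro p q h
  rcases M.vertex_cases p with ⟨x, rfl, hp⟩ | ⟨C, hC, rfl, hp⟩ | ⟨Y, hY, rfl, hp⟩ |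
    ⟨ε, hk, hm, rfl, hp⟩ | ⟨ε, hk, C', hm, hC', hcyl, rfl, hp⟩ <;>
  rcases M.vertex_cases q with ⟨x', rfl, hq⟩ | ⟨D, hD, rfl, hq⟩ | ⟨Y', hY', rfl, hq⟩ |
    ⟨ε', hk', hm', rfl, hq⟩ | ⟨ε', hk', D', hm', hD', hcyl', rfl, hq⟩ <;>
  rw [hp, hq] at h <;> first | exact absurd h Sum.inl_ne_inr | exact absurd h Sum.inr_ne_inl |
    simp only [Sum.inl.injEq, Sum.inr.injEq] at h
  · rw [M.vertexStar_injective h]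
  · exact absurd h M.vertexStar_ne_cylinderStar
  · exact absurd h M.vertexStar_ne_pairStar
  · rw [h]
  · exact absurd (h ▸ hC) hm'
  · exact absurd h.symm M.vertexStar_ne_cylinderStar
  · rw [M.cylinderStar_injective h]
  · exact absurd h M.cylinderStar_ne_pairStar
  · exact absurd (h ▸ hD) hm
  · obtain rfl := M.cc_injective hm h
    rfl
  · exact absurd h.symm M.vertexStar_ne_pairStar
  · exact absurd h.symm M.cylinderStar_ne_pairStar
  · obtain rfl := M.cc_injective hm (M.pairStar_injective h)
    rfl

theorem toRN_surjective : Function.Surjective M.toRN := by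
  rintro (C | S)
  · by_cases hC : M.Main C
    · exact ⟨_, M.toRN_of_main hC⟩
    · obtain ⟨x, hx, -⟩ := M.existsUnique_term C hC
      obtain ⟨p, -, hp, -⟩ := M.exists_adj_toRN (M.mem_vertexStar.2 hx)
      exact ⟨p, hp⟩
  · obtain ⟨C, hC, -⟩ := S.toSet_nontrivial
    obtain ⟨-, q, -, hq, -⟩ := M.exists_adj_toRN hC
    exact ⟨q, hq⟩

theorem toRN_smul (g : G) (p : M.subdivisionData.Vertex) : M.toRN (g • p) = g • M.toRN p := by
  rcases M.vertex_cases p with ⟨x, rfl, hp⟩ | ⟨C, hC, rfl, hp⟩ | ⟨Y, hY, rfl, hp⟩ |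
    ⟨ε, hk, hm, rfl, hp⟩ | ⟨ε, hk, C', hm, hC', hcyl, rfl, hp⟩ <;> rw [hp]
  · refine (M.toRN_vertex (g • x)).trans (congrArg Sum.inr (RNStar.ext_toSet (Set.ext fun D => ?_)))
    rw [RNStar.mem_toSet_smul, mem_vertexStar, mem_vertexStar, term_smul_iff, inv_inv]
  · have h := M.toRN_of_main (M.main_smul g C hC)
    rw [M.cyl_smul] at h
    exact h
  · have hY' : ¬ M.HasMain (g • Y) := fun h => hY ((M.hasMain_smul_iff g).1 h)
    refine (M.toRN_of_not_hasMain hY').trans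
      (congrArg Sum.inr (RNStar.ext_toSet (Set.ext fun D => ?_)))
    rw [RNStar.mem_toSet_smul, mem_cylinderStar, mem_cylinderStar, M.cyl_smul, inv_smul_eq_iff]
  · have hk' : 0 < M.subdivisionData.num (g • ε) := by rwa [M.subdivisionData.num_smul]
    exact (M.toRN_zero hk').trans (congrArg Sum.inl (M.smul_cc ε g).symm)
  · have hk' : 1 < M.subdivisionData.num (g • ε) := by rwa [M.subdivisionData.num_smul]
    refine (M.toRN_one hk' (by rwa [← smul_cc, main_smul_iff]) (M.main_smul g C' hC')
      (by rw [← smul_cc, M.cyl_smul, hcyl, M.cyl_smul])).trans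
      (congrArg Sum.inr (RNStar.ext_toSet (Set.ext fun D => ?_)))
    rw [RNStar.mem_toSet_smul, mem_pairStar, mem_pairStar, ← smul_cc, inv_smul_eq_iff,
      inv_smul_eq_iff]

theorem toRN_adj_iff {p q : M.subdivisionData.Vertex} :
    (regularNeighbourhood 𝒳).Adj (M.toRN p) (M.toRN q) ↔ M.subdivisionData.graph.Adj p q := by
  constructor
  · intro h
    rcases hp : M.toRN p with C | S <;> rcases hq : M.toRN q with C' | S' <;> rw [hp, hq] at h
    · exact h.elim
    · obtain ⟨p', q', hp', hq', hadj⟩ := M.exists_adj_toRN h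
      rwa [M.toRN_injective (hp.trans hp'.symm), M.toRN_injective (hq.trans hq'.symm)]
    · obtain ⟨q', p', hq', hp', hadj⟩ := M.exists_adj_toRN h
      rw [M.toRN_injective (hp.trans hp'.symm), M.toRN_injective (hq.trans hq'.symm)]
      exact hadj.symm
    · exact h.elim
  · rintro h
    obtain ⟨-, ⟨ε, k, hk, rfl, rfl⟩ | ⟨ε, k, hk, rfl, rfl⟩⟩ := (SimpleGraph.fromRel_adj _ _ _).1 h
    · exact M.toRN_point_adj hk
    · exact (M.toRN_point_adj hk).symm

/-- The regular neighbourhood is a subdivision of `bipartiteGraph r`. -/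
theorem exists_iso (M : RNModel 𝒳 r) :
    ∃ (D : SubdivisionData G r) (φ : D.graph ≃g regularNeighbourhood 𝒳),
    ∀ (g : G) (x : D.Vertex), φ (g • x) = g • φ x :=
  ⟨M.subdivisionData, ⟨.ofBijective _ ⟨M.toRN_injective, M.toRN_surjective⟩, M.toRN_adj_iff⟩,
    M.toRN_smul⟩

end RNModel

end RegularNeighbourhoodModel

/-! ### Subdivisions of trees -/

/-- Each edge must be a bridge, and the witness is a set of vertices that no other edge leaves.
Exhibiting such sets avoids handling cycles in `T_c` and its subdivisions. -/
theorem SimpleGraph.isAcyclic_iff_exists_side {W : Type*} {Γ : SimpleGraph W} :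
    Γ.IsAcyclic ↔ ∀ u v, Γ.Adj u v → ∃ S : Set W, u ∈ S ∧ v ∉ S ∧
      ∀ a b, Γ.Adj a b → s(a, b) ≠ s(u, v) → a ∈ S → b ∈ S := by
  rw [SimpleGraph.isAcyclic_iff_forall_adj_isBridge]
  refine forall₃_congr fun u v huv => ?_
  rw [SimpleGraph.isBridge_iff]
  constructor
  · intro h
    refine ⟨{w | (Γ.deleteEdges {s(u, v)}).Reachable u w}, .refl _, h, fun a b hab hne ha => ?_⟩
    refine SimpleGraph.Reachable.trans ha (SimpleGraph.Adj.reachable ?_)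
    rw [SimpleGraph.deleteEdges_adj]
    exact ⟨hab, hne⟩
  · rintro ⟨S, hu, hv, h⟩ ⟨p⟩
    have key : ∀ {a b : W}, (Γ.deleteEdges {s(u, v)}).Walk a b → a ∈ S → b ∈ S := by
      intro a b p
      induction p with
      | nil => exact id
      | cons hadj p ih =>
        rw [SimpleGraph.deleteEdges_adj] at hadj
        exact fun ha => ih (h _ _ hadj.1 hadj.2 ha)
    exact hv (key p hu)

/-- The relation `R` orients the edges; asking that sides be preserved in both directions makes it
enough to check each edge in one orientation. -/
theorem SimpleGraph.IsAcyclic.of_exists_side {W : Type*} {Γ : SimpleGraph W}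
    (R : W → W → Prop) (hR : ∀ u v, Γ.Adj u v → R u v ∨ R v u)
    (h : ∀ u v, R u v → ∃ S : Set W, u ∈ S ∧ v ∉ S ∧
      ∀ a b, R a b → s(a, b) ≠ s(u, v) → (a ∈ S ↔ b ∈ S)) : Γ.IsAcyclic := by
  have key : ∀ {S : Set W} {u v : W}, (∀ a b, R a b → s(a, b) ≠ s(u, v) → (a ∈ S ↔ b ∈ S)) →
      ∀ a b, Γ.Adj a b → s(a, b) ≠ s(u, v) → (a ∈ S ↔ b ∈ S) := by
    intro S u v hS a b hab hne
    rcases hR a b hab with h' | h'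
    · exact hS a b h' hne
    · exact (hS b a h' (by rwa [Sym2.eq_swap])).symm
  refine SimpleGraph.isAcyclic_iff_exists_side.2 fun u v huv => ?_
  rcases hR u v huv with h' | h'
  · obtain ⟨S, hu, hv, hS⟩ := h u v h'
    exact ⟨S, hu, hv, fun a b hab hne => (key hS a b hab hne).1⟩
  · obtain ⟨S, hv, hu, hS⟩ := h v u h'
    refine ⟨Sᶜ, hu, fun h => h hv, fun a b hab hne ha hb => ha ?_⟩
    exact (key hS a b hab (by rwa [Sym2.eq_swap (a := v)])).2 hb

namespace SubdivisionData

variable {G A B : Type*} [Group G] [MulAction G A] [MulAction G B] {r : A → B → Prop}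
  [InvariantRel G r] (D : SubdivisionData G r) {ε : BipEdge r} {k : ℕ}

theorem point_reachable (hk : k ≤ D.num ε + 1) :
    D.graph.Reachable (.inl (.inl ε.1.1)) (D.point ε k) := by
  induction k with
  | zero => exact .refl _
  | succ k ih => exact (ih (by omega)).trans (D.point_adj (by omega)).reachable

theorem graph_connected (h : (bipartiteGraph r).Connected) : D.graph.Connected := by
  have h₁ : ∀ ε : BipEdge r, D.graph.Reachable (.inl (.inl ε.1.1)) (.inl (.inr ε.1.2)) :=
      fun ε => by
    have := D.point_reachable (ε := ε) le_rfl
    rwa [D.point_of_not_lt (lt_irrefl _)] at this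
  have h₂ : ∀ u v, D.graph.Reachable (.inl u) (.inl v) := by
    intro u v
    obtain ⟨p⟩ := h.preconnected u v
    induction p with
    | nil => exact .refl _
    | @cons u w v hadj p ih =>
      refine .trans ?_ ih
      rcases u with a | b <;> rcases w with a' | b'
      · exact hadj.elim
      · exact h₁ ⟨(a, b'), hadj⟩
      · exact (h₁ ⟨(a', b), hadj⟩).symm
      · exact hadj.elim
  have h₃ : ∀ p, ∃ u, D.graph.Reachable p (.inl u) := by
    rintro (u | ⟨⟨ε, k⟩, hk⟩)
    · exact ⟨u, .refl _⟩
    · refine ⟨.inl ε.1.1, ?_⟩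
      have hk' : k < D.num ε := hk
      have := D.point_reachable (ε := ε) (k := k + 1) (by omega)
      rw [D.point_of_lt hk'] at this
      exact this.symm
  have : Nonempty D.Vertex := h.nonempty.map .inl
  refine ⟨fun p q => ?_⟩
  obtain ⟨u, hu⟩ := h₃ p
  obtain ⟨v, hv⟩ := h₃ q
  exact hu.trans ((h₂ u v).trans hv.symm)

theorem graph_isAcyclic (h : (bipartiteGraph r).IsAcyclic) : D.graph.IsAcyclic := by
  refine .of_exists_side _ (fun u v huv => ((SimpleGraph.fromRel_adj _ _ _).1 huv).2) ?_
  rintro _ _ ⟨ε, k, hk, rfl, rfl⟩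
  obtain ⟨S, hS₁, hS₂, hS⟩ :=
    SimpleGraph.isAcyclic_iff_exists_side.1 h (.inl ε.1.1) (.inr ε.1.2) ε.2
  have hS' : ∀ ε' : BipEdge r, ε' ≠ ε → (Sum.inl ε'.1.1 ∈ S ↔ Sum.inr ε'.1.2 ∈ S) := by
    intro ε' hne
    have hne' : s((Sum.inl ε'.1.1 : A ⊕ B), Sum.inr ε'.1.2) ≠ s(Sum.inl ε.1.1, Sum.inr ε.1.2) := by
      intro he
      rw [Sym2.eq_iff] at he
      rcases he with he | he
      · exact hne (Subtype.ext (Prod.ext (Sum.inl_injective he.1) (Sum.inr_injective he.2)))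
      · exact Sum.inl_ne_inr he.1
    have hadj : (bipartiteGraph r).Adj (.inl ε'.1.1) (.inr ε'.1.2) := ε'.2
    exact ⟨hS _ _ hadj hne', hS _ _ hadj.symm (by rwa [Sym2.eq_swap])⟩
  -- A side `S` of `ε` is extended to a side of the `k`-th segment of `ε`: new vertices on other
  -- edges follow the ends of their edge, and those on `ε` are cut after position `k`. The new
  -- vertex of index `j` is at position `j + 1`, hence the strict inequality.
  let P : D.Vertex → Prop
    | .inl u => u ∈ S
    | .inr q => (q.1.1 = ε ∧ q.1.2 < k) ∨ (q.1.1 ≠ ε ∧ Sum.inl q.1.1.1.1 ∈ S)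
  have hP₁ : ∀ j, j ≤ D.num ε + 1 → (P (D.point ε j) ↔ j ≤ k) := by
    intro j hj
    rcases j with - | j
    · exact ⟨fun _ => k.zero_le, fun _ => hS₁⟩
    · by_cases hj' : j < D.num ε
      · rw [D.point_of_lt hj']
        refine ⟨?_, fun h => .inl ⟨rfl, h⟩⟩
        rintro (h | h)
        · exact h.2
        · exact absurd rfl h.1
      · rw [D.point_of_not_lt hj']
        exact ⟨fun h => absurd h hS₂, fun h => by omega⟩
  have hP₂ : ∀ ε' ≠ ε, ∀ j, P (D.point ε' j) ↔ Sum.inl ε'.1.1 ∈ S := by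
    intro ε' hne j
    rcases j with - | j
    · exact Iff.rfl
    · by_cases hj' : j < D.num ε'
      · rw [D.point_of_lt hj']
        exact ⟨fun h => (h.resolve_left fun h => hne h.1).2, fun h => .inr ⟨hne, h⟩⟩
      · rw [D.point_of_not_lt hj']
        exact (hS' ε' hne).symm
  refine ⟨{p | P p}, (hP₁ k (by omega)).2 le_rfl, fun h => ?_, ?_⟩
  · have := (hP₁ (k + 1) (by omega)).1 h
    omega
  · rintro _ _ ⟨ε', j, hj, rfl, rfl⟩ hne
    by_cases hε : ε' = ε
    · subst hε
      have hjk : j ≠ k := fun h => hne (h ▸ rfl)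
      refine (hP₁ j (by omega)).trans (Iff.trans ?_ (hP₁ (j + 1) (by omega)).symm)
      omega
    · exact (hP₂ ε' hε j).trans (hP₂ ε' hε (j + 1)).symm

theorem graph_isTree (h : (bipartiteGraph r).IsTree) : D.graph.IsTree :=
  ⟨D.graph_connected h.connected, D.graph_isAcyclic h.isAcyclic⟩

end SubdivisionData

namespace GTree

variable {G V : Type*} [Group G] [MulAction G V] {T : GTree G V} {Y Y' : Set (Sym2 V)} {v₀ : V}

/-! ### The tree of cylinders -/

/-- The path from `a` to `b` stays in `Y`, and distinct cylinders have no common edge. -/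
theorem HasConvexCylinders.reachable_deleteEdges (hC : T.HasConvexCylinders) (hY : T.IsCylinder Y)
    (hY' : T.IsCylinder Y') (hne : Y ≠ Y') {a b : V} (ha : VertexMem a Y) (hb : VertexMem b Y) :
    (T.graph.deleteEdges Y').Reachable a b := by
  obtain ⟨p, hp⟩ := (T.isTree.connected.preconnected a b).exists_isPath
  exact (p.toDeleteEdges Y' fun e he he' =>
    hne (hY.eq_of_mem hY' (hC Y hY a b ha hb p hp e he) he')).reachable

theorem treeOfCylinders_isAcyclic (hC : T.HasConvexCylinders) :
    (bipartiteGraph T.cylinderIncidence).IsAcyclic := by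
  let R : T.V₀ ⊕ T.V₁ → T.V₀ ⊕ T.V₁ → Prop := fun u v =>
    ∃ x Y, T.cylinderIncidence x Y ∧ u = .inl x ∧ v = .inr Y
  refine .of_exists_side R ?_ ?_
  · rintro (x | Y) (x' | Y') h
    · exact h.elim
    · exact .inl ⟨x, Y', h, rfl, rfl⟩
    · exact .inr ⟨x', Y, h, rfl, rfl⟩
    · exact h.elim
  · rintro _ _ ⟨x, Y, hxY, rfl, rfl⟩
    -- The side of the edge `(x, Y)` consists of what lies in the component of `x` in `T` minus `Y`:
    -- vertices in it, and cylinders other than `Y` contained in it.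
    let P : T.V₀ ⊕ T.V₁ → Prop
      | .inl x' => x'.1 ∈ T.component Y.1 x.1
      | .inr Y' => Y' ≠ Y ∧ ∀ y, VertexMem y Y'.1 → y ∈ T.component Y.1 x.1
    refine ⟨{p | P p}, mem_component_self _, fun h => h.1 rfl, ?_⟩
    rintro _ _ ⟨x', Y', hxY', rfl, rfl⟩ hne
    by_cases hY : Y' = Y
    · subst hY
      refine ⟨fun h => absurd ?_ hne, fun h => absurd rfl h.1⟩
      have : x = x' := Subtype.ext (hC.eq_of_reachable Y'.2 hxY hxY' h)
      rw [this]
    · have hne' : Y'.1 ≠ Y.1 := fun h => hY (Subtype.ext h)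
      exact ⟨fun h => ⟨hY, fun y hy => SimpleGraph.Reachable.trans h
        (hC.reachable_deleteEdges Y'.2 Y.2 hne' hxY' hy)⟩, fun h => h.2 _ hxY'⟩

/-- Along a walk in `T`, consecutive edges are in the same cylinder or in two cylinders that share a
vertex, which is then in `T.V₀`. A second vertex is required for a cylinder to exist. -/
theorem treeOfCylinders_connected [Nontrivial V] :
    (bipartiteGraph T.cylinderIncidence).Connected := by
  have hedge : ∀ {v w : V}, T.graph.Adj v w → ∃ Y : T.V₁, VertexMem v Y.1 ∧ VertexMem w Y.1 := by
    intro v w h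
    obtain ⟨Y, hY, he⟩ := IsCylinder.exists_mem_of_mem_edgeSet (T := T) (e := s(v, w)) h
    exact ⟨⟨Y, hY⟩, ⟨_, he, by simp⟩, ⟨_, he, by simp⟩⟩
  have hvert : ∀ {v : V} {Y Y' : T.V₁}, VertexMem v Y.1 → VertexMem v Y'.1 →
      (bipartiteGraph T.cylinderIncidence).Reachable (.inr Y) (.inr Y') := by
    intro v Y Y' h h'
    by_cases hne : Y = Y'
    · rw [hne]
    · let x : T.V₀ := ⟨v, Y.1, Y'.1, Y.2, Y'.2, fun h => hne (Subtype.ext h), h, h'⟩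
      have a₁ : (bipartiteGraph T.cylinderIncidence).Adj (.inr Y) (.inl x) := h
      have a₂ : (bipartiteGraph T.cylinderIncidence).Adj (.inl x) (.inr Y') := h'
      exact a₁.reachable.trans a₂.reachable
  have hcyl : ∀ Y Y' : T.V₁,
      (bipartiteGraph T.cylinderIncidence).Reachable (.inr Y) (.inr Y') := by
    intro Y Y'
    obtain ⟨v, hv⟩ := Y.2.exists_vertexMem
    obtain ⟨w, hw⟩ := Y'.2.exists_vertexMem
    obtain ⟨p⟩ := T.isTree.connected.preconnected v w
    induction p generalizing Y with
    | nil => exact hvert hv hw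
    | cons hadj p ih =>
      obtain ⟨Y'', h₁, h₂⟩ := hedge hadj
      exact (hvert hv h₁).trans (ih Y'' h₂ hw)
  have hinr : ∀ u, ∃ Y, (bipartiteGraph T.cylinderIncidence).Reachable u (.inr Y) := by
    rintro (x | Y)
    · obtain ⟨Y, Y', hY, -, -, hx, -⟩ := x.2
      have a : (bipartiteGraph T.cylinderIncidence).Adj (.inl x) (.inr ⟨Y, hY⟩) := hx
      exact ⟨_, a.reachable⟩
    · exact ⟨Y, .refl _⟩
  obtain ⟨v, w, hne⟩ := exists_pair_ne V
  obtain ⟨p⟩ := T.isTree.connected.preconnected v w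
  obtain ⟨z, hadj, -⟩ := SimpleGraph.Walk.exists_eq_cons_of_ne hne p
  obtain ⟨Y, -⟩ := hedge hadj
  have : Nonempty (T.V₀ ⊕ T.V₁) := ⟨.inr Y⟩
  refine ⟨fun u v => ?_⟩
  obtain ⟨Y₁, h₁⟩ := hinr u
  obtain ⟨Y₂, h₂⟩ := hinr v
  exact h₁.trans ((hcyl Y₁ Y₂).trans h₂.symm)

theorem treeOfCylinders_isTree [Nontrivial V] (hC : T.HasConvexCylinders) :
    (bipartiteGraph T.cylinderIncidence).IsTree :=
  ⟨treeOfCylinders_connected, treeOfCylinders_isAcyclic hC⟩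

/-! ### The regular neighbourhood of the sets based on a tree -/

theorem exists_cccCyl_eq (hT : T.IsMinimal) (hC : T.HasConvexCylinders) (v₀ : V) (Y : T.V₁) :
    ∃ C : CCC (T.based v₀), cccCyl C = Y := by
  obtain ⟨Y, hY⟩ := Y
  obtain ⟨e, he⟩ := hY.nonempty
  induction e with
  | h a b =>
    have hab : T.graph.Adj a b := hY.subset_edgeSet he
    let c : Cut T v₀ := ⟨Y, hY, T.halfTree a b, .halfTree hab he, hT.not_small_halfTree hY hab, by
      rw [compl_halfTree hab]
      exact hT.not_small_halfTree hY hab.symm⟩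
    exact ⟨c.ccc, cccCyl_ccc hC c⟩

/-- The cross-connected components of the sets based on a tree, and the tree of cylinders. -/
noncomputable def rnModel [Group.FG G] (hT : T.IsMinimal) (hC : T.HasConvexCylinders) (v₀ : V) :
    RNModel (T.based v₀) T.cylinderIncidence where
  cyl := cccCyl
  Main := IsMain
  Term x C := IsTerminal x.1 C
  cyl_smul := cccCyl_smul hC
  main_smul g _ h := h.smul hC g
  term_smul g _ _ h := h.smul hC g
  rel_of_term _ _ h := h.1
  existsUnique_cyl x Y h := by
    obtain ⟨C, ⟨h₁, h₂⟩, huniq⟩ := existsUnique_isTerminal hT hC v₀ Y.2 h x.2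
    exact ⟨C, ⟨Subtype.ext h₁, h₂⟩, fun C' h' => huniq C' ⟨congrArg Subtype.val h'.1, h'.2⟩⟩
  existsUnique_term C hCm := by
    obtain ⟨x, ⟨hx, hxC⟩, huniq⟩ := existsUnique_isTerminal_of_not_isMain hT hC hCm
    exact ⟨⟨x, hx⟩, hxC, fun y hy => Subtype.ext (huniq y.1 ⟨y.2, hy⟩)⟩
  main_unique _ _ h h' hcyl := h.eq hC h' hcyl
  exists_main_or Y := by
    obtain ⟨C, rfl⟩ := exists_cccCyl_eq hT hC v₀ Y
    by_cases h : IsMain C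
    · exact .inl ⟨C, rfl, h⟩
    · obtain ⟨C', hC', hne⟩ : ∃ C' : CCC (T.based v₀), cccCyl C' = cccCyl C ∧ C' ≠ C := by
        by_contra! h'
        exact h (.inr h')
      exact .inr ⟨C, C', hne.symm, rfl, hC'⟩
  exists_rel_rel x := by
    obtain ⟨Y, Y', hY, hY', hne, hx, hx'⟩ := x.2
    exact ⟨⟨Y, hY⟩, ⟨Y', hY'⟩, fun h => hne (congrArg Subtype.val h), hx, hx'⟩
  eq_of_rel x x' Y Y' hne h₁ h₂ h₁' h₂' := Subtype.ext <| hC.eq_of_reachable Y'.2 h₂ h₂' <|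
    hC.reachable_deleteEdges Y.2 Y'.2 (fun h => hne (Subtype.ext h)) h₁ h₁'
  -- Going from `x` to `x₂` inside `Y₂` and from `x₂` to `x₁` inside `Y` uses no edge of `Y₁`,
  -- whereas `x` and `x₁` are both vertices of `Y₁`.
  eq_of_triangle x x₁ x₂ Y Y₁ Y₂ h₁₂ h₁ h₂ r₁ r₂ r₁' r r₂' r' :=
    Subtype.ext <| hC.eq_of_reachable Y₁.2 r₁ r₁' <|
      (hC.reachable_deleteEdges Y₂.2 Y₁.2 (fun h => h₁₂ (Subtype.ext h.symm)) r₂ r₂').trans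
        (hC.reachable_deleteEdges Y.2 Y₁.2 (fun h => h₁ (Subtype.ext h.symm)) r' r)
  close_iff_of_eq _ _ hne hcyl := close_iff_of_cyl_eq hC hne hcyl
  close_iff_of_ne C C' hcyl := by
    have hcyl' : (cccCyl C).1 ≠ (cccCyl C').1 := fun h => hcyl (Subtype.ext h)
    rw [close_iff_of_cyl_ne hT hC hcyl']
    refine ⟨fun ⟨x, h, h'⟩ => ⟨⟨x, _, _, (cccCyl C).2, (cccCyl C').2, hcyl', h.1, h'.1⟩, h, h'⟩,
      fun ⟨x, h, h'⟩ => ⟨x.1, h, h'⟩⟩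

end GTree

theorem theorem2 {G V : Type*} [Group G] [Group.FG G] [MulAction G V]
    (𝓔 : Set (Subgroup G)) (h𝓔 : IsCylinderFamily 𝓔)
    (T : GTree G V) (hTmin : T.IsMinimal) (hT𝓔 : T.IsTreeOver 𝓔) (v₀ : V) :
    (∃ (D : SubdivisionData G T.cylinderIncidence)
        (φ : D.graph ≃g regularNeighbourhood (T.based v₀)),
        ∀ (g : G) (x : D.Vertex), φ (g • x) = g • φ x) ∧
      (Nontrivial V → (regularNeighbourhood (T.based v₀)).IsTree) := by
  have hC := hT𝓔.hasConvexCylinders h𝓔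
  obtain ⟨D, φ, hφ⟩ := (GTree.rnModel hTmin hC v₀).exists_iso
  exact ⟨⟨D, φ, hφ⟩, fun _ => φ.isTree_iff.1 (D.graph_isTree (GTree.treeOfCylinders_isTree hC))⟩
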